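/- Let $(M^{4n},I,J,K)$ be a hypercomplex manifold: a smooth manifold of real dimension $4n$ with complex structures $I,J,K$ (integrable almost complex structures) acting on the right on $TM$, with $IJ=-JI=K$. All forms have complex coefficients. Quaternions act on the left on $1$-forms by $(g\alpha)(X)=\alpha(X\cdot g)$, and the group $SU(2)$ of unit quaternions, as well as $J$ and $J^{-1}$, act multiplicatively on all forms. For each $m$ let $\Lambda^m_+(M)\subset\Lambda^m(M)$ be the part of weight $m$ under $SU(2)$ (the sum of the $SU(2)$-subspaces isomorphic to the $m$-th symmetric power of the standard representation $\mathbb C^2$), and let $V^m$ be the sum of the parts of weight $<m$. Let $\Lambda^{p,q}_I(M)$ be the forms of Hodge type $(p,q)$ with respect to $I$, and $\Lambda^{p,q}_{I,+}(M)=\Lambda^{p+q}_+(M)\cap\Lambda^{p,q}_I(M)$. Then $\Lambda^m(M)=\Lambda^m_+(M)\oplus V^m$, and each $\Lambda^m(M)$ is the direct sum of $\Lambda^{p,q}_I(M)$ and the sum of the spaces of forms of the other types. Let $d_+$ be the de Rham differential followed by the projection $\Lambda^{m+1}(M)\to\Lambda^{m+1}_+(M)$ along $V^{m+1}$, let $\partial,\bar\partial$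 be the Dolbeault operators of $(M,I)$, and let $\partial_J=J^{-1}\circ\bar\partial\circ J:\Lambda^{m,0}_I(M)\to\Lambda^{m+1,0}_I(M)$. For all $p,q\ge 0$, with $m=p+q$, the $\mathbb C$-linear bundle map $\Phi_{p,q}$ given on $\Lambda^{m,0}_I$ by multiplication by $h_1^ph_2^q$, $$\Phi_{p,q}(\eta_1\wedge\dots\wedge\eta_m)=\frac1{m!}\sum_{\sigma\in\Sigma_m}(a_{\sigma(1)}\eta_1)\wedge\dots\wedge(a_{\sigma(m)}\eta_m),\qquad a_1=\dots=a_p=1,\ a_{p+1}=\dots=a_m=J,$$ is an isomorphism $$\Phi_{p,q}:\Lambda^{p+q,0}_I(M)\xrightarrow{\ \sim\ }\Lambda^{p,q}_{I,+}(M),$$ both on each fibre and on smooth forms. Under this identification $d_+:\Lambda^{p,q}_{I,+}(M)\to\Lambda^{p+1,q}_{I,+}(M)\oplus\Lambda^{p,q+1}_{I,+}(M)$ corresponds to $\partial\oplus\partial_J:\Lambda^{p+q,0}_I(M)\to\Lambda^{p+q+1,0}_I(M)\oplus\Lambda^{p+q+1,0}_I(M)$; that is, for every smooth $\eta\in\Lambda^{p+q,0}_I(M)$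 the forms $\partial\eta$ and $\partial_J\eta$ are smooth of type $(p+q+1,0)$ and $$d_+\big(\Phi_{p,q}(\eta)\big)=\Phi_{p+1,q}(\partial\eta)+\Phi_{p,q+1}(\partial_J\eta).$$ -/

import Mathlib

open scoped Manifold ContDiff Quaternion

noncomputable section

namespace Hypercomplex

/-! ### Linear algebra on one tangent space

`V` is a real topological vector space (a tangent space), and the space of complex valued `m`-forms
on `V` is `V [⋀^Fin m]→L[ℝ] ℂ`. Quaternions act on `V` on the right, so that an operator written
`I v` is the vector `v · I`; they act on forms on the left by `(g · α)(v₁, …) = α(v₁ · g, …)`. -/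

section LinearAlgebra

variable {V : Type*} [AddCommGroup V] [Module ℝ V] [TopologicalSpace V]
  [IsTopologicalAddGroup V] [ContinuousSMul ℝ V]

/-- Pullback of complex valued forms by a real linear endomorphism, applied in every slot. It is
multiplicative for the wedge product, and it is the identity on `0`-forms. -/
def pull (m : ℕ) (L : V →L[ℝ] V) :
    (V [⋀^Fin m]→L[ℝ] ℂ) →ₗ[ℂ] (V [⋀^Fin m]→L[ℝ] ℂ) where
  toFun α := α.compContinuousLinearMap L
  map_add' _ _ := rfl
  map_smul' _ _ := rfl

/-- The `(p,q)`-forms of degree `m` with respect to an operator `I` with `I² = -1`: the forms `α`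
with `α(z v₁, …, z vₘ) = z ^ p * (conj z) ^ q * α(v₁, …, vₘ)` for every complex number `z`, acting
on `V` through `I`. It is `0` unless `p + q = m`. -/
def typeForms (I : V →L[ℝ] V) (m p q : ℕ) : Submodule ℂ (V [⋀^Fin m]→L[ℝ] ℂ) where
  carrier := {α | ∀ (z : ℂ) (v : Fin m → V),
    α (fun i => z.re • v i + z.im • I (v i)) = z ^ p * (starRingEnd ℂ z) ^ q * α v}
  add_mem' := by
    intro a b ha hb z v
    simp only [ContinuousAlternatingMap.add_apply]
    rw [ha z v, hb z v]; ring
  zero_mem' := by intro z v; simp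
  smul_mem' := by
    intro c a ha z v
    simp only [ContinuousAlternatingMap.smul_apply, smul_eq_mul]
    rw [ha z v]; ring

/-- The sum of all the spaces of forms of a type other than `(p,q)`. -/
def otherTypeForms (I : V →L[ℝ] V) (m p q : ℕ) : Submodule ℂ (V [⋀^Fin m]→L[ℝ] ℂ) :=
  ⨆ (r : ℕ × ℕ) (_ : r ≠ (p, q)), typeForms I m r.1 r.2

open Classical in
/-- The projection of `W` onto `A` along `B`, when `W = A ⊕ B`. -/
def projAlong {W : Type*} [AddCommGroup W] [Module ℂ W] (A B : Submodule ℂ W) : W →ₗ[ℂ] W :=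
  if h : IsCompl A B then A.projection B h else 0

/-- The right action of a quaternion `a + b i + c j + d k` on `V`, for operators `I, J, K`. -/
def rightMul (I J K : V →L[ℝ] V) (g : ℍ[ℝ]) : V →L[ℝ] V :=
  g.re • ContinuousLinearMap.id ℝ V + g.imI • I + g.imJ • J + g.imK • K

/-- The action of a quaternion `g = a + b i + c j + d k` on polynomials in two variables
`h₁ = X 0` and `h₂ = X 1` by linear substitution. On linear forms this is left multiplication by `g`
on the quaternions, seen as a complex vector space through right multiplication by `i`, in the
basis `h₁ = 1`, `h₂ = j`: indeed `g * 1 = 1 * (a + b i) + j * (c - d i)` and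
`g * j = 1 * (-c - d i) + j * (a - b i)`. On homogeneous polynomials of degree `k` it is the `k`-th
symmetric power of that representation. -/
def symAct (g : ℍ[ℝ]) : MvPolynomial (Fin 2) ℂ →ₐ[ℂ] MvPolynomial (Fin 2) ℂ :=
  MvPolynomial.aeval
    ![MvPolynomial.C (⟨g.re, g.imI⟩ : ℂ) * MvPolynomial.X 0
        + MvPolynomial.C (⟨g.imJ, -g.imK⟩ : ℂ) * MvPolynomial.X 1,
      MvPolynomial.C (⟨-g.imJ, -g.imK⟩ : ℂ) * MvPolynomial.X 0
        + MvPolynomial.C (⟨g.re, -g.imI⟩ : ℂ) * MvPolynomial.X 1]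

/-- The part of weight `k` of the `m`-forms under `SU(2)`, the group of unit quaternions: the sum
of all the invariant subspaces isomorphic to the irreducible representation of weight `k`, which is
the `k`-th symmetric power of the standard one; equivalently the sum of the images of all
equivariant linear maps from that symmetric power. -/
def weightForms (I J K : V →L[ℝ] V) (m k : ℕ) : Submodule ℂ (V [⋀^Fin m]→L[ℝ] ℂ) :=
  ⨆ (T : MvPolynomial (Fin 2) ℂ →ₗ[ℂ] (V [⋀^Fin m]→L[ℝ] ℂ))
    (_ : ∀ g : ℍ[ℝ], ‖g‖ = 1 → ∀ P ∈ MvPolynomial.homogeneousSubmodule (Fin 2) ℂ k,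
      T (symAct g P) = pull m (rightMul I J K g) (T P)),
    (MvPolynomial.homogeneousSubmodule (Fin 2) ℂ k).map T

/-- `Λ^m_+`: the part of maximal weight `m` of the `m`-forms. -/
def plusForms (I J K : V →L[ℝ] V) (m : ℕ) : Submodule ℂ (V [⋀^Fin m]→L[ℝ] ℂ) :=
  weightForms I J K m m

/-- The sum of the parts of weight less than `m` of the `m`-forms. -/
def lowForms (I J K : V →L[ℝ] V) (m : ℕ) : Submodule ℂ (V [⋀^Fin m]→L[ℝ] ℂ) :=
  ⨆ (k : ℕ) (_ : k < m), weightForms I J K m k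

/-- `Λ^{p,q}_{I,+}` in degree `m = p + q`: the part of type `(p,q)` of `Λ^m_+`. -/
def plusTypeForms (I J K : V →L[ℝ] V) (m p q : ℕ) : Submodule ℂ (V [⋀^Fin m]→L[ℝ] ℂ) :=
  plusForms I J K m ⊓ typeForms I m p q

/-- Multiplication by `h₁ ^ p * h₂ ^ (m - p)` on `m`-forms, where `h₁` acts on a covector as the
identity and `h₂` acts as `J`. It is the map
`η₁ ∧ … ∧ ηₘ ↦ (1 / m!) ∑ σ, (a (σ 1) η₁) ∧ … ∧ (a (σ m) ηₘ)`, where `a i = 1` for the first `p`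
indices and `a i = J` for the `m - p` other ones; on an arbitrary form,
`η ↦ (1 / m!) ∑ σ, η (v₁ · a (σ 1), …, vₘ · a (σ m))`, see `hMul_apply`. -/
def hMul (J : V →L[ℝ] V) (m p : ℕ) :
    (V [⋀^Fin m]→L[ℝ] ℂ) →ₗ[ℂ] (V [⋀^Fin m]→L[ℝ] ℂ) where
  toFun η := ((m.factorial : ℂ)⁻¹) • ContinuousMultilinearMap.alternatization
    (η.toContinuousMultilinearMap.compContinuousLinearMap
      (fun i : Fin m => if i.val < p then ContinuousLinearMap.id ℝ V else J))
  map_add' a b := by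
    ext v
    simp [ContinuousMultilinearMap.alternatization_apply_apply, mul_add, Finset.sum_add_distrib]
  map_smul' c a := by
    ext v
    simp only [ContinuousAlternatingMap.smul_apply, RingHom.id_apply, smul_eq_mul,
      ContinuousMultilinearMap.alternatization_apply_apply, Finset.mul_sum]
    refine Finset.sum_congr rfl fun σ _ => ?_
    simp [Units.smul_def]
    ring

theorem hMul_apply (J : V →L[ℝ] V) (m p : ℕ) (η : V [⋀^Fin m]→L[ℝ] ℂ) (v : Fin m → V) :
    hMul J m p η v = (m.factorial : ℂ)⁻¹ * ∑ σ : Equiv.Perm (Fin m),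
      η (fun i => if (σ i).val < p then v i else J (v i)) := by
  have key : ∀ σ : Equiv.Perm (Fin m),
      Equiv.Perm.sign σ • η (fun i => if i.val < p then v (σ i) else J (v (σ i)))
        = η (fun i => if (σ⁻¹ i).val < p then v i else J (v i)) := by
    intro σ
    have h := η.toAlternatingMap.map_perm
      (fun i => if (σ⁻¹ i).val < p then v i else J (v i)) σ
    have h2 : ((fun i => if (σ⁻¹ i).val < p then v i else J (v i)) ∘ σ)
        = (fun i => if i.val < p then v (σ i) else J (v (σ i))) := by
      funext i; simp
    rw [h2] at h
    have h3 : η (fun i => if i.val < p then v (σ i) else J (v (σ i)))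
        = Equiv.Perm.sign σ • η (fun i => if (σ⁻¹ i).val < p then v i else J (v i)) := h
    rw [h3, smul_smul, Int.units_mul_self, one_smul]
  rw [← Equiv.sum_comp (Equiv.inv (Equiv.Perm (Fin m)))]
  simp only [hMul, LinearMap.coe_mk, AddHom.coe_mk, ContinuousAlternatingMap.smul_apply,
    ContinuousMultilinearMap.alternatization_apply_apply, smul_eq_mul, Equiv.inv_apply]
  congr 1
  refine Finset.sum_congr rfl fun σ _ => ?_
  rw [← key σ]
  congr 1
  simp only [ContinuousMultilinearMap.compContinuousLinearMap_apply]
  change η _ = η _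
  congr 1
  funext i
  split_ifs <;> rfl

end LinearAlgebra

/-! ### Differential forms and the de Rham differential on a manifold -/

section Manifold

variable {E : Type*} [NormedAddCommGroup E] [NormedSpace ℝ E]
  {M : Type*} [TopologicalSpace M] [ChartedSpace E M]

/-- Complex valued differential forms of degree `m`, not necessarily smooth. -/
abbrev Form (E : Type*) [NormedAddCommGroup E] [NormedSpace ℝ E]
    (M : Type*) [TopologicalSpace M] [ChartedSpace E M] (m : ℕ) : Type _ :=
  ∀ x : M, (TangentSpace 𝓘(ℝ, E) x) [⋀^Fin m]→L[ℝ] ℂ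

/-- Fields of endomorphisms of the tangent bundle, not necessarily smooth. -/
abbrev EndField (E : Type*) [NormedAddCommGroup E] [NormedSpace ℝ E]
    (M : Type*) [TopologicalSpace M] [ChartedSpace E M] : Type _ :=
  ∀ x : M, (TangentSpace 𝓘(ℝ, E) x) →L[ℝ] (TangentSpace 𝓘(ℝ, E) x)

/-- The expression of a form in the preferred chart at `x₀`: the pullback of the form by the inverse
of the chart. It is meaningful on the target of the chart, an open subset of `E`. -/
def localForm {m : ℕ} (β : Form E M m) (x₀ : M) : E → E [⋀^Fin m]→L[ℝ] ℂ := fun y =>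
  (β ((extChartAt 𝓘(ℝ, E) x₀).symm y)).compContinuousLinearMap
    (mfderiv 𝓘(ℝ, E) 𝓘(ℝ, E) (extChartAt 𝓘(ℝ, E) x₀).symm y :
      E →L[ℝ] TangentSpace 𝓘(ℝ, E) ((extChartAt 𝓘(ℝ, E) x₀).symm y))

/-- A form is smooth if its expressions in charts are. -/
def IsSmooth {m : ℕ} (β : Form E M m) : Prop :=
  ∀ x₀ : M, ContDiffOn ℝ ∞ (localForm β x₀) (extChartAt 𝓘(ℝ, E) x₀).target

/-- The de Rham differential, computed at `x` in the preferred chart at `x`. -/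
def deRham {m : ℕ} (β : Form E M m) : Form E M (m + 1) := fun x =>
  (extDeriv (localForm β x) (extChartAt 𝓘(ℝ, E) x x)).compContinuousLinearMap
    (mfderiv 𝓘(ℝ, E) 𝓘(ℝ, E) (extChartAt 𝓘(ℝ, E) x) x : TangentSpace 𝓘(ℝ, E) x →L[ℝ] E)

/-- The operator `∂` on `(p,q)`-forms: the component of type `(p+1,q)` of the differential. -/
def del (I : EndField E M) {m : ℕ} (p q : ℕ) (β : Form E M m) : Form E M (m + 1) := fun x =>
  projAlong (typeForms (I x) (m + 1) (p + 1) q) (otherTypeForms (I x) (m + 1) (p + 1) q)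
    (deRham β x)

/-- The operator `∂̄` on `(p,q)`-forms: the component of type `(p,q+1)` of the differential. -/
def delbar (I : EndField E M) {m : ℕ} (p q : ℕ) (β : Form E M m) : Form E M (m + 1) := fun x =>
  projAlong (typeForms (I x) (m + 1) p (q + 1)) (otherTypeForms (I x) (m + 1) p (q + 1))
    (deRham β x)

/-- The operator `∂_J = J⁻¹ ∘ ∂̄ ∘ J` on forms of type `(m,0)`. Here `J` acts on forms
multiplicatively and exchanges the types `(m,0)` and `(0,m)`, and `J⁻¹ = -J` on vectors. -/
def delJ (I J : EndField E M) {m : ℕ} (β : Form E M m) : Form E M (m + 1) := fun x =>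
  pull (m + 1) (-(J x)) (delbar I 0 m (fun y => pull m (J y) (β y)) x)

/-- The quaternionic Dolbeault differential `d_+`: the de Rham differential followed by the
projection onto `Λ^{m+1}_+` along the sum of the parts of smaller weight. -/
def dPlus (I J K : EndField E M) {m : ℕ} (β : Form E M m) : Form E M (m + 1) := fun x =>
  projAlong (plusForms (I x) (J x) (K x) (m + 1)) (lowForms (I x) (J x) (K x) (m + 1))
    (deRham β x)

variable [IsManifold 𝓘(ℝ, E) ∞ M]

/-- A complex structure: a smooth endomorphism field of square `-1` whose Nijenhuis tensor
`[IX, IY] - I[IX, Y] - I[X, IY] - [X, Y]` vanishes. -/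
structure IsComplexStructure (I : EndField E M) : Prop where
  smooth : ContMDiff 𝓘(ℝ, E) (𝓘(ℝ, E).prod 𝓘(ℝ, E →L[ℝ] E)) ∞
    (fun x : M => Bundle.TotalSpace.mk' (E →L[ℝ] E)
      (E := fun x : M => TangentSpace 𝓘(ℝ, E) x →L[ℝ] TangentSpace 𝓘(ℝ, E) x) x (I x))
  sq_eq : ∀ x v, I x (I x v) = -v
  integrable : ∀ (x : M) (X Y : ∀ y : M, TangentSpace 𝓘(ℝ, E) y),
    ContMDiffAt 𝓘(ℝ, E) 𝓘(ℝ, E).tangent ∞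
      (fun y => (⟨y, X y⟩ : TangentBundle 𝓘(ℝ, E) M)) x →
    ContMDiffAt 𝓘(ℝ, E) 𝓘(ℝ, E).tangent ∞
      (fun y => (⟨y, Y y⟩ : TangentBundle 𝓘(ℝ, E) M)) x →
    VectorField.mlieBracket 𝓘(ℝ, E) (fun y => I y (X y)) (fun y => I y (Y y)) x
      - I x (VectorField.mlieBracket 𝓘(ℝ, E) (fun y => I y (X y)) Y x)
      - I x (VectorField.mlieBracket 𝓘(ℝ, E) X (fun y => I y (Y y)) x)
      - VectorField.mlieBracket 𝓘(ℝ, E) X Y x = 0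

/-- A hypercomplex structure: complex structures `I, J, K` acting on the right on the tangent bundle
with `IJ = -JI = K`. As the action is on the right, `v · (IJ) = (v · I) · J`, which is
`J (I v)` when the operators are written as functions. -/
structure IsHypercomplex (I J K : EndField E M) : Prop where
  complexI : IsComplexStructure I
  complexJ : IsComplexStructure J
  complexK : IsComplexStructure K
  mul_IJ : ∀ x v, K x v = J x (I x v)
  mul_JI : ∀ x v, K x v = -I x (J x v)

end Manifold

end Hypercomplex

end

/-! On a fibre the statement is highest weight theory for SU(2). Write a quaternion as g = z + jw
with z, w complex. A form α of type (m,0) is complex linear in every slot, so expanding α(v₁·g, …,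
vₘ·g) gives the binomial formula for (z h₁ + w h₂)^m applied to α
(`IsQuaternionic.pull_rightMul_eq_sum`). Since the orbit of h₁^m spans the binary forms of degree m
(`eq_of_eq_on_orbit`), the map P ↦ P·α is equivariant (`IsQuaternionic.symMap_symAct`). Conversely
an equivariant map on Sym^m is determined by the image of h₁^m, which has circle weight m and so is
of type (m,0) (`IsQuaternionic.eq_symMap`). Thus Λ^m_+ is the sum over p of h₁^p h₂^(m-p) Λ^{m,0},
and the type separates the summands.

The translate of h₁^p h₂^q α by g has (m,0)-component z^p (-w̄)^q α
(`IsQuaternionic.circleProj_pull_hMul`). At g = 1 + j this inverts multiplication by h₁^p h₂^q by an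
explicit, hence smooth, formula. It also shows that a form in Λ^m_+ is determined by the
(m,0)-components of its translates. Forms of smaller weight have no such components, so the sum
Λ^m_+ + V^m is direct. It is everything because covectors are sums of standard representations, and
Clebsch–Gordan bounds the weights in an m-fold product by m (`multilinear_mem_iSup_weightPart`).

For the differential, integrability enters through the Obata connection ∇, which is torsion free and
preserves I and J (`exists_obata`). Hence d is the alternation of ∇, and ∇ preserves types and
commutes with h₁^p h₂^q. With A = ∇η = A₁ + A₂ split into its I-linear and I-antilinear parts, ∂η =
alt A₁ and ∂_J η = -alt(A₂∘J). It remains to compare (m+1,0)-components of translates: both sides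
give z^p (-w̄)^q alt(z A₁ + w̄ A₂∘J) (`IsQuaternionic.projAlong_wedgeAlt_hMul`). -/

noncomputable section

set_option linter.unusedSectionVars false

namespace Hypercomplex

/-! ### The Obata connection: pointwise algebra. -/

section Obata

variable {E : Type*} [NormedAddCommGroup E] [NormedSpace ℝ E]

/-- The Nijenhuis tensor at a point, on constant vector fields, of an operator field with value `A`
and derivative `dA`. -/
def nijenhuis (A : E →L[ℝ] E) (dA : E →L[ℝ] E →L[ℝ] E) (u v : E) : E :=
  dA (A u) v - dA (A v) u + A (dA v u) - A (dA u v)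

/-- The Christoffel symbols of the Obata connection of a hypercomplex structure, with the opposite
sign, in terms of the values and the derivatives of `I` and `J` at a point. -/
def obata (I J : E →L[ℝ] E) (dI dJ : E →L[ℝ] E →L[ℝ] E) : E →L[ℝ] E →L[ℝ] E :=
  (2⁻¹ : ℝ) • ((ContinuousLinearMap.compL ℝ E E E I) ∘L dI.flip
    + (ContinuousLinearMap.compL ℝ E E E J) ∘L dJ
    + (ContinuousLinearMap.compL ℝ E E E (J ∘L I)) ∘L dJ ∘L I
    - (ContinuousLinearMap.compL ℝ E E E (J ∘L I)) ∘L (dI ∘L J).flip)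

variable {I J : E →L[ℝ] E} {dI dJ : E →L[ℝ] E →L[ℝ] E}

theorem obata_apply (u v : E) : obata I J dI dJ u v =
    (2⁻¹ : ℝ) • (I (dI v u) + J (dJ u v) + J (I (dJ (I u) v)) - J (I (dI (J v) u))) := rfl

/-- Torsion-freeness, the only property of the connection that needs both Nijenhuis tensors. The
hypotheses on `dI` and `dJ` are the derivatives of I² = -1, J² = -1 and IJ = -JI. They bring every
term to a normal form, in which the antisymmetric part is a combination of eight values of the
tensors. -/
theorem obata_symm (hI : ∀ v, I (I v) = -v) (hJ : ∀ v, J (J v) = -v)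
    (hIJ : ∀ v, I (J v) = -J (I v)) (hdI : ∀ u v, dI u (I v) = -I (dI u v))
    (hdJ : ∀ u v, dJ u (J v) = -J (dJ u v))
    (hdIJ : ∀ u v, dJ u (I v) = -dI u (J v) - I (dJ u v) - J (dI u v))
    (nI : ∀ u v, nijenhuis I dI u v = 0) (nJ : ∀ u v, nijenhuis J dJ u v = 0) (u v : E) :
    obata I J dI dJ u v = obata I J dI dJ v u := by
  -- `hIJ` rewrites `I (J v)` to `-J (I v)`, after which `hdI` no longer matches; this is the
  -- missing rule.
  have hdI' : ∀ u v, dI u (J (I v)) = I (dI u (J v)) := fun u v => by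
    rw [← neg_neg (J (I v)), ← hIJ, map_neg, hdI, neg_neg]
  have a1 := congrArg (fun x => J (I x)) (nJ u (J (I v)))
  have a2 := congrArg J (nJ (J u) v)
  have a3 := congrArg (fun x => J (I x)) (nJ (J (I u)) v)
  have a4 := nI (J u) (J v)
  have a5 := congrArg J (nJ (I u) (J (I v)))
  have a6 := congrArg I (nI u (I v))
  have a7 := congrArg (fun x => J (I x)) (nI (J (I u)) v)
  have a8 := congrArg (fun x => J (I x)) (nI (I u) (J v))
  simp only [nijenhuis, obata_apply, hI, hJ, hIJ, hdI, hdJ, hdIJ, hdI', map_add, map_sub, map_neg,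
    map_zero, neg_apply, neg_neg] at a1 a2 a3 a4 a5 a6 a7 a8 ⊢
  linear_combination (norm := module) (-1/4 : ℝ) • a1 + (-1/4 : ℝ) • a2 + (-1/4 : ℝ) • a3
    + (-1/4 : ℝ) • a4 + (1/4 : ℝ) • a5 + (1/4 : ℝ) • a6 + (1/4 : ℝ) • a7 + (-1/4 : ℝ) • a8

/-- ∇I = 0 for the Christoffel symbols -Γ reads dI = [Γ, I]. This uses two values of the Nijenhuis
tensor of I, whereas ∇J = 0 below is purely algebraic. -/
theorem obata_parallel_fst (hI : ∀ v, I (I v) = -v) (hJ : ∀ v, J (J v) = -v)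
    (hIJ : ∀ v, I (J v) = -J (I v)) (hdI : ∀ u v, dI u (I v) = -I (dI u v))
    (hdIJ : ∀ u v, dJ u (I v) = -dI u (J v) - I (dJ u v) - J (dI u v))
    (nI : ∀ u v, nijenhuis I dI u v = 0) (u v : E) :
    dI u v = obata I J dI dJ u (I v) - I (obata I J dI dJ u v) := by
  have a1 := congrArg J (nI (I u) (J v))
  have a2 := nI u (I v)
  simp only [nijenhuis, obata_apply, hI, hJ, hIJ, hdI, hdIJ, map_add, map_sub, map_neg,
    map_zero, map_smul, neg_apply, neg_neg] at a1 a2 ⊢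
  linear_combination (norm := module) (-1/2 : ℝ) • a1 + (-1/2 : ℝ) • a2

theorem obata_parallel_snd (hJ : ∀ v, J (J v) = -v)
    (hIJ : ∀ v, I (J v) = -J (I v)) (hdJ : ∀ u v, dJ u (J v) = -J (dJ u v)) (u v : E) :
    dJ u v = obata I J dI dJ u (J v) - J (obata I J dI dJ u v) := by
  simp only [obata_apply, hJ, hIJ, hdJ, map_add, map_sub, map_neg, map_smul,
    neg_apply, neg_neg]
  module

end Obata

theorem eq_zero_of_smul_eq_zero {W : Type*} [AddCommGroup W] [Module ℂ W] {c : ℂ} {w : W}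
    (hc : c ≠ 0) (h : c • w = 0) : w = 0 :=
  (smul_eq_zero.1 h).resolve_left hc

/-! ### Types of forms as weights of the circle, and products of covectors. -/

section Types

variable {V : Type*} [AddCommGroup V] [Module ℝ V] [TopologicalSpace V]
  [IsTopologicalAddGroup V] [ContinuousSMul ℝ V] {m : ℕ}

@[simp]
theorem pull_apply (L : V →L[ℝ] V) (α : V [⋀^Fin m]→L[ℝ] ℂ) (v : Fin m → V) :
    pull m L α v = α fun i => L (v i) := rfl

/-- The action of complex numbers on `V` through an operator `I`. -/
def complexAct (I : V →L[ℝ] V) (z : ℂ) : V →L[ℝ] V :=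
  z.re • ContinuousLinearMap.id ℝ V + z.im • I

theorem complexAct_apply (I : V →L[ℝ] V) (z : ℂ) (v : V) :
    complexAct I z v = z.re • v + z.im • I v := rfl

theorem complexAct_ofReal_mul (I : V →L[ℝ] V) (r : ℝ) (z : ℂ) :
    complexAct I (r * z) = r • complexAct I z := by
  ext v
  simp [complexAct_apply, smul_smul]

theorem mem_typeForms {I : V →L[ℝ] V} {p q : ℕ} {α : V [⋀^Fin m]→L[ℝ] ℂ} :
    α ∈ typeForms I m p q ↔
      ∀ z : ℂ, pull m (complexAct I z) α = (z ^ p * (starRingEnd ℂ z) ^ q) • α :=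
  ⟨fun h z => ContinuousAlternatingMap.ext fun v => h z v,
    fun h z v => DFunLike.congr_fun (h z) v⟩

theorem pull_smul_real (r : ℝ) (L : V →L[ℝ] V) (α : V [⋀^Fin m]→L[ℝ] ℂ) :
    pull m (r • L) α = ((r : ℂ) ^ m) • pull m L α := by
  ext v
  have := α.toMultilinearMap.map_smul_univ (fun _ => r) (fun i => L (v i))
  simpa using this

theorem conj_eq_inv_of_norm_one {z : ℂ} (hz : ‖z‖ = 1) : starRingEnd ℂ z = z⁻¹ := by
  rw [Complex.inv_def, Complex.normSq_eq_norm_sq, hz]; simp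

/-- Positive reals scale every m-form by r^m, so by polar decomposition only unit complex numbers
matter. There conjugation is inversion, and the type becomes the character of weight p - q. -/
theorem mem_typeForms_iff_circle {I : V →L[ℝ] V} {p q : ℕ} (hpq : p + q = m)
    {α : V [⋀^Fin m]→L[ℝ] ℂ} :
    α ∈ typeForms I m p q ↔
      ∀ z : ℂ, ‖z‖ = 1 → pull m (complexAct I z) α = (z ^ ((p : ℤ) - q)) • α := by
  have key : ∀ z : ℂ, ‖z‖ = 1 → z ^ p * (starRingEnd ℂ z) ^ q = z ^ ((p : ℤ) - q) := by
    intro z hz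
    have hz0 : z ≠ 0 := by rintro rfl; simp at hz
    rw [conj_eq_inv_of_norm_one hz, zpow_sub₀ hz0, zpow_natCast, zpow_natCast, inv_pow,
      div_eq_mul_inv]
  rw [mem_typeForms]
  constructor
  · intro h z hz
    rw [h z, key z hz]
  · intro h z
    obtain ⟨u, hu, hz⟩ : ∃ u : ℂ, ‖u‖ = 1 ∧ z = (‖z‖ : ℝ) * u := by
      by_cases h0 : z = 0
      · exact ⟨1, by simp, by simp [h0]⟩
      · refine ⟨z / ‖z‖, by simp [h0], ?_⟩
        have : (‖z‖ : ℂ) ≠ 0 := by simpa using h0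
        field_simp
    rw [hz, complexAct_ofReal_mul, pull_smul_real, h u hu, ← key u hu, smul_smul]
    congr 1
    rw [map_mul, Complex.conj_ofReal, mul_pow, mul_pow, ← hpq, pow_add]
    ring

/-- The number 2 acts on every m-form by 2^m and on a (p,q)-form by 2^(p+q). -/
theorem typeForms_eq_bot {I : V →L[ℝ] V} {p q : ℕ} (hpq : p + q ≠ m) :
    typeForms I m p q = ⊥ := by
  refine (Submodule.eq_bot_iff _).2 fun α hα => ?_
  have h := mem_typeForms.1 hα 2
  have h2 : complexAct I 2 = (2 : ℝ) • complexAct I 1 := by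
    rw [← complexAct_ofReal_mul]; norm_num
  have h1 : pull m (complexAct I 1) α = α := by
    ext v; simp [complexAct_apply]
  rw [h2, pull_smul_real, h1] at h
  have h3 : (starRingEnd ℂ) 2 = 2 := by
    have := Complex.conj_ofReal 2
    simpa using this
  rw [h3, ← pow_add] at h
  have h' : (((2 : ℝ) : ℂ) ^ m - 2 ^ (p + q)) • α = 0 :=
    (sub_smul _ _ α).trans (sub_eq_zero.2 h)
  have hne : ((2 : ℝ) : ℂ) ^ m - 2 ^ (p + q) ≠ 0 := by
    intro h
    rw [sub_eq_zero] at h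
    have h4 : (2 : ℕ) ^ m = 2 ^ (p + q) := by
      have h5 : ((2 : ℕ) : ℂ) ^ m = ((2 : ℕ) : ℂ) ^ (p + q) := by simpa using h
      exact_mod_cast h5
    exact hpq (Nat.pow_right_injective le_rfl h4).symm
  exact eq_zero_of_smul_eq_zero hne h'

/-- The projection onto the part of weight `j` under the circle of unit complex numbers, computed as
an average over a finite group of roots of unity. -/
def circleProj (I : V →L[ℝ] V) (m : ℕ) (j : ℤ) :
    (V [⋀^Fin m]→L[ℝ] ℂ) →ₗ[ℂ] (V [⋀^Fin m]→L[ℝ] ℂ) :=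
  ∑ k ∈ Finset.range (2 * m + 1),
    ((2 * m + 1 : ℕ) : ℂ)⁻¹ • (Complex.exp (2 * Real.pi * Complex.I / (2 * m + 1 : ℕ)) ^ k) ^ (-j) •
      pull m (complexAct I (Complex.exp (2 * Real.pi * Complex.I / (2 * m + 1 : ℕ)) ^ k))

/-- The average is a geometric sum of powers of ζ^(l-j), with ζ a primitive root of unity of order
2m+1. As |l - j| ≤ 2m, this power is 1 only for l = j. -/
theorem circleProj_eq {I : V →L[ℝ] V} {j l : ℤ} (hj : |j| ≤ m) (hl : |l| ≤ m)
    {α : V [⋀^Fin m]→L[ℝ] ℂ}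
    (h : ∀ z : ℂ, ‖z‖ = 1 → pull m (complexAct I z) α = z ^ l • α) :
    circleProj I m j α = if l = j then α else 0 := by
  set ζ := Complex.exp (2 * Real.pi * Complex.I / (2 * m + 1 : ℕ)) with hζ
  have hprim : IsPrimitiveRoot ζ (2 * m + 1) := Complex.isPrimitiveRoot_exp _ (by omega)
  have hnorm : ‖ζ‖ = 1 := hprim.norm'_eq_one (by omega)
  have hζ0 : ζ ≠ 0 := by rintro h0; rw [h0] at hnorm; simp at hnorm
  have hN : ((2 * m + 1 : ℕ) : ℂ) ≠ 0 := by exact_mod_cast (by omega : 2 * m + 1 ≠ 0)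
  have h1 : circleProj I m j α =
      (((2 * m + 1 : ℕ) : ℂ)⁻¹ * ∑ k ∈ Finset.range (2 * m + 1), (ζ ^ (l - j)) ^ k) • α := by
    simp only [circleProj, LinearMap.sum_apply, LinearMap.smul_apply]
    rw [Finset.mul_sum]
    refine Eq.trans (Finset.sum_congr rfl fun k _ => ?_) (Finset.sum_smul ..).symm
    rw [h _ (by rw [norm_pow, hnorm, one_pow]), smul_smul, smul_smul]
    congr 1
    rw [← hζ, mul_assoc, ← zpow_add₀ (pow_ne_zero _ hζ0), ← zpow_natCast, ← zpow_natCast,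
      ← zpow_mul, ← zpow_mul]
    congr 2
    ring
  rw [h1]
  split_ifs with hjl
  · subst hjl
    simp only [sub_self, zpow_zero, one_pow, Finset.sum_const, Finset.card_range, nsmul_eq_mul,
      mul_one]
    rw [inv_mul_cancel₀ hN, one_smul]
  · have hne : ζ ^ (l - j) ≠ 1 := by
      intro h2
      rw [hprim.zpow_eq_one_iff_dvd] at h2
      have h3 := Int.eq_zero_of_abs_lt_dvd h2 (by rw [abs_le] at hj hl; rw [abs_lt]; push_cast; omega)
      omega
    rw [geom_sum_eq hne, ← zpow_natCast, ← zpow_mul, mul_comm (l - j), zpow_mul,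
      zpow_natCast, hprim.pow_eq_one]
    simp only [one_zpow, sub_self, zero_div, mul_zero]
    exact zero_smul ℂ α

theorem circleProj_typeForms {I : V →L[ℝ] V} {p q p' q' : ℕ} (hpq : p + q = m)
    (hpq' : p' + q' = m) {α : V [⋀^Fin m]→L[ℝ] ℂ} (hα : α ∈ typeForms I m p q) :
    circleProj I m ((p' : ℤ) - q') α = if p = p' then α else 0 := by
  rw [circleProj_eq (by rw [abs_le]; omega) (by rw [abs_le]; omega)
    ((mem_typeForms_iff_circle hpq).1 hα)]
  congr 1
  exact propext ⟨by omega, by omega⟩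

/-- The alternating product of covectors. -/
def altProd (θ : Fin m → V →L[ℝ] ℂ) : V [⋀^Fin m]→L[ℝ] ℂ :=
  ContinuousMultilinearMap.alternatization
    ((ContinuousMultilinearMap.mkPiAlgebra ℝ (Fin m) ℂ).compContinuousLinearMap θ)

theorem altProd_apply (θ : Fin m → V →L[ℝ] ℂ) (v : Fin m → V) :
    altProd θ v = ∑ σ : Equiv.Perm (Fin m), Equiv.Perm.sign σ • ∏ i, θ i (v (σ i)) := by
  simp [altProd, ContinuousMultilinearMap.alternatization_apply_apply]

/-- The product of the values of covectors at given vectors, as a multilinear map. -/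
def evalProd (v : Fin m → V) : MultilinearMap ℂ (fun _ : Fin m => V →L[ℝ] ℂ) ℂ :=
  (MultilinearMap.mkPiAlgebra ℂ (Fin m) ℂ).compLinearMap fun i =>
    { toFun := fun f => f (v i), map_add' := fun _ _ => rfl, map_smul' := fun _ _ => rfl }

theorem altProd_apply_eq_evalProd (θ : Fin m → V →L[ℝ] ℂ) (v : Fin m → V) :
    altProd θ v = ∑ σ : Equiv.Perm (Fin m), Equiv.Perm.sign σ • evalProd (fun i => v (σ i)) θ :=
  altProd_apply θ v

/-- The alternating product of covectors, as a multilinear map. -/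
def altProdMultilinear : MultilinearMap ℂ (fun _ : Fin m => V →L[ℝ] ℂ) (V [⋀^Fin m]→L[ℝ] ℂ) where
  toFun := altProd
  map_update_add' θ i x y := by
    ext v
    simp only [ContinuousAlternatingMap.add_apply, altProd_apply_eq_evalProd,
      MultilinearMap.map_update_add, smul_add, Finset.sum_add_distrib]
  map_update_smul' θ i c x := by
    ext v
    simp only [ContinuousAlternatingMap.smul_apply, altProd_apply_eq_evalProd,
      MultilinearMap.map_update_smul, Finset.smul_sum, smul_comm c]

theorem altProdMultilinear_apply (θ : Fin m → V →L[ℝ] ℂ) : altProdMultilinear θ = altProd θ := rfl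

theorem pull_altProd (L : V →L[ℝ] V) (θ : Fin m → V →L[ℝ] ℂ) :
    pull m L (altProd θ) = altProd fun i => θ i ∘L L := by
  ext v
  simp [altProd_apply]

/-- In a basis, α is a combination of unsymmetrised products of covectors. Summing this expansion
over permutations with signs replaces the products by `altProd` and α by m!·α. -/
theorem span_altProd [FiniteDimensional ℝ V] [T2Space V] :
    Submodule.span ℂ (Set.range (altProd (V := V) (m := m))) = ⊤ := by
  refine eq_top_iff.2 fun α _ => ?_
  set b := Module.finBasis ℝ V
  let e : Fin (Module.finrank ℝ V) → V →L[ℝ] ℂ := fun j =>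
    Complex.ofRealCLM ∘L LinearMap.toContinuousLinearMap (b.coord j)
  have he : ∀ j v, e j v = (b.repr v j : ℂ) := fun j v => rfl
  have hexp : ∀ w : Fin m → V, α w = ∑ f : Fin m → Fin (Module.finrank ℝ V),
      (∏ i, e (f i) (w i)) * α fun i => b (f i) := by
    intro w
    have h1 : α w = α.toMultilinearMap fun i => ∑ j, b.repr (w i) j • b j := by
      exact congrArg α (funext fun i => (b.sum_repr (w i)).symm)
    rw [h1, MultilinearMap.map_sum]
    refine Finset.sum_congr rfl fun f _ => ?_
    rw [MultilinearMap.map_smul_univ]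
    simp only [he]
    rw [← Complex.ofReal_prod, Complex.real_smul]
    rfl
  have hα : α = ((m.factorial : ℂ)⁻¹) • ∑ f : Fin m → Fin (Module.finrank ℝ V),
      α (fun i => b (f i)) • altProd fun i => e (f i) := by
    ext v
    have h2 : (m.factorial : ℂ) * α v =
        ∑ f : Fin m → Fin (Module.finrank ℝ V),
          α (fun i => b (f i)) * altProd (fun i => e (f i)) v := by
      have h3 : ∀ σ : Equiv.Perm (Fin m),
          α v = Equiv.Perm.sign σ • α fun i => v (σ i) := by
        intro σ
        have := α.toAlternatingMap.map_perm v σ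
        have h4 : α (fun i => v (σ i)) = Equiv.Perm.sign σ • α v := this
        rw [h4, smul_smul, Int.units_mul_self, one_smul]
      have h5 : (m.factorial : ℂ) * α v = ∑ σ : Equiv.Perm (Fin m),
          Equiv.Perm.sign σ • α fun i => v (σ i) := by
        rw [← Finset.sum_congr rfl fun σ _ => h3 σ]
        simp [Fintype.card_perm]
      rw [h5]
      simp only [hexp (fun i => v _), altProd_apply, Finset.smul_sum, Finset.mul_sum]
      rw [Finset.sum_comm]
      refine Finset.sum_congr rfl fun f _ => Finset.sum_congr rfl fun σ _ => ?_
      simp only [Units.smul_def, zsmul_eq_mul]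
      ring
    have hm : (m.factorial : ℂ) ≠ 0 := by exact_mod_cast m.factorial_ne_zero
    simp only [ContinuousAlternatingMap.smul_apply, ContinuousAlternatingMap.sum_apply, smul_eq_mul]
    rw [← h2, ← mul_assoc, inv_mul_cancel₀ hm, one_mul]
  rw [hα]
  exact Submodule.smul_mem _ _ (Submodule.sum_mem _ fun f _ =>
    Submodule.smul_mem _ _ (Submodule.subset_span ⟨_, rfl⟩))

end Types

theorem projAlong_eq {W : Type*} [AddCommGroup W] [Module ℂ W] {A B : Submodule ℂ W}
    (h : IsCompl A B) {w a : W} (ha : a ∈ A) (hb : w - a ∈ B) : projAlong A B w = a := by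
  have h1 : w = a + (w - a) := by abel
  rw [projAlong, dif_pos h, h1, map_add]
  rw [show A.projection B h a = a from Submodule.projection_apply_of_mem_left h ha,
    show A.projection B h (w - a) = 0 from Submodule.projection_apply_of_mem_right h hb, add_zero]

theorem projAlong_eq_of_proj {W : Type*} [AddCommGroup W] [Module ℂ W] {A B : Submodule ℂ W}
    (h : IsCompl A B) (P : W →ₗ[ℂ] W) (hA : ∀ a ∈ A, P a = a) (hB : ∀ b ∈ B, P b = 0) (w : W) :
    projAlong A B w = P w := by
  obtain ⟨a, ha, b, hb, rfl⟩ :=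
    Submodule.mem_sup.1 (h.sup_eq_top ▸ Submodule.mem_top : w ∈ A ⊔ B)
  rw [map_add P, hA a ha, hB b hb, add_zero]
  exact projAlong_eq h ha (by simpa using hb)

/-! ### The decomposition into types. -/

section Types

variable {V : Type*} [AddCommGroup V] [Module ℝ V] [TopologicalSpace V]
  [IsTopologicalAddGroup V] [ContinuousSMul ℝ V] {m : ℕ} {I : V →L[ℝ] V}

/-- The complex linear part of a covector. -/
def holPart (I : V →L[ℝ] V) (θ : V →L[ℝ] ℂ) : V →L[ℝ] ℂ :=
  (2⁻¹ : ℂ) • (θ - Complex.I • (θ ∘L I))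

/-- The complex antilinear part of a covector. -/
def antiPart (I : V →L[ℝ] V) (θ : V →L[ℝ] ℂ) : V →L[ℝ] ℂ :=
  (2⁻¹ : ℂ) • (θ + Complex.I • (θ ∘L I))

theorem holPart_apply (θ : V →L[ℝ] ℂ) (v : V) :
    holPart I θ v = 2⁻¹ * (θ v - Complex.I * θ (I v)) := rfl

theorem antiPart_apply (θ : V →L[ℝ] ℂ) (v : V) :
    antiPart I θ v = 2⁻¹ * (θ v + Complex.I * θ (I v)) := rfl

theorem holPart_add_antiPart (θ : V →L[ℝ] ℂ) : holPart I θ + antiPart I θ = θ := by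
  ext v
  rw [add_apply, holPart_apply, antiPart_apply]
  ring

theorem holPart_map (hI : ∀ v, I (I v) = -v) (θ : V →L[ℝ] ℂ) (v : V) :
    holPart I θ (I v) = Complex.I * holPart I θ v := by
  rw [holPart_apply, holPart_apply, hI, map_neg]
  linear_combination (2⁻¹ * θ (I v)) * Complex.I_mul_I

theorem antiPart_map (hI : ∀ v, I (I v) = -v) (θ : V →L[ℝ] ℂ) (v : V) :
    antiPart I θ (I v) = -Complex.I * antiPart I θ v := by
  rw [antiPart_apply, antiPart_apply, hI, map_neg]
  linear_combination (2⁻¹ * θ (I v)) * Complex.I_mul_I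

theorem apply_complexAct_of_hol {θ : V →L[ℝ] ℂ} (h : ∀ v, θ (I v) = Complex.I * θ v) (z : ℂ)
    (v : V) : θ (complexAct I z v) = z * θ v := by
  rw [complexAct_apply, map_add, map_smul, map_smul, h, Complex.real_smul, Complex.real_smul]
  nth_rw 3 [← Complex.re_add_im z]
  ring

theorem apply_complexAct_of_anti {θ : V →L[ℝ] ℂ} (h : ∀ v, θ (I v) = -Complex.I * θ v) (z : ℂ)
    (v : V) : θ (complexAct I z v) = starRingEnd ℂ z * θ v := by
  rw [complexAct_apply, map_add, map_smul, map_smul, h, Complex.real_smul, Complex.real_smul]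
  nth_rw 3 [← Complex.re_add_im z]
  simp only [map_add, map_mul, Complex.conj_ofReal, Complex.conj_I]
  ring

theorem altProd_mem_typeForms (S : Finset (Fin m)) {θ : Fin m → V →L[ℝ] ℂ}
    (h : ∀ i ∈ S, ∀ v, θ i (I v) = Complex.I * θ i v)
    (h' : ∀ i ∉ S, ∀ v, θ i (I v) = -Complex.I * θ i v) :
    altProd θ ∈ typeForms I m S.card (m - S.card) := by
  rw [mem_typeForms]
  intro z
  have h1 : (fun i => θ i ∘L complexAct I z)
      = fun i => (if i ∈ S then z else starRingEnd ℂ z) • θ i := by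
    funext i
    ext v
    split_ifs with hi
    · exact apply_complexAct_of_hol (h i hi) z v
    · exact apply_complexAct_of_anti (h' i hi) z v
  rw [pull_altProd, h1, ← altProdMultilinear_apply, MultilinearMap.map_smul_univ,
    altProdMultilinear_apply]
  congr 1
  rw [Finset.prod_ite, Finset.prod_const, Finset.prod_const]
  congr 2
  · congr 1; ext i; simp
  · rw [show Finset.univ.filter (fun i => i ∉ S) = Sᶜ by ext i; simp, Finset.card_compl,
      Fintype.card_fin]

theorem altProd_eq_sum (I : V →L[ℝ] V) (θ : Fin m → V →L[ℝ] ℂ) :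
    altProd θ = ∑ S : Finset (Fin m),
      altProd (S.piecewise (fun i => holPart I (θ i)) fun i => antiPart I (θ i)) := by
  have h := altProdMultilinear.map_add_univ (fun i => holPart I (θ i)) fun i => antiPart I (θ i)
  have h1 : ((fun i => holPart I (θ i)) + fun i => antiPart I (θ i)) = θ :=
    funext fun i => holPart_add_antiPart (θ i)
  rw [h1] at h
  exact h

theorem altProd_piecewise_mem (hI : ∀ v, I (I v) = -v) (θ : Fin m → V →L[ℝ] ℂ)
    (S : Finset (Fin m)) :
    altProd (S.piecewise (fun i => holPart I (θ i)) fun i => antiPart I (θ i)) ∈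
      typeForms I m S.card (m - S.card) := by
  refine altProd_mem_typeForms S (fun i hi v => ?_) fun i hi v => ?_
  · rw [Finset.piecewise_eq_of_mem _ _ _ hi]; exact holPart_map hI _ v
  · rw [Finset.piecewise_eq_of_notMem _ _ _ hi]; exact antiPart_map hI _ v

variable [FiniteDimensional ℝ V] [T2Space V]

theorem iSup_typeForms (hI : ∀ v, I (I v) = -v) :
    ⨆ r : ℕ × ℕ, typeForms I m r.1 r.2 = ⊤ := by
  rw [eq_top_iff, ← span_altProd, Submodule.span_le]
  rintro _ ⟨θ, rfl⟩
  rw [altProd_eq_sum I θ]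
  refine Submodule.sum_mem _ fun S _ => ?_
  exact Submodule.mem_iSup_of_mem (S.card, m - S.card) (altProd_piecewise_mem hI θ S)

theorem circleProj_otherTypeForms {p q : ℕ} (hpq : p + q = m) {α : V [⋀^Fin m]→L[ℝ] ℂ}
    (hα : α ∈ otherTypeForms I m p q) : circleProj I m ((p : ℤ) - q) α = 0 := by
  have : otherTypeForms I m p q ≤ LinearMap.ker (circleProj I m ((p : ℤ) - q)) := by
    refine iSup₂_le fun r hr β hβ => ?_
    rw [LinearMap.mem_ker]
    by_cases h : r.1 + r.2 = m
    · rw [circleProj_typeForms h hpq hβ, if_neg]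
      rintro h1
      exact hr (Prod.ext h1 (by omega))
    · rw [typeForms_eq_bot h, Submodule.mem_bot] at hβ
      rw [hβ, map_zero]
  exact this hα

/-- `circleProj` is the identity on one summand and zero on the other. When p + q ≠ m the first
space vanishes, so no condition on degrees is needed. -/
theorem isCompl_typeForms (hI : ∀ v, I (I v) = -v) (m p q : ℕ) :
    IsCompl (typeForms I m p q) (otherTypeForms I m p q) := by
  constructor
  · rw [Submodule.disjoint_def]
    intro α hα hα'
    by_cases h : p + q = m
    · have h1 := circleProj_typeForms h h hα
      rw [circleProj_otherTypeForms h hα', if_pos rfl] at h1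
      exact h1.symm
    · rw [typeForms_eq_bot h, Submodule.mem_bot] at hα
      exact hα
  · rw [codisjoint_iff, eq_top_iff, ← iSup_typeForms hI]
    refine iSup_le fun r => ?_
    by_cases h : r = (p, q)
    · subst h; exact le_sup_left
    · exact le_trans (le_iSup₂ (f := fun (r : ℕ × ℕ) (_ : r ≠ (p, q)) =>
        typeForms I m r.1 r.2) r h) le_sup_right

theorem projAlong_typeForms (hI : ∀ v, I (I v) = -v) {p q : ℕ} (hpq : p + q = m)
    (α : V [⋀^Fin m]→L[ℝ] ℂ) :
    projAlong (typeForms I m p q) (otherTypeForms I m p q) α = circleProj I m ((p : ℤ) - q) α :=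
  projAlong_eq_of_proj (isCompl_typeForms hI m p q) _
    (fun a ha => by rw [circleProj_typeForms hpq hpq ha, if_pos rfl])
    (fun b hb => circleProj_otherTypeForms hpq hb) α

theorem projAlong_typeForms_mem (hI : ∀ v, I (I v) = -v) (p q : ℕ) (α : V [⋀^Fin m]→L[ℝ] ℂ) :
    projAlong (typeForms I m p q) (otherTypeForms I m p q) α ∈ typeForms I m p q := by
  obtain ⟨a, ha, b, hb, rfl⟩ := Submodule.mem_sup.1
    ((isCompl_typeForms hI m p q).sup_eq_top ▸ Submodule.mem_top :
      α ∈ typeForms I m p q ⊔ otherTypeForms I m p q)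
  rw [projAlong_eq (isCompl_typeForms hI m p q) ha (by simpa using hb)]
  exact ha

/-- Forms of type `(m,0)` are complex linear in each slot. -/
theorem apply_complexAct (hI : ∀ v, I (I v) = -v) {α : V [⋀^Fin m]→L[ℝ] ℂ}
    (hα : α ∈ typeForms I m m 0) (u : Fin m → ℂ) (v : Fin m → V) :
    α (fun i => complexAct I (u i) (v i)) = (∏ i, u i) * α v := by
  -- `typeForms` only controls the same scalar in all slots. Stated for the (m,0)-component of an
  -- arbitrary β, slotwise linearity is linear in β and can be checked on products of covectors; α
  -- is its own component.
  have key : ∀ β : V [⋀^Fin m]→L[ℝ] ℂ,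
      circleProj I m ((m : ℤ) - (0 : ℕ)) β (fun i => complexAct I (u i) (v i)) =
        (∏ i, u i) * circleProj I m ((m : ℤ) - (0 : ℕ)) β v := by
    intro β
    have hβ : β ∈ Submodule.span ℂ (Set.range (altProd (V := V) (m := m))) :=
      (span_altProd (V := V) (m := m)).symm ▸ Submodule.mem_top
    induction hβ using Submodule.span_induction with
    | zero => rw [map_zero]; simp
    | add x y _ _ hx hy =>
      rw [map_add, ContinuousAlternatingMap.add_apply, ContinuousAlternatingMap.add_apply, hx, hy,
        mul_add]
    | smul c x _ hx =>
      rw [map_smul, ContinuousAlternatingMap.smul_apply, ContinuousAlternatingMap.smul_apply, hx,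
        smul_eq_mul, smul_eq_mul, mul_left_comm]
    | mem x hx =>
      obtain ⟨θ, rfl⟩ := hx
      have h1 : circleProj I m ((m : ℤ) - (0 : ℕ)) (altProd θ) =
          altProd fun i => holPart I (θ i) := by
        rw [altProd_eq_sum I θ, map_sum, Finset.sum_eq_single Finset.univ]
        · rw [circleProj_typeForms _ (add_zero m) (altProd_piecewise_mem hI θ _), if_pos (by simp),
            Finset.piecewise_univ]
          simp
        · intro S _ hS
          have hc : S.card ≤ m := by simpa using S.card_le_univ
          rw [circleProj_typeForms (by omega) (add_zero m) (altProd_piecewise_mem hI θ S), if_neg]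
          intro h
          exact hS (Finset.card_eq_iff_eq_univ S |>.1 (by simpa using h))
        · simp
      rw [h1, altProd_apply, altProd_apply, Finset.mul_sum]
      refine Finset.sum_congr rfl fun σ _ => ?_
      simp only [apply_complexAct_of_hol (holPart_map hI _), Finset.prod_mul_distrib]
      rw [Equiv.prod_comp σ u, mul_smul_comm]
  have h2 := circleProj_typeForms (add_zero m) (add_zero m) hα
  rw [if_pos rfl] at h2
  have h3 := key α
  rwa [h2] at h3

end Types

/-! ### Binary forms as representations of the unit quaternions. -/

section Polynomials

open MvPolynomial

/-- The coordinate `z` in the decomposition `g = z + j * w` of a quaternion. -/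
def fstCoord (g : ℍ[ℝ]) : ℂ := ⟨g.re, g.imI⟩

/-- The coordinate `w` in the decomposition `g = z + j * w` of a quaternion. -/
def sndCoord (g : ℍ[ℝ]) : ℂ := ⟨g.imJ, -g.imK⟩

/-- The quaternion `z + j * w`. -/
def ofCoords (z w : ℂ) : ℍ[ℝ] := ⟨z.re, z.im, w.re, -w.im⟩

@[simp] theorem fstCoord_ofCoords (z w : ℂ) : fstCoord (ofCoords z w) = z := rfl

@[simp] theorem sndCoord_ofCoords (z w : ℂ) : sndCoord (ofCoords z w) = w := by
  apply Complex.ext <;> simp [sndCoord, ofCoords]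

theorem symAct_X_zero (g : ℍ[ℝ]) :
    symAct g (X 0) = C (fstCoord g) * X 0 + C (sndCoord g) * X 1 := by
  simp [symAct, fstCoord, sndCoord]

theorem symAct_X_one (g : ℍ[ℝ]) :
    symAct g (X 1) = C (-starRingEnd ℂ (sndCoord g)) * X 0 + C (starRingEnd ℂ (fstCoord g)) * X 1 := by
  have h1 : (⟨-g.imJ, -g.imK⟩ : ℂ) = -starRingEnd ℂ (sndCoord g) := by
    apply Complex.ext <;> simp [sndCoord]
  have h2 : (⟨g.re, -g.imI⟩ : ℂ) = starRingEnd ℂ (fstCoord g) := by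
    apply Complex.ext <;> simp [fstCoord]
  rw [← h1, ← h2]
  simp [symAct]

theorem fstCoord_mul (g h : ℍ[ℝ]) : fstCoord (g * h) =
    fstCoord h * fstCoord g - sndCoord h * starRingEnd ℂ (sndCoord g) := by
  apply Complex.ext <;>
    simp only [fstCoord, sndCoord, Quaternion.re_mul, Quaternion.imI_mul, Complex.sub_re,
      Complex.sub_im, Complex.mul_re, Complex.mul_im, Complex.conj_re, Complex.conj_im] <;> ring

theorem sndCoord_mul (g h : ℍ[ℝ]) : sndCoord (g * h) =
    fstCoord h * sndCoord g + sndCoord h * starRingEnd ℂ (fstCoord g) := by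
  apply Complex.ext <;>
    simp only [fstCoord, sndCoord, Quaternion.imJ_mul, Quaternion.imK_mul, Complex.add_re,
      Complex.add_im, Complex.mul_re, Complex.mul_im, Complex.conj_re, Complex.conj_im] <;> ring

theorem symAct_mul (g h : ℍ[ℝ]) (P : MvPolynomial (Fin 2) ℂ) :
    symAct (g * h) P = symAct g (symAct h P) := by
  suffices H : symAct (g * h) = (symAct g).comp (symAct h) from
    DFunLike.congr_fun H P
  refine algHom_ext fun i => ?_
  have hc : ∀ c : ℂ, symAct g (C c) = C c := fun c => (symAct g).commutes c
  fin_cases i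
  · simp only [Fin.zero_eta, AlgHom.comp_apply]
    rw [symAct_X_zero, symAct_X_zero, map_add, map_mul, map_mul, symAct_X_zero, symAct_X_one, hc,
      hc, fstCoord_mul, sndCoord_mul]
    simp only [map_sub, map_add, map_mul, map_neg]
    ring
  · simp only [Fin.mk_one, AlgHom.comp_apply]
    rw [symAct_X_one, symAct_X_one, map_add, map_mul, map_mul, symAct_X_zero, symAct_X_one, hc,
      hc, fstCoord_mul, sndCoord_mul]
    simp only [map_sub, map_add, map_mul, map_neg, Complex.conj_conj]
    ring

theorem isHomogeneous_symAct (g : ℍ[ℝ]) {P : MvPolynomial (Fin 2) ℂ} {k : ℕ}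
    (hP : P.IsHomogeneous k) : (symAct g P).IsHomogeneous k := by
  have h := hP.aeval (τ := Fin 2) ![C (⟨g.re, g.imI⟩ : ℂ) * X 0 + C (⟨g.imJ, -g.imK⟩ : ℂ) * X 1,
      C (⟨-g.imJ, -g.imK⟩ : ℂ) * X 0 + C (⟨g.re, -g.imI⟩ : ℂ) * X 1] (n := 1) ?_
  · rw [one_mul] at h
    exact h
  · intro i
    fin_cases i
    · exact (isHomogeneous_C_mul_X _ _).add (isHomogeneous_C_mul_X _ _)
    · exact (isHomogeneous_C_mul_X _ _).add (isHomogeneous_C_mul_X _ _)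

/-- The chain rule for a linear substitution. It makes the contraction with partial derivatives in
the Clebsch–Gordan step equivariant. -/
theorem pderiv_symAct (g : ℍ[ℝ]) (P : MvPolynomial (Fin 2) ℂ) :
    (pderiv 0 (symAct g P) = C (fstCoord g) * symAct g (pderiv 0 P)
        + C (-starRingEnd ℂ (sndCoord g)) * symAct g (pderiv 1 P)) ∧
      pderiv 1 (symAct g P) = C (sndCoord g) * symAct g (pderiv 0 P)
        + C (starRingEnd ℂ (fstCoord g)) * symAct g (pderiv 1 P) := by
  have hc : ∀ c : ℂ, symAct g (C c) = C c := fun c => (symAct g).commutes c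
  induction P using MvPolynomial.induction_on with
  | C a => simp [hc]
  | add p q hp hq =>
    simp only [map_add, hp, hq]
    constructor <;> ring
  | mul_X p i hp =>
    fin_cases i
    · simp only [Fin.zero_eta, map_mul, Derivation.leibniz, smul_eq_mul, hp, symAct_X_zero, map_add,
        pderiv_C, pderiv_X_self, pderiv_X_of_ne (zero_ne_one : (0 : Fin 2) ≠ 1),
        pderiv_X_of_ne (one_ne_zero : (1 : Fin 2) ≠ 0), mul_zero, mul_one, add_zero, zero_add]
      constructor <;> ring
    · simp only [Fin.mk_one, map_mul, Derivation.leibniz, smul_eq_mul, hp, symAct_X_one, map_add,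
        pderiv_C, pderiv_X_self, pderiv_X_of_ne (zero_ne_one : (0 : Fin 2) ≠ 1),
        pderiv_X_of_ne (one_ne_zero : (1 : Fin 2) ≠ 0), mul_zero, mul_one, add_zero, zero_add]
      constructor <;> ring

theorem X_pow_mul_X_pow (p q : ℕ) : (X 0 ^ p * X 1 ^ q : MvPolynomial (Fin 2) ℂ) =
    monomial (Finsupp.single 0 p + Finsupp.single 1 q) 1 := by
  rw [X_pow_eq_monomial, X_pow_eq_monomial, monomial_mul, one_mul]

theorem coeff_X_pow_mul_X_pow (p q p' q' : ℕ) :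
    coeff (Finsupp.single 0 p + Finsupp.single 1 q) (X 0 ^ p' * X 1 ^ q' : MvPolynomial (Fin 2) ℂ) =
      if p' = p ∧ q' = q then 1 else 0 := by
  rw [X_pow_mul_X_pow, coeff_monomial]
  congr 1
  refine propext ⟨fun h => ?_, fun h => by rw [h.1, h.2]⟩
  have h0 := DFunLike.congr_fun h 0
  have h1 := DFunLike.congr_fun h 1
  exact ⟨by simpa using h0, by simpa using h1⟩

theorem isHomogeneous_X_pow_mul_X_pow (p q : ℕ) :
    (X 0 ^ p * X 1 ^ q : MvPolynomial (Fin 2) ℂ).IsHomogeneous (p + q) :=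
  (isHomogeneous_X_pow _ _).mul (isHomogeneous_X_pow _ _)

theorem eq_sum_of_isHomogeneous {P : MvPolynomial (Fin 2) ℂ} {k : ℕ} (hP : P.IsHomogeneous k) :
    P = ∑ p ∈ Finset.range (k + 1),
      coeff (Finsupp.single 0 p + Finsupp.single 1 (k - p)) P • (X 0 ^ p * X 1 ^ (k - p)) := by
  ext d
  have hd : d = Finsupp.single 0 (d 0) + Finsupp.single 1 (d 1) := by
    ext i; fin_cases i <;> simp
  have hdeg : d.degree = d 0 + d 1 := by
    rw [Finsupp.degree_eq_sum, Fin.sum_univ_two]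
  rw [coeff_sum]
  simp only [coeff_smul, smul_eq_mul]
  by_cases h : d 0 + d 1 = k
  · rw [Finset.sum_eq_single (d 0)]
    · rw [show k - d 0 = d 1 by omega, ← hd]
      conv_rhs => rw [hd]
      rw [coeff_X_pow_mul_X_pow, if_pos (by simp), mul_one]
      exact congrArg (coeff · P) hd
    · intro p _ hp
      rw [hd, coeff_X_pow_mul_X_pow, if_neg (fun h => hp h.1), mul_zero]
    · intro h'; simp at h'; omega
  · rw [hP.coeff_eq_zero (by rw [hdeg]; exact h)]
    symm
    refine Finset.sum_eq_zero fun p hp => ?_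
    rw [hd, coeff_X_pow_mul_X_pow, if_neg, mul_zero]
    rintro ⟨h1, h2⟩
    simp at hp
    omega

variable {W : Type*} [AddCommGroup W] [Module ℂ W]

/-- Linear functionals reduce this to a scalar polynomial that vanishes identically. -/
theorem eq_zero_of_sum_pow_smul {n : ℕ} {a : ℕ → W}
    (h : ∀ z : ℂ, ∑ p ∈ Finset.range n, z ^ p • a p = 0) {p : ℕ} (hp : p < n) : a p = 0 := by
  rw [← Module.forall_dual_apply_eq_zero_iff ℂ]
  intro φ
  have h1 : (∑ p ∈ Finset.range n, Polynomial.C (φ (a p)) * Polynomial.X ^ p) = 0 := by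
    refine Polynomial.funext fun z => ?_
    have h2 := congrArg φ (h z)
    simp only [map_sum, map_smul, smul_eq_mul, map_zero] at h2
    simp only [Polynomial.eval_finsetSum, Polynomial.eval_mul, Polynomial.eval_C,
      Polynomial.eval_pow, Polynomial.eval_X, Polynomial.eval_zero]
    rw [← h2]
    exact Finset.sum_congr rfl fun p _ => mul_comm _ _
  have h3 := congrArg (fun q => Polynomial.coeff q p) h1
  simpa [Polynomial.finsetSum_coeff, Polynomial.coeff_C_mul, Polynomial.coeff_X_pow, hp] using h3

theorem linearForm_pow (z w : ℂ) (k : ℕ) :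
    ((C z * X 0 + C w * X 1) ^ k : MvPolynomial (Fin 2) ℂ) =
      ∑ p ∈ Finset.range (k + 1), (k.choose p * z ^ p * w ^ (k - p)) • (X 0 ^ p * X 1 ^ (k - p)) := by
  rw [add_pow]
  refine Finset.sum_congr rfl fun p _ => ?_
  rw [MvPolynomial.smul_eq_C_mul, mul_pow, mul_pow]
  simp only [map_mul, map_pow, map_natCast]
  ring

/-- Linear maps on binary forms are determined by their values on the powers of the linear forms in
the orbit of `X 0` under the unit quaternions. -/
theorem eq_of_eq_on_orbit {k : ℕ} {f f' : MvPolynomial (Fin 2) ℂ →ₗ[ℂ] W}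
    (h : ∀ g : ℍ[ℝ], ‖g‖ = 1 → f (symAct g (X 0 ^ k)) = f' (symAct g (X 0 ^ k)))
    {P : MvPolynomial (Fin 2) ℂ} (hP : P.IsHomogeneous k) : f P = f' P := by
  have h1 : ∀ z : ℂ, f ((C z * X 0 + C 1 * X 1) ^ k) = f' ((C z * X 0 + C 1 * X 1) ^ k) := by
    intro z
    -- The quaternion z + j sends h₁ to z h₁ + h₂; normalising it to unit length costs a nonzero
    -- factor, removed by homogeneity.
    set g := ofCoords z 1 with hg
    have hg0 : ‖g‖ ≠ 0 := by
      intro h0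
      have := congrArg sndCoord (norm_eq_zero.1 h0)
      rw [hg, sndCoord_ofCoords] at this
      simpa [sndCoord] using congrArg Complex.re this
    have hu := h ((‖g‖⁻¹ : ℝ) • g) (by rw [norm_smul]; simp [hg0])
    have h2 : symAct ((‖g‖⁻¹ : ℝ) • g) (X 0 ^ k) =
        ((‖g‖⁻¹ : ℝ) : ℂ) ^ k • (C z * X 0 + C 1 * X 1) ^ k := by
      have hf : fstCoord ((‖g‖⁻¹ : ℝ) • g) = ((‖g‖⁻¹ : ℝ) : ℂ) * z := by
        rw [← fstCoord_ofCoords z 1, ← hg]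
        apply Complex.ext <;> simp [fstCoord]
      have hs : sndCoord ((‖g‖⁻¹ : ℝ) • g) = ((‖g‖⁻¹ : ℝ) : ℂ) * 1 := by
        rw [← sndCoord_ofCoords z 1, ← hg]
        apply Complex.ext <;> simp [sndCoord]
      rw [map_pow, symAct_X_zero, hf, hs, MvPolynomial.smul_eq_C_mul, map_pow, ← mul_pow]
      congr 1
      simp only [map_mul]
      ring
    rw [h2, map_smul, map_smul] at hu
    exact smul_right_injective W (pow_ne_zero k (by exact_mod_cast inv_ne_zero hg0)) hu
  have h3 : ∀ p < k + 1, (f - f') (X 0 ^ p * X 1 ^ (k - p)) = 0 := by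
    intro p hp
    -- The coefficient of z^p in (z h₁ + h₂)^k is a binomial multiple of the monomial, and the
    -- binomial is nonzero.
    have h4 := eq_zero_of_sum_pow_smul (n := k + 1)
      (a := fun p => (k.choose p : ℂ) • (f - f') (X 0 ^ p * X 1 ^ (k - p))) (fun z => ?_) hp
    · exact eq_zero_of_smul_eq_zero (by
        exact_mod_cast (Nat.choose_pos (Nat.lt_succ_iff.1 hp)).ne') h4
    · have h5 : (f - f') ((C z * X 0 + C 1 * X 1) ^ k) = 0 := by
        rw [LinearMap.sub_apply, h1 z, sub_self]
      rw [linearForm_pow, map_sum] at h5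
      rw [← h5]
      refine Finset.sum_congr rfl fun p _ => ?_
      rw [map_smul, smul_smul, one_pow, mul_one, mul_comm]
  rw [← sub_eq_zero, ← LinearMap.sub_apply, eq_sum_of_isHomogeneous hP, map_sum]
  refine Finset.sum_eq_zero fun p hp => ?_
  rw [map_smul, h3 p (Finset.mem_range.1 hp), smul_zero]

end Polynomials

/-! ### Translates of (m,0)-forms under quaternions. -/

section QuaternionicForms

variable {V : Type*} [AddCommGroup V] [Module ℝ V] [TopologicalSpace V]
  [IsTopologicalAddGroup V] [ContinuousSMul ℝ V] {m : ℕ} {I J K : V →L[ℝ] V}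

/-- Operators `I, J, K` defining a right action of the quaternions on `V`. -/
structure IsQuaternionic (I J K : V →L[ℝ] V) : Prop where
  I_sq : ∀ v, I (I v) = -v
  J_sq : ∀ v, J (J v) = -v
  K_eq : ∀ v, K v = J (I v)
  K_eq' : ∀ v, K v = -I (J v)

theorem IsQuaternionic.I_J (h : IsQuaternionic I J K) (v : V) : I (J v) = -J (I v) := by
  rw [← h.K_eq, h.K_eq', neg_neg]

theorem rightMul_apply (g : ℍ[ℝ]) (v : V) :
    rightMul I J K g v = g.re • v + g.imI • I v + g.imJ • J v + g.imK • K v := rfl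

/-- For a right action, v·(z + jw) = v·z + (v·j)·w: `J` acts before the complex number w. -/
theorem IsQuaternionic.rightMul_eq (h : IsQuaternionic I J K) (g : ℍ[ℝ]) (v : V) :
    rightMul I J K g v = complexAct I (fstCoord g) v + complexAct I (sndCoord g) (J v) := by
  rw [rightMul_apply, complexAct_apply, complexAct_apply, h.K_eq']
  simp only [fstCoord, sndCoord]
  module

theorem IsQuaternionic.rightMul_rightMul (h : IsQuaternionic I J K) (g g' : ℍ[ℝ]) (v : V) :
    rightMul I J K g' (rightMul I J K g v) = rightMul I J K (g * g') v := by
  simp only [rightMul_apply, h.K_eq, map_add, map_smul, h.I_sq, h.J_sq, h.I_J, map_neg,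
    Quaternion.re_mul, Quaternion.imI_mul, Quaternion.imJ_mul, Quaternion.imK_mul]
  module

theorem IsQuaternionic.pull_rightMul (h : IsQuaternionic I J K) (g g' : ℍ[ℝ])
    (α : V [⋀^Fin m]→L[ℝ] ℂ) : pull m (rightMul I J K g) (pull m (rightMul I J K g') α) =
      pull m (rightMul I J K (g * g')) α := by
  ext v
  simp only [pull_apply, h.rightMul_rightMul]

theorem IsQuaternionic.J_complexAct (h : IsQuaternionic I J K) (z : ℂ) (v : V) :
    J (complexAct I z v) = complexAct I (starRingEnd ℂ z) (J v) := by
  simp only [complexAct_apply, map_add, map_smul, h.I_J, Complex.conj_re, Complex.conj_im]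
  module

theorem rightMul_ofCoords_zero (z : ℂ) : rightMul I J K (ofCoords z 0) = complexAct I z := by
  ext v
  rw [rightMul_apply]
  simp [complexAct_apply, ofCoords]

theorem norm_ofCoords_zero (z : ℂ) : ‖ofCoords z 0‖ = ‖z‖ := by
  rw [← sq_eq_sq₀ (norm_nonneg _) (norm_nonneg _), sq, ← Quaternion.normSq_eq_norm_mul_self,
    ← Complex.normSq_eq_norm_sq, Complex.normSq_apply, Quaternion.normSq_def']
  simp [ofCoords]
  ring

theorem prod_ite_val_lt (m p : ℕ) (hp : p ≤ m) (a b : ℂ) :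
    ∏ i : Fin m, (if i.val < p then a else b) = a ^ p * b ^ (m - p) := by
  obtain ⟨q, rfl⟩ := Nat.exists_eq_add_of_le hp
  rw [Fin.prod_univ_add]
  simp

theorem hMul_self (α : V [⋀^Fin m]→L[ℝ] ℂ) : hMul J m m α = α := by
  ext v
  have hm : (m.factorial : ℂ) ≠ 0 := by exact_mod_cast m.factorial_ne_zero
  simp [hMul_apply, Fintype.card_perm, hm]

/-- Averaging over permutations only depends on the number of slots with a `J`. -/
theorem sum_perm_apply_ite (J : V →L[ℝ] V) (α : V [⋀^Fin m]→L[ℝ] ℂ) (v : Fin m → V)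
    (S : Finset (Fin m)) :
    (m.factorial : ℂ)⁻¹ * ∑ σ : Equiv.Perm (Fin m), α (fun i => if σ i ∈ S then v i else J (v i)) =
      hMul J m S.card α v := by
  have hS : S.card ≤ m := by simpa using S.card_le_univ
  have hcard : Fintype.card {x // x ∈ S} = Fintype.card {x : Fin m // x.val < S.card} := by
    rw [Fintype.card_coe, Fintype.card_subtype]
    obtain ⟨q, hq⟩ := Nat.exists_eq_add_of_le hS
    simp [Fin.card_filter_val_lt, hS]
  -- Extended to a permutation, this carries S to the first |S| indices, and the sum over
  -- permutations absorbs it.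
  let e := Fintype.equivOfCardEq hcard
  have he : ∀ x, (e.extendSubtype x).val < S.card ↔ x ∈ S := fun x =>
    ⟨fun h => by_contra fun hx => e.extendSubtype_not_mem x hx h, e.extendSubtype_mem x⟩
  rw [hMul_apply]
  congr 1
  rw [← Equiv.sum_comp (Equiv.mulLeft e.extendSubtype)
    fun σ : Equiv.Perm (Fin m) => α fun i => if (σ i).val < S.card then v i else J (v i)]
  refine Finset.sum_congr rfl fun σ _ => ?_
  congr 1
  funext i
  simp only [Equiv.coe_mulLeft, Equiv.Perm.mul_apply, he]

/-- Relabelling indices permutes the subsets and preserves their sizes. The sum therefore equals its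
average over permutations, and that average depends only on the cardinality of each subset. -/
theorem sum_finset_apply_ite (J : V →L[ℝ] V) (α : V [⋀^Fin m]→L[ℝ] ℂ) (v : Fin m → V) (c : ℕ → ℂ) :
    ∑ S : Finset (Fin m), c S.card * α (fun i => if i ∈ S then v i else J (v i)) =
      ∑ p ∈ Finset.range (m + 1), m.choose p * (c p * hMul J m p α v) := by
  have hm : (m.factorial : ℂ) ≠ 0 := by exact_mod_cast m.factorial_ne_zero
  have h1 : ∀ σ : Equiv.Perm (Fin m),
      ∑ S : Finset (Fin m), c S.card * α (fun i => if i ∈ S then v i else J (v i)) =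
        ∑ S : Finset (Fin m), c S.card * α (fun i => if σ i ∈ S then v i else J (v i)) := by
    intro σ
    rw [← Equiv.sum_comp (Equiv.finsetCongr σ.symm)]
    refine Finset.sum_congr rfl fun S _ => ?_
    simp only [Equiv.finsetCongr_apply, Finset.card_map, Finset.mem_map_equiv, Equiv.symm_symm]
  have h2 : ∑ S : Finset (Fin m), c S.card * α (fun i => if i ∈ S then v i else J (v i)) =
      ∑ S : Finset (Fin m), c S.card * hMul J m S.card α v := by
    simp only [← sum_perm_apply_ite]
    have h3 : ∑ _σ : Equiv.Perm (Fin m),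
        ∑ S : Finset (Fin m), c S.card * α (fun i => if i ∈ S then v i else J (v i)) =
        m.factorial * ∑ S : Finset (Fin m), c S.card * α (fun i => if i ∈ S then v i else J (v i)) := by
      rw [Finset.sum_const, Finset.card_univ, Fintype.card_perm, Fintype.card_fin, nsmul_eq_mul]
    rw [← mul_right_inj' hm, ← h3, Finset.sum_congr rfl fun σ _ => h1 σ, Finset.sum_comm,
      Finset.mul_sum]
    refine Finset.sum_congr rfl fun S _ => ?_
    rw [mul_left_comm, ← mul_assoc (m.factorial : ℂ), mul_inv_cancel₀ hm, one_mul, Finset.mul_sum]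
  rw [h2, ← Finset.powerset_univ,
    Finset.sum_powerset_apply_card (fun p => c p * hMul J m p α v)]
  simp

variable [FiniteDimensional ℝ V] [T2Space V]

/-- `J` is antilinear for I, so the p slots without `J` contribute z and the other q contribute its
conjugate. -/
theorem IsQuaternionic.hMul_mem_typeForms (h : IsQuaternionic I J K) {p q : ℕ} (hpq : p + q = m)
    {α : V [⋀^Fin m]→L[ℝ] ℂ} (hα : α ∈ typeForms I m m 0) : hMul J m p α ∈ typeForms I m p q := by
  rw [mem_typeForms]
  intro z
  ext v
  rw [pull_apply, hMul_apply, ContinuousAlternatingMap.smul_apply, hMul_apply, smul_eq_mul,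
    mul_left_comm]
  congr 1
  rw [Finset.mul_sum]
  refine Finset.sum_congr rfl fun σ _ => ?_
  have h1 : (fun i => if (σ i).val < p then complexAct I z (v i) else J (complexAct I z (v i))) =
      fun i => complexAct I (if (σ i).val < p then z else starRingEnd ℂ z)
        (if (σ i).val < p then v i else J (v i)) := by
    funext i
    split_ifs
    · rfl
    · exact h.J_complexAct z (v i)
  rw [h1, apply_complexAct h.I_sq hα,
    Equiv.prod_comp σ fun i => if i.val < p then z else starRingEnd ℂ z,
    prod_ite_val_lt m p (by omega), show m - p = q by omega]

/-- The binomial theorem for (z h₁ + w h₂)^m: expand each slot as v·z + (v·j)·w, extract the scalars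
by slotwise linearity, and group the subsets of slots by size. -/
theorem IsQuaternionic.pull_rightMul_eq_sum (h : IsQuaternionic I J K) {α : V [⋀^Fin m]→L[ℝ] ℂ}
    (hα : α ∈ typeForms I m m 0) (g : ℍ[ℝ]) : pull m (rightMul I J K g) α =
      ∑ p ∈ Finset.range (m + 1),
        (m.choose p * fstCoord g ^ p * sndCoord g ^ (m - p)) • hMul J m p α := by
  ext v
  have h1 : pull m (rightMul I J K g) α v = α.toMultilinearMap
      ((fun i => complexAct I (fstCoord g) (v i)) +
        fun i => complexAct I (sndCoord g) (J (v i))) :=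
    congrArg α (funext fun i => h.rightMul_eq g (v i))
  rw [h1, MultilinearMap.map_add_univ]
  have h2 : ∀ S : Finset (Fin m), α.toMultilinearMap
      (S.piecewise (fun i => complexAct I (fstCoord g) (v i))
        fun i => complexAct I (sndCoord g) (J (v i))) =
      (fstCoord g ^ S.card * sndCoord g ^ (m - S.card)) *
        α (fun i => if i ∈ S then v i else J (v i)) := by
    intro S
    have h3 : S.piecewise (fun i => complexAct I (fstCoord g) (v i))
        (fun i => complexAct I (sndCoord g) (J (v i))) =
        fun i => complexAct I (if i ∈ S then fstCoord g else sndCoord g)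
          (if i ∈ S then v i else J (v i)) := by
      funext i
      by_cases hi : i ∈ S <;> simp [hi]
    rw [h3]
    refine (apply_complexAct h.I_sq hα _ _).trans ?_
    congr 1
    rw [Finset.prod_ite, Finset.prod_const, Finset.prod_const]
    congr 2
    · congr 1; ext i; simp
    · rw [show Finset.univ.filter (fun i => i ∉ S) = Sᶜ by ext i; simp, Finset.card_compl,
        Fintype.card_fin]
  rw [Finset.sum_congr rfl fun S _ => h2 S,
    sum_finset_apply_ite J α v fun p => fstCoord g ^ p * sndCoord g ^ (m - p)]
  simp only [ContinuousAlternatingMap.sum_apply, ContinuousAlternatingMap.smul_apply, smul_eq_mul,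
    mul_assoc]

end QuaternionicForms

/-! ### Forms of maximal weight. -/

section MaximalWeight

open MvPolynomial

variable {V : Type*} [AddCommGroup V] [Module ℝ V] [TopologicalSpace V]
  [IsTopologicalAddGroup V] [ContinuousSMul ℝ V] {m : ℕ} {I J K : V →L[ℝ] V}

/-- The map from binary forms to differential forms sending `X 0 ^ p * X 1 ^ (m - p)` to
`hMul J m p α`. -/
def symMap (J : V →L[ℝ] V) (α : V [⋀^Fin m]→L[ℝ] ℂ) :
    MvPolynomial (Fin 2) ℂ →ₗ[ℂ] (V [⋀^Fin m]→L[ℝ] ℂ) :=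
  ∑ p ∈ Finset.range (m + 1),
    (lcoeff ℂ (Finsupp.single 0 p + Finsupp.single 1 (m - p))).smulRight (hMul J m p α)

theorem symMap_apply (α : V [⋀^Fin m]→L[ℝ] ℂ) (P : MvPolynomial (Fin 2) ℂ) :
    symMap J α P = ∑ p ∈ Finset.range (m + 1),
      coeff (Finsupp.single 0 p + Finsupp.single 1 (m - p)) P • hMul J m p α := by
  rw [symMap, LinearMap.sum_apply]
  rfl

theorem symMap_X_pow_mul_X_pow (α : V [⋀^Fin m]→L[ℝ] ℂ) {p q : ℕ} (hpq : p + q = m) :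
    symMap J α (X 0 ^ p * X 1 ^ q) = hMul J m p α := by
  rw [symMap_apply, Finset.sum_eq_single p]
  · rw [coeff_X_pow_mul_X_pow, if_pos ⟨rfl, by omega⟩]
    exact one_smul ℂ (hMul J m p α)
  · intro r _ hr
    rw [coeff_X_pow_mul_X_pow, if_neg (fun h => hr h.1.symm)]
    exact zero_smul ℂ (hMul J m r α)
  · intro h
    simp at h
    omega

/-- On homogeneous polynomials the coefficient of h₁^m is the value at (1,0), where the substitution
gives z for h₁ and -w̄ for h₂. -/
theorem coeff_symAct (g : ℍ[ℝ]) {p q m : ℕ} (hpq : p + q = m) :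
    coeff (Finsupp.single 0 m + Finsupp.single 1 0) (symAct g (X 0 ^ p * X 1 ^ q)) =
      fstCoord g ^ p * (-starRingEnd ℂ (sndCoord g)) ^ q := by
  have h : ∀ P : MvPolynomial (Fin 2) ℂ, P.IsHomogeneous m →
      coeff (Finsupp.single 0 m + Finsupp.single 1 0) P = eval ![1, 0] P := by
    intro P hP
    conv_rhs => rw [eq_sum_of_isHomogeneous hP]
    rw [map_sum, Finset.sum_eq_single m]
    · simp
    · intro r hr hrm
      simp only [Finset.mem_range] at hr
      have : m - r ≠ 0 := by omega
      simp [this]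
    · simp
  rw [h _ (hpq ▸ isHomogeneous_symAct g (isHomogeneous_X_pow_mul_X_pow p q)), map_mul, map_pow,
    map_pow, symAct_X_zero, symAct_X_one]
  simp

variable [FiniteDimensional ℝ V] [T2Space V]

theorem IsQuaternionic.symMap_symAct_X_pow (h : IsQuaternionic I J K) {α : V [⋀^Fin m]→L[ℝ] ℂ}
    (hα : α ∈ typeForms I m m 0) (g : ℍ[ℝ]) :
    symMap J α (symAct g (X 0 ^ m)) = pull m (rightMul I J K g) α := by
  rw [map_pow, symAct_X_zero, linearForm_pow, map_sum, h.pull_rightMul_eq_sum hα]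
  refine Finset.sum_congr rfl fun p hp => ?_
  rw [map_smul, symMap_X_pow_mul_X_pow α (by simp at hp; omega)]

/-- Enough to test on the orbit of h₁^m, where both sides are the translate of α by a product of
quaternions. -/
theorem IsQuaternionic.symMap_symAct (h : IsQuaternionic I J K) {α : V [⋀^Fin m]→L[ℝ] ℂ}
    (hα : α ∈ typeForms I m m 0) (g : ℍ[ℝ]) {P : MvPolynomial (Fin 2) ℂ}
    (hP : P.IsHomogeneous m) :
    symMap J α (symAct g P) = pull m (rightMul I J K g) (symMap J α P) := by
  refine eq_of_eq_on_orbit (f := symMap J α ∘ₗ (symAct g).toLinearMap)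
    (f' := pull m (rightMul I J K g) ∘ₗ symMap J α) (fun u _ => ?_) hP
  simp only [LinearMap.comp_apply, AlgHom.toLinearMap_apply]
  rw [← symAct_mul, h.symMap_symAct_X_pow hα, h.symMap_symAct_X_pow hα, h.pull_rightMul]

theorem IsQuaternionic.hMul_mem_plusForms (h : IsQuaternionic I J K) {α : V [⋀^Fin m]→L[ℝ] ℂ}
    (hα : α ∈ typeForms I m m 0) {p : ℕ} (hp : p ≤ m) : hMul J m p α ∈ plusForms I J K m := by
  refine Submodule.mem_iSup_of_mem (symMap J α) (Submodule.mem_iSup_of_mem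
    (fun g _ P hP => h.symMap_symAct hα g hP) ⟨X 0 ^ p * X 1 ^ (m - p), ?_, ?_⟩)
  · have := isHomogeneous_X_pow_mul_X_pow p (m - p)
    rwa [Nat.add_sub_cancel' hp] at this
  · exact symMap_X_pow_mul_X_pow α (Nat.add_sub_cancel' hp)

/-- Images of monomials under equivariant maps are weight vectors of the circle. -/
theorem pull_complexAct_of_equivariant {k : ℕ}
    {T : MvPolynomial (Fin 2) ℂ →ₗ[ℂ] (V [⋀^Fin m]→L[ℝ] ℂ)}
    (hT : ∀ g : ℍ[ℝ], ‖g‖ = 1 → ∀ P ∈ homogeneousSubmodule (Fin 2) ℂ k,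
      T (symAct g P) = pull m (rightMul I J K g) (T P)) {a b : ℕ} (hab : a + b = k)
    (z : ℂ) (hz : ‖z‖ = 1) :
    pull m (complexAct I z) (T (X 0 ^ a * X 1 ^ b)) = z ^ ((a : ℤ) - b) • T (X 0 ^ a * X 1 ^ b) := by
  have hz0 : z ≠ 0 := by rintro rfl; simp at hz
  have h1 := hT (ofCoords z 0) (by rw [norm_ofCoords_zero, hz]) (X 0 ^ a * X 1 ^ b)
    (hab ▸ isHomogeneous_X_pow_mul_X_pow a b)
  rw [rightMul_ofCoords_zero] at h1
  rw [← h1, ← map_smul, map_mul, map_pow, map_pow, symAct_X_zero, symAct_X_one]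
  congr 1
  rw [fstCoord_ofCoords, sndCoord_ofCoords, zpow_sub₀ hz0, zpow_natCast, zpow_natCast,
    conj_eq_inv_of_norm_one hz, MvPolynomial.smul_eq_C_mul, div_eq_mul_inv, ← inv_pow]
  simp only [map_zero, neg_zero, zero_mul, add_zero, zero_add, mul_pow, map_mul, map_pow]
  ring

/-- The image of h₁^m is a vector of circle weight m, hence of type (m,0), and it determines an
equivariant map because the orbit of h₁^m spans. -/
theorem IsQuaternionic.eq_symMap (h : IsQuaternionic I J K)
    {T : MvPolynomial (Fin 2) ℂ →ₗ[ℂ] (V [⋀^Fin m]→L[ℝ] ℂ)}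
    (hT : ∀ g : ℍ[ℝ], ‖g‖ = 1 → ∀ P ∈ homogeneousSubmodule (Fin 2) ℂ m,
      T (symAct g P) = pull m (rightMul I J K g) (T P)) :
    T (X 0 ^ m) ∈ typeForms I m m 0 ∧
      ∀ P : MvPolynomial (Fin 2) ℂ, P.IsHomogeneous m → T P = symMap J (T (X 0 ^ m)) P := by
  have h1 : T (X 0 ^ m) ∈ typeForms I m m 0 := by
    rw [mem_typeForms_iff_circle (add_zero m)]
    intro z hz
    have := pull_complexAct_of_equivariant hT (add_zero m) z hz
    rwa [pow_zero, mul_one] at this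
  refine ⟨h1, fun P hP => eq_of_eq_on_orbit (fun g hg => ?_) hP⟩
  rw [hT g hg _ (isHomogeneous_X_pow 0 m), h.symMap_symAct_X_pow h1]

/-- Forms of maximal weight are sums of the forms `hMul J m p α` with `α` of type `(m,0)`. -/
theorem IsQuaternionic.exists_of_mem_plusForms (h : IsQuaternionic I J K)
    {γ : V [⋀^Fin m]→L[ℝ] ℂ} (hγ : γ ∈ plusForms I J K m) :
    ∃ η : ℕ → V [⋀^Fin m]→L[ℝ] ℂ, (∀ p, η p ∈ typeForms I m m 0) ∧
      γ = ∑ p ∈ Finset.range (m + 1), hMul J m p (η p) := by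
  let S : Submodule ℂ (V [⋀^Fin m]→L[ℝ] ℂ) :=
    { carrier := {γ | ∃ η : ℕ → V [⋀^Fin m]→L[ℝ] ℂ, (∀ p, η p ∈ typeForms I m m 0) ∧
        γ = ∑ p ∈ Finset.range (m + 1), hMul J m p (η p)}
      add_mem' := by
        rintro _ _ ⟨η, hη, rfl⟩ ⟨η', hη', rfl⟩
        refine ⟨fun p => η p + η' p, fun p => add_mem (hη p) (hη' p), ?_⟩
        simp only [map_add, Finset.sum_add_distrib]
      zero_mem' := ⟨fun _ => 0, fun _ => zero_mem _, by simp⟩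
      smul_mem' := by
        rintro c _ ⟨η, hη, rfl⟩
        refine ⟨fun p => c • η p, fun p => Submodule.smul_mem _ c (hη p), ?_⟩
        simp only [map_smul, Finset.smul_sum] }
  have hS : plusForms I J K m ≤ S := by
    refine iSup₂_le fun T hT => ?_
    rintro _ ⟨P, hP, rfl⟩
    obtain ⟨h1, h2⟩ := h.eq_symMap hT
    refine ⟨fun p => coeff (Finsupp.single 0 p + Finsupp.single 1 (m - p)) P • T (X 0 ^ m),
      fun p => Submodule.smul_mem _ _ h1, ?_⟩
    rw [h2 P hP, symMap_apply]
    simp only [map_smul]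
  exact hS hγ

/-- The component of type `(m,0)` of a translate of a form of maximal weight. -/
theorem IsQuaternionic.circleProj_pull_hMul (h : IsQuaternionic I J K)
    {α : V [⋀^Fin m]→L[ℝ] ℂ} (hα : α ∈ typeForms I m m 0) {p q : ℕ} (hpq : p + q = m) (g : ℍ[ℝ]) :
    circleProj I m m (pull m (rightMul I J K g) (hMul J m p α)) =
      (fstCoord g ^ p * (-starRingEnd ℂ (sndCoord g)) ^ q) • α := by
  -- The translate is a combination of the forms `hMul J m r α`, of types (r, m-r); only r = m
  -- survives the projection, and there `hMul` is the identity.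
  rw [← symMap_X_pow_mul_X_pow α hpq, ← h.symMap_symAct hα g
    (hpq ▸ isHomogeneous_X_pow_mul_X_pow p q), symMap_apply, map_sum, Finset.sum_eq_single m]
  · have := circleProj_typeForms (I := I) (add_zero m) (add_zero m) hα
    rw [if_pos rfl, Nat.cast_zero, sub_zero] at this
    rw [map_smul, hMul_self, this, Nat.sub_self, coeff_symAct g hpq]
  · intro r hr hrm
    have hr' : r + (m - r) = m := by simp at hr; omega
    have := circleProj_typeForms (I := I) hr' (add_zero m) (h.hMul_mem_typeForms hr' hα)
    rw [if_neg hrm, Nat.cast_zero, sub_zero] at this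
    rw [map_smul, this]
    exact smul_zero (M := ℂ) (A := V [⋀^Fin m]→L[ℝ] ℂ) _
  · simp

/-- A translate stays in the image of Sym^k with k < m, whose circle weights are at most k in
absolute value. -/
theorem circleProj_pull_of_mem_lowForms {γ : V [⋀^Fin m]→L[ℝ] ℂ} (hγ : γ ∈ lowForms I J K m)
    {g : ℍ[ℝ]} (hg : ‖g‖ = 1) : circleProj I m m (pull m (rightMul I J K g) γ) = 0 := by
  have hle : lowForms I J K m ≤
      LinearMap.ker (circleProj I m m ∘ₗ pull m (rightMul I J K g)) := by
    refine iSup₂_le fun k hk => iSup₂_le fun T hT => ?_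
    rintro _ ⟨P, hP, rfl⟩
    rw [LinearMap.mem_ker, LinearMap.comp_apply, ← hT g hg P hP,
      eq_sum_of_isHomogeneous (isHomogeneous_symAct g hP), map_sum, map_sum]
    refine Finset.sum_eq_zero fun a ha => ?_
    rw [Finset.mem_range] at ha
    rw [map_smul, map_smul, circleProj_eq (by simp) (by rw [abs_le]; omega)
      (pull_complexAct_of_equivariant hT (show a + (k - a) = k by omega)), if_neg (by omega)]
    exact smul_zero (M := ℂ) (A := V [⋀^Fin m]→L[ℝ] ℂ) _
  exact hle hγ

/-- Writing γ as the sum of h₁^p h₂^(m-p) η_p, the hypothesis says that the sum of z^p (-w̄)^(m-p)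
η_p vanishes for all unit quaternions. As a polynomial identity in z this kills every η_p. -/
theorem IsQuaternionic.eq_zero_of_mem_plusForms (h : IsQuaternionic I J K)
    {γ : V [⋀^Fin m]→L[ℝ] ℂ} (hγ : γ ∈ plusForms I J K m)
    (h0 : ∀ g : ℍ[ℝ], ‖g‖ = 1 → circleProj I m m (pull m (rightMul I J K g) γ) = 0) : γ = 0 := by
  obtain ⟨η, hη, rfl⟩ := h.exists_of_mem_plusForms hγ
  have h1 : ∀ g : ℍ[ℝ], ‖g‖ = 1 → ∑ p ∈ Finset.range (m + 1),
      (fstCoord g ^ p * (-starRingEnd ℂ (sndCoord g)) ^ (m - p)) • η p = 0 := by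
    intro g hg
    rw [← h0 g hg, map_sum, map_sum]
    refine Finset.sum_congr rfl fun p hp => ?_
    rw [h.circleProj_pull_hMul (hη p) (show p + (m - p) = m by simp at hp; omega)]
  refine Finset.sum_eq_zero fun p hp => ?_
  have h2 := eq_zero_of_sum_pow_smul (n := m + 1) (a := η) (fun z => ?_) (Finset.mem_range.1 hp)
  · rw [h2, map_zero]
  -- With w = -1 the factor -w̄ is 1, leaving a polynomial in z alone.
  · set g := ofCoords z (-1) with hg
    have hg0 : ‖g‖ ≠ 0 := by
      intro h0
      have := congrArg sndCoord (norm_eq_zero.1 h0)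
      rw [hg, sndCoord_ofCoords] at this
      simpa [sndCoord] using congrArg Complex.re this
    have hu := h1 ((‖g‖⁻¹ : ℝ) • g) (by rw [norm_smul]; simp [hg0])
    have hf : fstCoord ((‖g‖⁻¹ : ℝ) • g) = ((‖g‖⁻¹ : ℝ) : ℂ) * z := by
      rw [← fstCoord_ofCoords z (-1), ← hg]
      apply Complex.ext <;> simp [fstCoord]
    have hs : sndCoord ((‖g‖⁻¹ : ℝ) • g) = ((‖g‖⁻¹ : ℝ) : ℂ) * (-1) := by
      rw [← sndCoord_ofCoords z (-1), ← hg]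
      apply Complex.ext <;> simp [sndCoord]
    have hne : ((‖g‖⁻¹ : ℝ) : ℂ) ^ m ≠ 0 := pow_ne_zero m (by exact_mod_cast inv_ne_zero hg0)
    refine eq_zero_of_smul_eq_zero hne ?_
    rw [← hu, Finset.smul_sum]
    refine Finset.sum_congr rfl fun p hp => ?_
    rw [smul_smul, hf, hs, map_mul, Complex.conj_ofReal, map_neg, map_one, mul_neg, mul_one,
      neg_neg, mul_pow]
    congr 1
    rw [mul_right_comm, ← pow_add, show p + (m - p) = m by simp at hp; omega]

theorem IsQuaternionic.disjoint_plusForms (h : IsQuaternionic I J K) (m : ℕ) :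
    Disjoint (plusForms I J K m) (lowForms I J K m) := by
  rw [Submodule.disjoint_def]
  intro γ hγ hγ'
  exact h.eq_zero_of_mem_plusForms hγ fun g hg => circleProj_pull_of_mem_lowForms hγ' hg

/-- In the expansion of a form in Λ^m_+, the summand with index r has type (r, m-r), so projecting
to type (p,q) leaves only r = p. -/
theorem IsQuaternionic.mem_plusTypeForms (h : IsQuaternionic I J K) {p q : ℕ} (hpq : p + q = m)
    {γ : V [⋀^Fin m]→L[ℝ] ℂ} (hγ : γ ∈ plusTypeForms I J K m p q) :
    ∃ α ∈ typeForms I m m 0, hMul J m p α = γ := by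
  obtain ⟨hγ1, hγ2⟩ := hγ
  obtain ⟨η, hη, hγ⟩ := h.exists_of_mem_plusForms hγ1
  refine ⟨η p, hη p, ?_⟩
  have h1 := circleProj_typeForms hpq hpq hγ2
  rw [if_pos rfl] at h1
  rw [← h1, hγ, map_sum, Finset.sum_eq_single p]
  · rw [circleProj_typeForms hpq hpq (h.hMul_mem_typeForms hpq (hη p)), if_pos rfl]
  · intro r hr hrp
    rw [circleProj_typeForms (show r + (m - r) = m by simp at hr; omega) hpq
      (h.hMul_mem_typeForms (by simp at hr; omega) (hη r)), if_neg hrp]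
  · intro h'; simp at h'; omega

theorem IsQuaternionic.hMul_mem_plusTypeForms (h : IsQuaternionic I J K) {p q : ℕ}
    (hpq : p + q = m) {α : V [⋀^Fin m]→L[ℝ] ℂ} (hα : α ∈ typeForms I m m 0) :
    hMul J m p α ∈ plusTypeForms I J K m p q :=
  ⟨h.hMul_mem_plusForms hα (by omega), h.hMul_mem_typeForms hpq hα⟩

/-- The inverse of `hMul`. -/
def hDiv (I J : V →L[ℝ] V) (m q : ℕ) : (V [⋀^Fin m]→L[ℝ] ℂ) →ₗ[ℂ] (V [⋀^Fin m]→L[ℝ] ℂ) :=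
  ((-1 : ℂ) ^ q) • circleProj I m m ∘ₗ pull m (ContinuousLinearMap.id ℝ V + J)

/-- At g = 1 + j the component z^p (-w̄)^q is (-1)^q, which the sign in `hDiv` cancels. The
component formula holds for all quaternions, so g need not be normalised. -/
theorem IsQuaternionic.hDiv_hMul (h : IsQuaternionic I J K) {p q : ℕ} (hpq : p + q = m)
    {α : V [⋀^Fin m]→L[ℝ] ℂ} (hα : α ∈ typeForms I m m 0) :
    hDiv I J m q (hMul J m p α) = α := by
  have h1 := h.circleProj_pull_hMul hα hpq (ofCoords 1 1)
  have h2 : rightMul I J K (ofCoords 1 1) = ContinuousLinearMap.id ℝ V + J := by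
    ext v
    rw [rightMul_apply]
    simp [ofCoords]
  rw [h2] at h1
  rw [hDiv, LinearMap.smul_apply, LinearMap.comp_apply, h1, fstCoord_ofCoords, sndCoord_ofCoords,
    smul_smul, map_one, one_pow, one_mul, ← mul_pow]
  rw [neg_mul_neg, one_mul, one_pow]
  exact one_smul ℂ α

theorem IsQuaternionic.bijOn_hMul (h : IsQuaternionic I J K) {p q : ℕ} (hpq : p + q = m) :
    Set.BijOn (hMul J m p) (typeForms I m m 0) (plusTypeForms I J K m p q) :=
  ⟨fun _ hα => h.hMul_mem_plusTypeForms hpq hα,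
    fun α hα β hβ hab => by rw [← h.hDiv_hMul hpq hα, hab, h.hDiv_hMul hpq hβ],
    fun _ hγ => h.mem_plusTypeForms hpq hγ⟩

end MaximalWeight

/-! ### Clebsch–Gordan: bounding the weights in products of covectors. -/

section ClebschGordan

open MvPolynomial

/-- The part of weight `k` of a representation `ρ` of the unit quaternions. -/
def weightPart {W : Type*} [AddCommGroup W] [Module ℂ W] (ρ : ℍ[ℝ] → W → W) (k : ℕ) :
    Submodule ℂ W :=
  ⨆ (T : MvPolynomial (Fin 2) ℂ →ₗ[ℂ] W)
    (_ : ∀ g : ℍ[ℝ], ‖g‖ = 1 → ∀ P ∈ homogeneousSubmodule (Fin 2) ℂ k,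
      T (symAct g P) = ρ g (T P)),
    (homogeneousSubmodule (Fin 2) ℂ k).map T

variable {W A : Type*} [AddCommGroup W] [Module ℂ W] [AddCommGroup A] [Module ℂ A]
  {ρ : ℍ[ℝ] → W →ₗ[ℂ] W} {r : ℍ[ℝ] → A →ₗ[ℂ] A}

theorem fstCoord_smul_add_norm (g : ℍ[ℝ]) (hg : ‖g‖ = 1) :
    fstCoord g * starRingEnd ℂ (fstCoord g) + sndCoord g * starRingEnd ℂ (sndCoord g) = 1 := by
  have h : g.re ^ 2 + g.imI ^ 2 + g.imJ ^ 2 + g.imK ^ 2 = 1 := by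
    rw [← Quaternion.normSq_def', Quaternion.normSq_eq_norm_mul_self, hg, one_mul]
  apply Complex.ext
  · simp [fstCoord, sndCoord]
    linarith
  · simp [fstCoord, sndCoord]
    ring

/-- An equivariant map from the tensor product of a space of binary forms of degree `k` and `m`
copies of a sum of standard representations takes its values in the parts of weight at most
`k + m`. -/
theorem multilinear_mem_iSup_weightPart
    (hA : ∀ θ : A, ∃ a b a' b' : A, θ = a + b' ∧
      (∀ g, r g a = fstCoord g • a + sndCoord g • b) ∧
      (∀ g, r g b = -starRingEnd ℂ (sndCoord g) • a + starRingEnd ℂ (fstCoord g) • b) ∧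
      (∀ g, r g a' = fstCoord g • a' + sndCoord g • b') ∧
      (∀ g, r g b' = -starRingEnd ℂ (sndCoord g) • a' + starRingEnd ℂ (fstCoord g) • b')) :
    ∀ (m k : ℕ) (B : MvPolynomial (Fin 2) ℂ →ₗ[ℂ] MultilinearMap ℂ (fun _ : Fin m => A) W),
      (∀ g : ℍ[ℝ], ‖g‖ = 1 → ∀ P : MvPolynomial (Fin 2) ℂ, P.IsHomogeneous k →
        ∀ θ : Fin m → A, B (symAct g P) (fun i => r g (θ i)) = ρ g (B P θ)) →
      ∀ P : MvPolynomial (Fin 2) ℂ, P.IsHomogeneous k → ∀ θ : Fin m → A,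
        B P θ ∈ ⨆ (j : ℕ) (_ : j ≤ k + m), weightPart (fun g => ρ g) j := by
  intro m
  induction m with
  | zero =>
    -- Without covectors left, `B` is itself an equivariant map from Sym^k.
    intro k B hB P hP θ
    let T : MvPolynomial (Fin 2) ℂ →ₗ[ℂ] W :=
      { toFun := fun P => B P θ
        map_add' := fun P Q => by rw [map_add]; rfl
        map_smul' := fun c P => by rw [map_smul]; rfl }
    refine Submodule.mem_iSup_of_mem k (Submodule.mem_iSup_of_mem le_rfl ?_)
    refine Submodule.mem_iSup_of_mem T (Submodule.mem_iSup_of_mem ?_ ⟨P, hP, rfl⟩)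
    intro g hg Q hQ
    have := hB g hg Q hQ θ
    rwa [Subsingleton.elim (fun i => r g (θ i)) θ] at this
  | succ m ih =>
    intro k B hB
    -- currying in the first covector
    let Cu : A → MvPolynomial (Fin 2) ℂ →ₗ[ℂ] MultilinearMap ℂ (fun _ : Fin m => A) W := fun a =>
      { toFun := fun P => (B P).curryLeft a
        map_add' := fun P Q => by rw [map_add]; rfl
        map_smul' := fun c P => by rw [map_smul]; rfl }
    have hCu : ∀ a P θ, Cu a P θ = B P (Fin.cons a θ) := fun a P θ => rfl
    have hadd : ∀ a b P θ, Cu (a + b) P θ = Cu a P θ + Cu b P θ := fun a b P θ => by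
      change (B P).curryLeft (a + b) θ = _
      rw [map_add]; rfl
    have hsmul : ∀ (c : ℂ) a P θ, Cu (c • a) P θ = c • Cu a P θ := fun c a P θ => by
      change (B P).curryLeft (c • a) θ = _
      rw [map_smul]; rfl
    have hCuB : ∀ g : ℍ[ℝ], ‖g‖ = 1 → ∀ P : MvPolynomial (Fin 2) ℂ, P.IsHomogeneous k →
        ∀ (a : A) (θ : Fin m → A),
          Cu (r g a) (symAct g P) (fun i => r g (θ i)) = ρ g (Cu a P θ) := by
      intro g hg P hP a θ
      rw [hCu, hCu, ← hB g hg P hP]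
      congr 1
      funext i
      refine Fin.cases ?_ (fun i => ?_) i <;> simp
    have key : ∀ a b : A, (∀ g, r g a = fstCoord g • a + sndCoord g • b) →
        (∀ g, r g b = -starRingEnd ℂ (sndCoord g) • a + starRingEnd ℂ (fstCoord g) • b) →
        ∀ P : MvPolynomial (Fin 2) ℂ, P.IsHomogeneous k → ∀ θ : Fin m → A,
          Cu a P θ ∈ ⨆ (j : ℕ) (_ : j ≤ k + (m + 1)), weightPart (fun g => ρ g) j ∧
          Cu b P θ ∈ ⨆ (j : ℕ) (_ : j ≤ k + (m + 1)), weightPart (fun g => ρ g) j := by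
      intro a b ha hb P hP θ
      set N := ⨆ (j : ℕ) (_ : j ≤ k + (m + 1)), weightPart (fun g => ρ g) j with hN
      -- The two Clebsch–Gordan embeddings of Sym^(k+1) and Sym^(k-1) into Sym^k ⊗ ℂ², with (a, b)
      -- in the role of (h₁, h₂). Each absorbs one covector, so the induction hypothesis applies to
      -- both.
      let B₁ : MvPolynomial (Fin 2) ℂ →ₗ[ℂ] MultilinearMap ℂ (fun _ : Fin m => A) W :=
        Cu a ∘ₗ (pderiv 0).toLinearMap + Cu b ∘ₗ (pderiv 1).toLinearMap
      let B₂ : MvPolynomial (Fin 2) ℂ →ₗ[ℂ] MultilinearMap ℂ (fun _ : Fin m => A) W :=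
        Cu b ∘ₗ LinearMap.mulLeft ℂ (X 0) - Cu a ∘ₗ LinearMap.mulLeft ℂ (X 1)
      have hB₁ : ∀ Q θ, B₁ Q θ = Cu a (pderiv 0 Q) θ + Cu b (pderiv 1 Q) θ := fun Q θ => rfl
      have hB₂ : ∀ Q θ, B₂ Q θ = Cu b (X 0 * Q) θ - Cu a (X 1 * Q) θ := fun Q θ => rfl
      have hC : ∀ (c : ℂ) a Q θ, Cu a (C c * Q) θ = c • Cu a Q θ := fun c a Q θ => by
        rw [← MvPolynomial.smul_eq_C_mul, map_smul]; rfl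
      have hCadd : ∀ a Q Q' θ, Cu a (Q + Q') θ = Cu a Q θ + Cu a Q' θ := fun a Q Q' θ => by
        rw [map_add]; rfl
      have h₁ : ∀ Q : MvPolynomial (Fin 2) ℂ, Q.IsHomogeneous (k + 1) → ∀ θ, B₁ Q θ ∈ N := by
        intro Q hQ θ
        have := ih (k + 1) B₁ (fun g hg Q hQ θ => ?_) Q hQ θ
        · rwa [show k + 1 + m = k + (m + 1) by omega] at this
        · have h0 : (pderiv 0 Q).IsHomogeneous k := by simpa using hQ.pderiv (i := 0)
          have h1 : (pderiv 1 Q).IsHomogeneous k := by simpa using hQ.pderiv (i := 1)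
          rw [hB₁, hB₁, (pderiv_symAct g Q).1, (pderiv_symAct g Q).2, map_add (ρ g),
            ← hCuB g hg _ h0, ← hCuB g hg _ h1, ha, hb]
          simp only [hCadd, hC, hadd, hsmul]
          module
      have h₂ : ∀ j, j + 1 = k → ∀ Q : MvPolynomial (Fin 2) ℂ, Q.IsHomogeneous j →
          ∀ θ, B₂ Q θ ∈ N := by
        intro j hj Q hQ θ
        have := ih j B₂ (fun g hg Q hQ θ => ?_) Q hQ θ
        · refine (?_ : (⨆ (i : ℕ) (_ : i ≤ j + m), weightPart (fun g => ρ g) i) ≤ N) this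
          exact iSup₂_le fun i hi => le_iSup₂ (f := fun (i : ℕ) (_ : i ≤ k + (m + 1)) =>
            weightPart (fun g => ρ g) i) i (by omega)
        · have h0 : (X 0 * Q).IsHomogeneous k := by
            rw [← hj, add_comm]; exact (isHomogeneous_X ℂ 0).mul hQ
          have h1 : (X 1 * Q).IsHomogeneous k := by
            rw [← hj, add_comm]; exact (isHomogeneous_X ℂ 1).mul hQ
          rw [hB₂, hB₂, map_sub (ρ g), ← hCuB g hg _ h0, ← hCuB g hg _ h1, ha, hb,
            map_mul (symAct g), map_mul (symAct g),
            symAct_X_zero, symAct_X_one]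
          simp only [add_mul, mul_assoc, hCadd, hC, hadd, hsmul]
          -- Invariance of the antisymmetric tensor h₁ ⊗ h₂ - h₂ ⊗ h₁ is the determinant condition,
          -- that is, unit norm.
          have hn := fstCoord_smul_add_norm g hg
          set x₁ := Cu a (X 0 * symAct g Q) fun i => r g (θ i)
          set x₂ := Cu a (X 1 * symAct g Q) fun i => r g (θ i)
          set y₁ := Cu b (X 0 * symAct g Q) fun i => r g (θ i)
          set y₂ := Cu b (X 1 * symAct g Q) fun i => r g (θ i)
          linear_combination (norm := module) hn • (x₂ - y₁)
      have hEuler : X 0 * pderiv 0 P + X 1 * pderiv 1 P = C (k : ℂ) * P := by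
        have := hP.sum_X_mul_pderiv
        rw [Fin.sum_univ_two, nsmul_eq_mul] at this
        rw [this, map_natCast]
      have hd : ∀ i, B₂ (pderiv i P) θ ∈ N := by
        intro i
        rcases Nat.eq_zero_or_pos k with hk | hk
        · have : pderiv i P = 0 := by
            subst hk
            rw [(totalDegree_eq_zero_iff_eq_C (p := P)).1
              ((totalDegree_zero_iff_isHomogeneous (Fin 2)).2 hP), pderiv_C]
          rw [this, map_zero]
          exact zero_mem N
        · exact h₂ (k - 1) (by omega) _ hP.pderiv θ
      have hk0 : ((k : ℂ) + 1) ≠ 0 := by exact_mod_cast k.succ_ne_zero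
      have hX : ∀ i : Fin 2, (X i * P).IsHomogeneous (k + 1) := fun i => by
        rw [add_comm]; exact (isHomogeneous_X ℂ i).mul hP
      have hE : ∀ a θ, Cu a (X 0 * pderiv 0 P) θ + Cu a (X 1 * pderiv 1 P) θ = (k : ℂ) • Cu a P θ := by
        intro a θ
        rw [← hCadd, hEuler, hC]
      constructor
      -- Euler's identity, together with the term P from differentiating X₀P, recovers (k+1) P ⊗ a
      -- from the two embeddings.
      · have e : ((k : ℂ) + 1) • Cu a P θ = B₁ (X 0 * P) θ - B₂ (pderiv 1 P) θ := by
          rw [hB₁, hB₂]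
          simp only [Derivation.leibniz, smul_eq_mul, pderiv_X_self,
            pderiv_X_of_ne (zero_ne_one : (0 : Fin 2) ≠ 1), mul_one, mul_zero, add_zero, hCadd]
          have := hE a θ
          linear_combination (norm := module) -this
        have h3 : ((k : ℂ) + 1) • Cu a P θ ∈ N := e ▸ sub_mem (h₁ _ (hX 0) θ) (hd 1)
        exact (Submodule.smul_mem_iff N hk0).1 h3
      · have e : ((k : ℂ) + 1) • Cu b P θ = B₁ (X 1 * P) θ + B₂ (pderiv 0 P) θ := by
          rw [hB₁, hB₂]
          simp only [Derivation.leibniz, smul_eq_mul, pderiv_X_self,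
            pderiv_X_of_ne (one_ne_zero : (1 : Fin 2) ≠ 0), mul_one, mul_zero, add_zero, hCadd]
          have := hE b θ
          linear_combination (norm := module) -this
        have h3 : ((k : ℂ) + 1) • Cu b P θ ∈ N := e ▸ add_mem (h₁ _ (hX 1) θ) (hd 0)
        exact (Submodule.smul_mem_iff N hk0).1 h3
    intro P hP θ
    obtain ⟨a, b, a', b', h0, ha, hb, ha', hb'⟩ := hA (θ 0)
    have h1 : B P θ = Cu a P (Fin.tail θ) + Cu b' P (Fin.tail θ) := by
      rw [← hadd, ← h0, hCu, Fin.cons_self_tail]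
    rw [h1]
    exact add_mem (key a b ha hb P hP _).1 (key a' b' ha' hb' P hP _).2

end ClebschGordan

/-! ### Maximal weight and smaller weights are complementary. -/

section WeightDecomposition

open MvPolynomial

variable {V : Type*} [AddCommGroup V] [Module ℝ V] [TopologicalSpace V]
  [IsTopologicalAddGroup V] [ContinuousSMul ℝ V] {m : ℕ} {I J K : V →L[ℝ] V}

/-- Precomposition of covectors with an operator. -/
def covectorPull (L : V →L[ℝ] V) : (V →L[ℝ] ℂ) →ₗ[ℂ] (V →L[ℝ] ℂ) where
  toFun θ := θ ∘L L
  map_add' _ _ := rfl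
  map_smul' _ _ := rfl

theorem covectorPull_apply (L : V →L[ℝ] V) (θ : V →L[ℝ] ℂ) (v : V) :
    covectorPull L θ v = θ (L v) := rfl

/-- A complex linear covector a and its image Ja transform like h₁ and h₂: they are the image of a
standard representation. -/
theorem IsQuaternionic.covectorPull_of_hol (h : IsQuaternionic I J K) {a : V →L[ℝ] ℂ}
    (ha : ∀ v, a (I v) = Complex.I * a v) (g : ℍ[ℝ]) :
    covectorPull (rightMul I J K g) a = fstCoord g • a + sndCoord g • covectorPull J a ∧
      covectorPull (rightMul I J K g) (covectorPull J a) =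
        -starRingEnd ℂ (sndCoord g) • a + starRingEnd ℂ (fstCoord g) • covectorPull J a := by
  constructor
  · ext v
    rw [covectorPull_apply, h.rightMul_eq, map_add, apply_complexAct_of_hol ha,
      apply_complexAct_of_hol ha]
    rfl
  · ext v
    rw [covectorPull_apply, covectorPull_apply, h.rightMul_eq, map_add, map_add, h.J_complexAct,
      h.J_complexAct, apply_complexAct_of_hol ha, apply_complexAct_of_hol ha, h.J_sq, map_neg,
      mul_neg, ← neg_mul, add_comm]
    rfl

/-- As J² = -1, the antilinear part β of θ is J applied to -Jβ, which is complex linear. -/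
theorem IsQuaternionic.exists_covector_decomposition (h : IsQuaternionic I J K) (θ : V →L[ℝ] ℂ) :
    ∃ a a' : V →L[ℝ] ℂ, θ = a + covectorPull J a' ∧ (∀ v, a (I v) = Complex.I * a v) ∧
      ∀ v, a' (I v) = Complex.I * a' v := by
  refine ⟨holPart I θ, -covectorPull J (antiPart I θ), ?_, holPart_map h.I_sq θ, fun v => ?_⟩
  · ext v
    rw [add_apply, covectorPull_apply, neg_apply, covectorPull_apply, h.J_sq, map_neg, neg_neg,
      ← add_apply, holPart_add_antiPart]
  · rw [neg_apply, neg_apply, covectorPull_apply, covectorPull_apply, ← neg_neg (J (I v)), ← h.I_J,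
      map_neg, antiPart_map h.I_sq]
    ring

/-- Clebsch–Gordan with k = 0: the polynomial argument is a constant, which the unit quaternions
fix, so only the m covectors count. -/
theorem IsQuaternionic.altProd_mem (h : IsQuaternionic I J K) (θ : Fin m → V →L[ℝ] ℂ) :
    altProd θ ∈ ⨆ (j : ℕ) (_ : j ≤ m), weightForms I J K m j := by
  have hB := multilinear_mem_iSup_weightPart (W := V [⋀^Fin m]→L[ℝ] ℂ)
    (ρ := fun g => pull m (rightMul I J K g)) (r := fun g => covectorPull (rightMul I J K g))
    (fun θ => ?_) m 0 ((lcoeff ℂ 0).smulRight altProdMultilinear) (fun g _ P hP θ => ?_) 1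
    (isHomogeneous_one (Fin 2) ℂ) θ
  · rw [zero_add] at hB
    have h1 : ((lcoeff ℂ 0).smulRight (altProdMultilinear (V := V) (m := m)))
        (1 : MvPolynomial (Fin 2) ℂ) θ = altProd θ := by
      change coeff 0 (1 : MvPolynomial (Fin 2) ℂ) • altProd θ = _
      rw [coeff_zero_one]
      exact one_smul ℂ (altProd θ)
    rw [h1] at hB
    exact hB
  · obtain ⟨a, a', h1, ha, ha'⟩ := h.exists_covector_decomposition θ
    exact ⟨a, covectorPull J a, a', covectorPull J a', h1,
      fun g => (h.covectorPull_of_hol ha g).1, fun g => (h.covectorPull_of_hol ha g).2,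
      fun g => (h.covectorPull_of_hol ha' g).1, fun g => (h.covectorPull_of_hol ha' g).2⟩
  · have h1 : symAct g P = P := by
      rw [(totalDegree_eq_zero_iff_eq_C (p := P)).1
        ((totalDegree_zero_iff_isHomogeneous (Fin 2)).2 hP)]
      exact (symAct g).commutes _
    rw [h1]
    change coeff 0 P • altProd _ = pull m _ (coeff 0 P • altProd θ)
    rw [map_smul, pull_altProd]
    rfl

variable [FiniteDimensional ℝ V] [T2Space V]

/-- The forms of maximal weight and those of smaller weight are complementary. -/
theorem IsQuaternionic.isCompl_plusForms (h : IsQuaternionic I J K) (m : ℕ) :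
    IsCompl (plusForms I J K m) (lowForms I J K m) := by
  refine ⟨h.disjoint_plusForms m, ?_⟩
  rw [codisjoint_iff, eq_top_iff, ← span_altProd, Submodule.span_le]
  rintro _ ⟨θ, rfl⟩
  refine (?_ : (⨆ (j : ℕ) (_ : j ≤ m), weightForms I J K m j) ≤ _) (h.altProd_mem θ)
  refine iSup₂_le fun j hj => ?_
  rcases hj.lt_or_eq with hj | rfl
  · exact le_trans (le_iSup₂ (f := fun (k : ℕ) (_ : k < m) => weightForms I J K m k) j hj)
      le_sup_right
  · exact le_sup_left

/-- The projection to the part of maximal weight is determined by the components of type `(m,0)` of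
the translates of a form. -/
theorem IsQuaternionic.projAlong_plusForms_eq (h : IsQuaternionic I J K)
    {γ τ : V [⋀^Fin m]→L[ℝ] ℂ} (hτ : τ ∈ plusForms I J K m)
    (hγ : ∀ g : ℍ[ℝ], ‖g‖ = 1 → circleProj I m m (pull m (rightMul I J K g) γ) =
      circleProj I m m (pull m (rightMul I J K g) τ)) :
    projAlong (plusForms I J K m) (lowForms I J K m) γ = τ := by
  obtain ⟨a, ha, b, hb, rfl⟩ := Submodule.mem_sup.1
    ((h.isCompl_plusForms m).sup_eq_top ▸ Submodule.mem_top :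
      γ ∈ plusForms I J K m ⊔ lowForms I J K m)
  have h1 : a - τ = 0 := by
    refine h.eq_zero_of_mem_plusForms (sub_mem ha hτ) fun g hg => ?_
    have := hγ g hg
    rw [map_add, map_add, circleProj_pull_of_mem_lowForms hb hg, add_zero] at this
    rw [map_sub, map_sub, this, sub_self]
  rw [projAlong_eq (h.isCompl_plusForms m) ha (by simpa using hb)]
  exact sub_eq_zero.1 h1

end WeightDecomposition

/-! ### The identity for d₊ as algebra on one fibre. -/

section Alternation

variable {E : Type*} [NormedAddCommGroup E] [NormedSpace ℝ E] [FiniteDimensional ℝ E] {m : ℕ}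
  {I J K : E →L[ℝ] E}

/-- The alternation of a linear map with values in `m`-forms. -/
def wedgeAlt (C : E →ₗ[ℝ] E [⋀^Fin m]→L[ℝ] ℂ) : E [⋀^Fin (m + 1)]→L[ℝ] ℂ :=
  ContinuousAlternatingMap.alternatizeUncurryFin (LinearMap.toContinuousLinearMap C)

theorem wedgeAlt_apply (C : E →ₗ[ℝ] E [⋀^Fin m]→L[ℝ] ℂ) (v : Fin (m + 1) → E) :
    wedgeAlt C v = ∑ i : Fin (m + 1), (-1 : ℂ) ^ (i : ℕ) * C (v i) (i.removeNth v) := by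
  rw [wedgeAlt, ContinuousAlternatingMap.alternatizeUncurryFin_apply]
  refine Finset.sum_congr rfl fun i _ => ?_
  simp

theorem wedgeAlt_add (C D : E →ₗ[ℝ] E [⋀^Fin m]→L[ℝ] ℂ) :
    wedgeAlt (C + D) = wedgeAlt C + wedgeAlt D := by
  ext v
  simp [wedgeAlt_apply, mul_add, Finset.sum_add_distrib]

theorem wedgeAlt_smul (c : ℂ) (C : E →ₗ[ℝ] E [⋀^Fin m]→L[ℝ] ℂ) :
    wedgeAlt (c • C) = c • wedgeAlt C := by
  ext v
  simp [wedgeAlt_apply, Finset.mul_sum, mul_left_comm]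

theorem wedgeAlt_sum {ι : Type*} (s : Finset ι) (C : ι → E →ₗ[ℝ] E [⋀^Fin m]→L[ℝ] ℂ) :
    wedgeAlt (∑ r ∈ s, C r) = ∑ r ∈ s, wedgeAlt (C r) := by
  classical
  induction s using Finset.induction_on with
  | empty => ext v; simp [wedgeAlt_apply]
  | insert a s ha ih => rw [Finset.sum_insert ha, Finset.sum_insert ha, wedgeAlt_add, ih]

theorem pull_wedgeAlt (L : E →L[ℝ] E) (C : E →ₗ[ℝ] E [⋀^Fin m]→L[ℝ] ℂ) :
    pull (m + 1) L (wedgeAlt C) =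
      wedgeAlt ((pull m L).restrictScalars ℝ ∘ₗ C ∘ₗ L.toLinearMap) := by
  ext v
  rw [pull_apply, wedgeAlt_apply, wedgeAlt_apply]
  rfl

theorem map_complexAct_of_hol {C : E →ₗ[ℝ] E [⋀^Fin m]→L[ℝ] ℂ}
    (hC : ∀ u, C (I u) = Complex.I • C u) (z : ℂ) (u : E) : C (complexAct I z u) = z • C u := by
  ext v
  rw [complexAct_apply, map_add, map_smul, map_smul, hC]
  simp only [ContinuousAlternatingMap.add_apply, ContinuousAlternatingMap.smul_apply,
    Complex.real_smul, smul_eq_mul]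
  nth_rw 3 [← Complex.re_add_im z]
  ring

theorem map_complexAct_of_anti {C : E →ₗ[ℝ] E [⋀^Fin m]→L[ℝ] ℂ}
    (hC : ∀ u, C (I u) = -Complex.I • C u) (z : ℂ) (u : E) :
    C (complexAct I z u) = starRingEnd ℂ z • C u := by
  ext v
  rw [complexAct_apply, map_add, map_smul, map_smul, hC]
  simp only [ContinuousAlternatingMap.add_apply, ContinuousAlternatingMap.smul_apply,
    Complex.real_smul, smul_eq_mul]
  nth_rw 3 [← Complex.re_add_im z]
  simp only [map_add, map_mul, Complex.conj_ofReal, Complex.conj_I]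
  ring

/-- The slot fed to `C` contributes one more factor z; in the antilinear case below it contributes
the conjugate. -/
theorem wedgeAlt_mem_of_hol {C : E →ₗ[ℝ] E [⋀^Fin m]→L[ℝ] ℂ} {a b : ℕ}
    (hC : ∀ u, C (I u) = Complex.I • C u) (hab : ∀ u, C u ∈ typeForms I m a b) :
    wedgeAlt C ∈ typeForms I (m + 1) (a + 1) b := by
  rw [mem_typeForms]
  intro z
  ext v
  rw [pull_wedgeAlt, ContinuousAlternatingMap.smul_apply, wedgeAlt_apply, wedgeAlt_apply,
    smul_eq_mul, Finset.mul_sum]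
  refine Finset.sum_congr rfl fun i _ => ?_
  simp only [LinearMap.comp_apply, LinearMap.restrictScalars_apply, ContinuousLinearMap.coe_coe,
    map_complexAct_of_hol hC, map_smul, mem_typeForms.1 (hab _) z,
    ContinuousAlternatingMap.smul_apply, smul_eq_mul]
  ring

theorem wedgeAlt_mem_of_anti {C : E →ₗ[ℝ] E [⋀^Fin m]→L[ℝ] ℂ} {a b : ℕ}
    (hC : ∀ u, C (I u) = -Complex.I • C u) (hab : ∀ u, C u ∈ typeForms I m a b) :
    wedgeAlt C ∈ typeForms I (m + 1) a (b + 1) := by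
  rw [mem_typeForms]
  intro z
  ext v
  rw [pull_wedgeAlt, ContinuousAlternatingMap.smul_apply, wedgeAlt_apply, wedgeAlt_apply,
    smul_eq_mul, Finset.mul_sum]
  refine Finset.sum_congr rfl fun i _ => ?_
  simp only [LinearMap.comp_apply, LinearMap.restrictScalars_apply, ContinuousLinearMap.coe_coe,
    map_complexAct_of_anti hC, map_smul, mem_typeForms.1 (hab _) z,
    ContinuousAlternatingMap.smul_apply, smul_eq_mul]
  ring

theorem hMul_zero_eq_pull (α : E [⋀^Fin m]→L[ℝ] ℂ) : hMul J m 0 α = pull m J α := by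
  ext v
  have hm : (m.factorial : ℂ) ≠ 0 := by exact_mod_cast m.factorial_ne_zero
  simp [hMul_apply, Fintype.card_perm, hm]

/-- Composition of a form valued linear map with an operator on forms. -/
def postcompForms (P : (E [⋀^Fin m]→L[ℝ] ℂ) →ₗ[ℂ] (E [⋀^Fin m]→L[ℝ] ℂ))
    (C : E →ₗ[ℝ] E [⋀^Fin m]→L[ℝ] ℂ) : E →ₗ[ℝ] E [⋀^Fin m]→L[ℝ] ℂ :=
  P.restrictScalars ℝ ∘ₗ C

theorem postcompForms_apply (P : (E [⋀^Fin m]→L[ℝ] ℂ) →ₗ[ℂ] (E [⋀^Fin m]→L[ℝ] ℂ))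
    (C : E →ₗ[ℝ] E [⋀^Fin m]→L[ℝ] ℂ) (u : E) : postcompForms P C u = P (C u) := rfl

/-- The component of type `(m+1,0)` of the alternation of `hMul J m r ∘ D`. -/
theorem IsQuaternionic.circleProj_wedgeAlt_hMul (h : IsQuaternionic I J K)
    {D₁ D₂ : E →ₗ[ℝ] E [⋀^Fin m]→L[ℝ] ℂ} (h₁ : ∀ u, D₁ (I u) = Complex.I • D₁ u)
    (h₂ : ∀ u, D₂ (I u) = -Complex.I • D₂ u) (t₁ : ∀ u, D₁ u ∈ typeForms I m m 0)
    (t₂ : ∀ u, D₂ u ∈ typeForms I m m 0) {r s : ℕ} (hrs : r + s = m) :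
    circleProj I (m + 1) ((m + 1 : ℕ) : ℤ) (wedgeAlt (postcompForms (hMul J m r) (D₁ + D₂))) =
      (if r = m then 1 else 0 : ℂ) • wedgeAlt D₁ := by
  have e : postcompForms (hMul J m r) (D₁ + D₂) =
      postcompForms (hMul J m r) D₁ + postcompForms (hMul J m r) D₂ := by
    ext u v
    simp [postcompForms_apply]
  have m₁ : wedgeAlt (postcompForms (hMul J m r) D₁) ∈ typeForms I (m + 1) (r + 1) s :=
    wedgeAlt_mem_of_hol (fun u => by rw [postcompForms_apply, h₁, map_smul, postcompForms_apply])
      fun u => h.hMul_mem_typeForms hrs (t₁ u)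
  have m₂ : wedgeAlt (postcompForms (hMul J m r) D₂) ∈ typeForms I (m + 1) r (s + 1) :=
    wedgeAlt_mem_of_anti (fun u => by rw [postcompForms_apply, h₂, map_smul, postcompForms_apply])
      fun u => h.hMul_mem_typeForms hrs (t₂ u)
  have p₁ := circleProj_typeForms (by omega) (add_zero (m + 1)) m₁
  have p₂ := circleProj_typeForms (by omega) (add_zero (m + 1)) m₂
  rw [Nat.cast_zero, sub_zero] at p₁ p₂
  rw [e, wedgeAlt_add, map_add, p₁, p₂, if_neg (by omega : r ≠ m + 1), add_zero]
  by_cases hr : r = m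
  · subst hr
    rw [if_pos rfl, if_pos rfl]
    have : postcompForms (hMul J r r) D₁ = D₁ := by
      ext u v
      rw [postcompForms_apply, hMul_self]
    rw [this]
    exact (one_smul ℂ (wedgeAlt D₁)).symm
  · rw [if_neg (by omega), if_neg hr]
    exact (zero_smul ℂ (wedgeAlt D₁)).symm

/-- The component of type `(0,m+1)` of the alternation of `pull m J ∘ D`. -/
theorem IsQuaternionic.circleProj_wedgeAlt_pull (h : IsQuaternionic I J K)
    {D₁ D₂ : E →ₗ[ℝ] E [⋀^Fin m]→L[ℝ] ℂ} (h₁ : ∀ u, D₁ (I u) = Complex.I • D₁ u)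
    (h₂ : ∀ u, D₂ (I u) = -Complex.I • D₂ u) (t₁ : ∀ u, D₁ u ∈ typeForms I m m 0)
    (t₂ : ∀ u, D₂ u ∈ typeForms I m m 0) :
    circleProj I (m + 1) (((0 : ℕ) : ℤ) - (m + 1 : ℕ))
      (wedgeAlt (postcompForms (pull m J) (D₁ + D₂))) =
      wedgeAlt (postcompForms (pull m J) D₂) := by
  have e : postcompForms (pull m J) (D₁ + D₂) =
      postcompForms (pull m J) D₁ + postcompForms (pull m J) D₂ := by
    ext u v
    simp [postcompForms_apply]
  have t : ∀ α ∈ typeForms I m m 0, pull m J α ∈ typeForms I m 0 m := fun α hα => by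
    rw [← hMul_zero_eq_pull]
    exact h.hMul_mem_typeForms (zero_add m) hα
  have m₁ : wedgeAlt (postcompForms (pull m J) D₁) ∈ typeForms I (m + 1) (0 + 1) m :=
    wedgeAlt_mem_of_hol (fun u => by rw [postcompForms_apply, h₁, map_smul, postcompForms_apply])
      fun u => t _ (t₁ u)
  have m₂ : wedgeAlt (postcompForms (pull m J) D₂) ∈ typeForms I (m + 1) 0 (m + 1) :=
    wedgeAlt_mem_of_anti (fun u => by rw [postcompForms_apply, h₂, map_smul, postcompForms_apply])
      fun u => t _ (t₂ u)
  have p₁ := circleProj_typeForms (by omega) (zero_add (m + 1)) m₁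
  have p₂ := circleProj_typeForms (by omega) (zero_add (m + 1)) m₂
  rw [e, wedgeAlt_add, map_add, p₁, p₂, if_neg (by omega), if_pos rfl, zero_add]

/-- The algebraic form of the identity `d₊ ∘ hMul = hMul ∘ ∂ + hMul ∘ ∂_J`. -/
theorem IsQuaternionic.projAlong_wedgeAlt_hMul (h : IsQuaternionic I J K) {p q : ℕ}
    (hpq : p + q = m) {A : E →ₗ[ℝ] E [⋀^Fin m]→L[ℝ] ℂ} (hA : ∀ u, A u ∈ typeForms I m m 0) :
    projAlong (plusForms I J K (m + 1)) (lowForms I J K (m + 1))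
        (wedgeAlt (postcompForms (hMul J m p) A)) =
      hMul J (m + 1) (p + 1)
        (projAlong (typeForms I (m + 1) (m + 1) 0) (otherTypeForms I (m + 1) (m + 1) 0)
          (wedgeAlt A)) +
      hMul J (m + 1) p (pull (m + 1) (-J)
        (projAlong (typeForms I (m + 1) 0 (m + 1)) (otherTypeForms I (m + 1) 0 (m + 1))
          (wedgeAlt (postcompForms (pull m J) A)))) := by
  -- The I-linear and I-antilinear parts of `A` in the direction of differentiation; the values stay
  -- of type (m,0).
  set A₁ : E →ₗ[ℝ] E [⋀^Fin m]→L[ℝ] ℂ := (2⁻¹ : ℂ) • (A - Complex.I • (A ∘ₗ I.toLinearMap))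
    with hA₁
  set A₂ : E →ₗ[ℝ] E [⋀^Fin m]→L[ℝ] ℂ := (2⁻¹ : ℂ) • (A + Complex.I • (A ∘ₗ I.toLinearMap))
    with hA₂
  have a₁ : ∀ u, A₁ u = (2⁻¹ : ℂ) • (A u - Complex.I • A (I u)) := fun u => rfl
  have a₂ : ∀ u, A₂ u = (2⁻¹ : ℂ) • (A u + Complex.I • A (I u)) := fun u => rfl
  have hsum : A = A₁ + A₂ := by
    ext u v
    rw [LinearMap.add_apply, a₁, a₂]
    simp only [ContinuousAlternatingMap.add_apply, ContinuousAlternatingMap.sub_apply,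
      ContinuousAlternatingMap.smul_apply, smul_eq_mul]
    ring
  have h₁ : ∀ u, A₁ (I u) = Complex.I • A₁ u := fun u => by
    ext v
    rw [a₁, a₁, h.I_sq, map_neg]
    simp only [ContinuousAlternatingMap.sub_apply, ContinuousAlternatingMap.neg_apply,
      ContinuousAlternatingMap.smul_apply, smul_eq_mul]
    linear_combination (2⁻¹ * A (I u) v) * Complex.I_mul_I
  have h₂ : ∀ u, A₂ (I u) = -Complex.I • A₂ u := fun u => by
    ext v
    rw [a₂, a₂, h.I_sq, map_neg]
    simp only [ContinuousAlternatingMap.add_apply, ContinuousAlternatingMap.neg_apply,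
      ContinuousAlternatingMap.smul_apply, smul_eq_mul]
    linear_combination (2⁻¹ * A (I u) v) * Complex.I_mul_I
  have t₁ : ∀ u, A₁ u ∈ typeForms I m m 0 := fun u =>
    Submodule.smul_mem _ _ (sub_mem (hA u) (Submodule.smul_mem _ _ (hA (I u))))
  have t₂ : ∀ u, A₂ u ∈ typeForms I m m 0 := fun u =>
    Submodule.smul_mem _ _ (add_mem (hA u) (Submodule.smul_mem _ _ (hA (I u))))
  -- Two antilinear maps compose to a linear one, so the alternation of `A₃` is again of type
  -- (m+1,0).
  set A₃ : E →ₗ[ℝ] E [⋀^Fin m]→L[ℝ] ℂ := A₂ ∘ₗ J.toLinearMap with hA₃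
  have a₃ : ∀ u, A₃ u = A₂ (J u) := fun u => rfl
  have h₃ : ∀ u, A₃ (I u) = Complex.I • A₃ u := fun u => by
    ext v
    rw [a₃, a₃, ← neg_neg (J (I u)), ← h.I_J, map_neg, h₂]
    simp
  have d1 : projAlong (typeForms I (m + 1) (m + 1) 0) (otherTypeForms I (m + 1) (m + 1) 0)
      (wedgeAlt A) = wedgeAlt A₁ := by
    have := h.circleProj_wedgeAlt_hMul h₁ h₂ t₁ t₂ (add_zero m)
    have e : postcompForms (hMul J m m) A = A := by
      ext u v
      rw [postcompForms_apply, hMul_self]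
    rw [← hsum, e, if_pos rfl] at this
    rw [projAlong_typeForms h.I_sq (add_zero (m + 1)), Nat.cast_zero, sub_zero, this]
    exact one_smul ℂ (wedgeAlt A₁)
  -- The pullbacks by `J` and `-J` cancel on the m-form, while the remaining slot becomes `A₂ (-J
  -- u)`; hence the sign.
  have d2 : pull (m + 1) (-J)
      (projAlong (typeForms I (m + 1) 0 (m + 1)) (otherTypeForms I (m + 1) 0 (m + 1))
        (wedgeAlt (postcompForms (pull m J) A))) = (-1 : ℂ) • wedgeAlt A₃ := by
    have := h.circleProj_wedgeAlt_pull h₁ h₂ t₁ t₂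
    rw [← hsum] at this
    rw [projAlong_typeForms h.I_sq (zero_add (m + 1)), this, pull_wedgeAlt, ← wedgeAlt_smul]
    congr 1
    ext u v
    simp [postcompForms_apply, a₃, h.J_sq]
  have m1 : wedgeAlt A₁ ∈ typeForms I (m + 1) (m + 1) 0 := wedgeAlt_mem_of_hol h₁ t₁
  have m3 : (-1 : ℂ) • wedgeAlt A₃ ∈ typeForms I (m + 1) (m + 1) 0 :=
    Submodule.smul_mem _ _ (wedgeAlt_mem_of_hol h₃ fun u => t₂ (J u))
  rw [d1, d2]
  refine h.projAlong_plusForms_eq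
    (add_mem (h.hMul_mem_plusForms m1 (by omega)) (h.hMul_mem_plusForms m3 (by omega))) fun g _ => ?_
  rw [map_add, map_add, h.circleProj_pull_hMul m1 (show p + 1 + q = m + 1 by omega),
    h.circleProj_pull_hMul m3 (show p + (q + 1) = m + 1 by omega)]
  set z := fstCoord g with hz
  set w := sndCoord g with hw
  -- The linear and antilinear parts of u ↦ A(u·g), found from u·g = u·z + (u·j)·w.
  set B₁ : E →ₗ[ℝ] E [⋀^Fin m]→L[ℝ] ℂ := z • A₁ + starRingEnd ℂ w • A₃ with hB₁
  set B₂ : E →ₗ[ℝ] E [⋀^Fin m]→L[ℝ] ℂ :=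
    starRingEnd ℂ z • A₂ + w • (A₁ ∘ₗ J.toLinearMap) with hB₂
  have b₁ : ∀ u, B₁ u = z • A₁ u + starRingEnd ℂ w • A₃ u := fun u => rfl
  have b₂ : ∀ u, B₂ u = starRingEnd ℂ z • A₂ u + w • A₁ (J u) := fun u => rfl
  have hB : ∀ u, A (rightMul I J K g u) = (B₁ + B₂) u := fun u => by
    rw [h.rightMul_eq, map_add, hsum, LinearMap.add_apply, LinearMap.add_apply, LinearMap.add_apply,
      map_complexAct_of_hol h₁, map_complexAct_of_hol h₁, map_complexAct_of_anti h₂,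
      map_complexAct_of_anti h₂, b₁, b₂, a₃]
    abel
  have hb₁ : ∀ u, B₁ (I u) = Complex.I • B₁ u := fun u => by
    rw [b₁, b₁, h₁, h₃]
    module
  have hb₂ : ∀ u, B₂ (I u) = -Complex.I • B₂ u := fun u => by
    rw [b₂, b₂, h₂, ← neg_neg (J (I u)), ← h.I_J, map_neg, h₁]
    module
  have e : pull (m + 1) (rightMul I J K g) (wedgeAlt (postcompForms (hMul J m p) A)) =
      ∑ r ∈ Finset.range (m + 1),
        MvPolynomial.coeff (Finsupp.single 0 r + Finsupp.single 1 (m - r))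
          (symAct g (MvPolynomial.X 0 ^ p * MvPolynomial.X 1 ^ q)) •
          wedgeAlt (postcompForms (hMul J m r) (B₁ + B₂)) := by
    simp only [← wedgeAlt_smul]
    rw [pull_wedgeAlt, ← wedgeAlt_sum]
    congr 1
    ext u : 1
    have h5 := h.symMap_symAct (hA (rightMul I J K g u)) g
      (hpq ▸ isHomogeneous_X_pow_mul_X_pow p q : MvPolynomial.IsHomogeneous _ m)
    rw [symMap_X_pow_mul_X_pow _ hpq, symMap_apply] at h5
    simp only [LinearMap.comp_apply, LinearMap.restrictScalars_apply, ContinuousLinearMap.coe_coe,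
      postcompForms_apply, LinearMap.sum_apply, LinearMap.smul_apply]
    rw [← h5, hB]
  -- Only r = m reaches type (m+1,0), with coefficient z^p (-w̄)^q and form alt(z A₁ + w̄ A₃). The
  -- w̄ term matches because ∂_J corresponds to -alt A₃ and its factor is -w̄.
  rw [e, map_sum, Finset.sum_eq_single m]
  · have := h.circleProj_wedgeAlt_hMul hb₁ hb₂
      (fun u => add_mem (Submodule.smul_mem _ _ (t₁ u)) (Submodule.smul_mem _ _ (t₂ (J u))))
      (fun u => add_mem (Submodule.smul_mem _ _ (t₂ u)) (Submodule.smul_mem _ _ (t₁ (J u))))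
      (add_zero m)
    rw [map_smul, this, if_pos rfl, Nat.sub_self, coeff_symAct g hpq, hB₁, wedgeAlt_add,
      wedgeAlt_smul z A₁, wedgeAlt_smul (starRingEnd ℂ w) A₃, ← hz, ← hw]
    module
  · intro r hr hrm
    have := h.circleProj_wedgeAlt_hMul hb₁ hb₂
      (fun u => add_mem (Submodule.smul_mem _ _ (t₁ u)) (Submodule.smul_mem _ _ (t₂ (J u))))
      (fun u => add_mem (Submodule.smul_mem _ _ (t₂ u)) (Submodule.smul_mem _ _ (t₁ (J u))))
      (show r + (m - r) = m by simp at hr; omega)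
    rw [map_smul, this, if_neg hrm]
    module
  · simp

end Alternation

/-! ### Covariant derivatives of forms along parallel endomorphisms. -/

section CovariantDerivative

variable {E : Type*} [NormedAddCommGroup E] [NormedSpace ℝ E] {m : ℕ}
  {Γ : E →L[ℝ] E →L[ℝ] E} {y₀ : E}

/-- The covariant derivative of a form for the connection with Christoffel symbols `-Γ`. -/
def covDeriv (Γ : E →L[ℝ] E →L[ℝ] E) (η : E → E [⋀^Fin m]→L[ℝ] ℂ) (y : E) :
    E →L[ℝ] E [⋀^Fin m]→L[ℝ] ℂ :=
  fderiv ℝ η y + (η y).fderivCompContinuousLinearMap (ContinuousLinearMap.id ℝ E) ∘L Γ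

/-- The field of endomorphisms `L` is parallel at `y₀` for the connection with Christoffel symbols
`-Γ`. -/
def IsParallelAt (Γ : E →L[ℝ] E →L[ℝ] E) (L : E → E →L[ℝ] E) (y₀ : E) : Prop :=
  DifferentiableAt ℝ L y₀ ∧ ∀ u v, fderiv ℝ L y₀ u v = Γ u (L y₀ v) - L y₀ (Γ u v)

theorem covDeriv_apply (η : E → E [⋀^Fin m]→L[ℝ] ℂ) (u : E) (v : Fin m → E) :
    covDeriv Γ η y₀ u v = fderiv ℝ η y₀ u v + ∑ i, η y₀ (Function.update v i (Γ u (v i))) := by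
  rw [covDeriv, add_apply, ContinuousAlternatingMap.add_apply]
  simp only [ContinuousLinearMap.comp_apply,
    ContinuousAlternatingMap.fderivCompContinuousLinearMap_apply]
  congr 1
  refine Finset.sum_congr rfl fun i _ => congrArg _ ?_
  ext j
  by_cases hj : j = i
  · subst hj; simp
  · simp [hj]

/-- Zero torsion: the contribution of a symmetric Γ dies under alternation, leaving the exterior
derivative. -/
theorem alternatizeUncurryFin_covDeriv (hΓ : ∀ u v, Γ u v = Γ v u)
    (η : E → E [⋀^Fin m]→L[ℝ] ℂ) :
    ContinuousAlternatingMap.alternatizeUncurryFin (covDeriv Γ η y₀) = extDeriv η y₀ := by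
  rw [covDeriv, ContinuousAlternatingMap.alternatizeUncurryFin_add,
    ContinuousAlternatingMap.alternatizeUncurryFin_fderivCompContinuousLinearMap_eq_zero _ _ hΓ,
    add_zero, extDeriv]

theorem isParallelAt_id : IsParallelAt Γ (fun _ => ContinuousLinearMap.id ℝ E) y₀ :=
  ⟨differentiableAt_const _, fun u v => by simp⟩

theorem IsParallelAt.combination {L : E → E →L[ℝ] E} (hL : IsParallelAt Γ L y₀) (a b : ℝ) :
    IsParallelAt Γ (fun y => a • ContinuousLinearMap.id ℝ E + b • L y) y₀ := by
  refine ⟨(differentiableAt_const _).add (hL.1.const_smul b), fun u v => ?_⟩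
  have : fderiv ℝ (fun y => a • ContinuousLinearMap.id ℝ E + b • L y) y₀ =
      b • fderiv ℝ L y₀ := by
    rw [fderiv_const_add, fderiv_fun_const_smul hL.1]
  rw [this]
  simp only [smul_apply, add_apply, ContinuousLinearMap.id_apply, hL.2, map_add,
    map_smul]
  module

/-- Leibniz rule with ∇L = 0. The operators may differ from slot to slot because `hMul` mixes the
identity and `J`. -/
theorem fderiv_apply_parallel {η : E → E [⋀^Fin m]→L[ℝ] ℂ} (hη : DifferentiableAt ℝ η y₀)
    {L : Fin m → E → E →L[ℝ] E} (hL : ∀ i, IsParallelAt Γ (L i) y₀) (u : E) (v : Fin m → E) :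
    DifferentiableAt ℝ (fun y => η y (fun i => L i y (v i))) y₀ ∧
    fderiv ℝ (fun y => η y (fun i => L i y (v i))) y₀ u +
      ∑ i, η y₀ (fun j => L j y₀ (Function.update v i (Γ u (v i)) j)) =
    covDeriv Γ η y₀ u (fun i => L i y₀ (v i)) := by
  have hd : ∀ i, DifferentiableAt ℝ (fun y => L i y (v i)) y₀ := fun i =>
    (hL i).1.clm_apply (differentiableAt_const _)
  have hf : ∀ i, fderiv ℝ (fun y => L i y (v i)) y₀ u =
      Γ u (L i y₀ (v i)) - L i y₀ (Γ u (v i)) := fun i => by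
    rw [fderiv_clm_apply (hL i).1 (differentiableAt_const _), ← (hL i).2]
    simp
  refine ⟨hη.continuousAlternatingMap_apply hd, ?_⟩
  rw [fderiv_continuousAlternatingMap_apply_apply (g := fun i y => L i y (v i)) hη hd,
    covDeriv_apply, add_assoc, ← Finset.sum_add_distrib]
  congr 1
  refine Finset.sum_congr rfl fun i _ => ?_
  rw [hf]
  have : (fun j => L j y₀ (Function.update v i (Γ u (v i)) j)) =
      Function.update (fun j => L j y₀ (v j)) i (L i y₀ (Γ u (v i))) := by
    ext j
    by_cases hj : j = i
    · subst hj; simp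
    · simp [hj]
  rw [this, ContinuousAlternatingMap.map_update_sub, sub_add_cancel]

theorem fderiv_form_apply {η : E → E [⋀^Fin m]→L[ℝ] ℂ} (hη : DifferentiableAt ℝ η y₀) (u : E)
    (v : Fin m → E) : fderiv ℝ η y₀ u v = fderiv ℝ (fun y => η y v) y₀ u := by
  rw [fderiv_continuousAlternatingMap_apply_apply (g := fun i _ => v i) hη
    fun i => differentiableAt_const _]
  simp

/-- A covariant derivative that preserves `I` preserves the types of forms. -/
theorem covDeriv_mem_typeForms {I : E → E →L[ℝ] E} (hI : IsParallelAt Γ I y₀) {p q : ℕ}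
    {η : E → E [⋀^Fin m]→L[ℝ] ℂ} (hη : DifferentiableAt ℝ η y₀)
    (h : ∀ᶠ y in nhds y₀, η y ∈ typeForms (I y) m p q) (u : E) :
    covDeriv Γ η y₀ u ∈ typeForms (I y₀) m p q := by
  intro z v
  have := (fderiv_apply_parallel hη (fun _ : Fin m => hI.combination z.re z.im) u v).2
  -- Near the base point the type condition makes the twisted form a fixed scalar multiple of η, so
  -- the Leibniz rule transfers the condition to ∇η.
  have e : (fun y => η y fun i => (z.re • ContinuousLinearMap.id ℝ E + z.im • I y) (v i))
      =ᶠ[nhds y₀] fun y => (z ^ p * (starRingEnd ℂ z) ^ q) • η y v := by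
    filter_upwards [h] with y hy
    exact hy z v
  rw [e.fderiv_eq] at this
  refine this.symm.trans ?_
  have h₀ : ∀ w : Fin m → E,
      (η y₀ fun i => (z.re • ContinuousLinearMap.id ℝ E + z.im • I y₀) (w i)) =
        z ^ p * (starRingEnd ℂ z) ^ q * η y₀ w := fun w => h.self_of_nhds z w
  simp only [h₀]
  have hd : DifferentiableAt ℝ (fun y => η y v) y₀ :=
    hη.continuousAlternatingMap_apply (g := fun i _ => v i) fun i => differentiableAt_const _
  rw [fderiv_fun_const_smul hd, covDeriv_apply, fderiv_form_apply hη, mul_add, Finset.mul_sum]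
  rfl

/-- A covariant derivative that preserves `J` commutes with `hMul J`. -/
theorem covDeriv_hMul {J : E → E →L[ℝ] E} (hJ : IsParallelAt Γ J y₀) {p : ℕ}
    {η : E → E [⋀^Fin m]→L[ℝ] ℂ} (hη : DifferentiableAt ℝ η y₀)
    (hβ : DifferentiableAt ℝ (fun y => hMul (J y) m p (η y)) y₀) (u : E) :
    covDeriv Γ (fun y => hMul (J y) m p (η y)) y₀ u = hMul (J y₀) m p (covDeriv Γ η y₀ u) := by
  ext v
  set L : Equiv.Perm (Fin m) → Fin m → E → E →L[ℝ] E := fun σ i y =>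
    if (σ i).val < p then ContinuousLinearMap.id ℝ E else J y with hL
  have hLp : ∀ σ i, IsParallelAt Γ (L σ i) y₀ := fun σ i => by
    by_cases hi : (σ i).val < p
    · simp only [hL, hi, if_true]; exact isParallelAt_id
    · simp only [hL, hi, if_false]; exact hJ
  have key : ∀ (α : E [⋀^Fin m]→L[ℝ] ℂ) y w, hMul (J y) m p α w = (m.factorial : ℂ)⁻¹ *
      ∑ σ : Equiv.Perm (Fin m), α fun i => L σ i y (w i) := fun α y w => by
    rw [hMul_apply]
    congr 1
    refine Finset.sum_congr rfl fun σ _ => congrArg _ ?_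
    ext i
    simp only [hL]
    split_ifs <;> rfl
  rw [covDeriv_apply, fderiv_form_apply hβ, key]
  simp only [key]
  rw [← Finset.mul_sum, Finset.sum_comm]
  have hd := fun σ => (fderiv_apply_parallel hη (hLp σ) u v).1
  have hs : fderiv ℝ (fun y => (m.factorial : ℂ)⁻¹ * ∑ σ : Equiv.Perm (Fin m),
      η y fun i => L σ i y (v i)) y₀ u = (m.factorial : ℂ)⁻¹ * ∑ σ : Equiv.Perm (Fin m),
        fderiv ℝ (fun y => η y fun i => L σ i y (v i)) y₀ u := by
    rw [fderiv_const_mul (DifferentiableAt.fun_sum fun σ _ => hd σ),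
      fderiv_fun_sum fun σ _ => hd σ]
    simp
  rw [hs, ← mul_add, ← Finset.sum_add_distrib]
  congr 1
  exact Finset.sum_congr rfl fun σ _ => (fderiv_apply_parallel hη (hLp σ) u v).2

end CovariantDerivative

/-! ### The identity on an open subset of a vector space. -/

section LocalIdentity

variable {E : Type*} [NormedAddCommGroup E] [NormedSpace ℝ E] [FiniteDimensional ℝ E] {m : ℕ}
  {I J K : E → E →L[ℝ] E} {y₀ : E}

theorem fderiv_clm_comp_apply {A B : E → E →L[ℝ] E} (hA : DifferentiableAt ℝ A y₀)
    (hB : DifferentiableAt ℝ B y₀) (u v : E) :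
    fderiv ℝ (fun y => A y (B y v)) y₀ u = fderiv ℝ A y₀ u (B y₀ v) + A y₀ (fderiv ℝ B y₀ u v) := by
  have hBv : DifferentiableAt ℝ (fun y => B y v) y₀ := hB.clm_apply (differentiableAt_const _)
  rw [fderiv_clm_apply hA hBv, fderiv_clm_apply hB (differentiableAt_const _)]
  simp [add_comm]

/-- The Obata connection: a torsion free connection for which `I` and `J` are parallel. -/
theorem exists_obata (hI : DifferentiableAt ℝ I y₀) (hJ : DifferentiableAt ℝ J y₀)
    (h : ∀ᶠ y in nhds y₀, IsQuaternionic (I y) (J y) (K y))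
    (nI : ∀ u v, nijenhuis (I y₀) (fderiv ℝ I y₀) u v = 0)
    (nJ : ∀ u v, nijenhuis (J y₀) (fderiv ℝ J y₀) u v = 0) :
    ∃ Γ : E →L[ℝ] E →L[ℝ] E, (∀ u v, Γ u v = Γ v u) ∧ IsParallelAt Γ I y₀ ∧
      IsParallelAt Γ J y₀ := by
  have h₀ := h.self_of_nhds
  have dII : ∀ u v, fderiv ℝ I y₀ u (I y₀ v) = -I y₀ (fderiv ℝ I y₀ u v) := fun u v => by
    have e : (fun y => I y (I y v)) =ᶠ[nhds y₀] fun _ => -v := by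
      filter_upwards [h] with y hy using hy.I_sq v
    have := fderiv_clm_comp_apply hI hI u v
    rw [e.fderiv_eq, fderiv_fun_const] at this
    exact eq_neg_of_add_eq_zero_left this.symm
  have dJJ : ∀ u v, fderiv ℝ J y₀ u (J y₀ v) = -J y₀ (fderiv ℝ J y₀ u v) := fun u v => by
    have e : (fun y => J y (J y v)) =ᶠ[nhds y₀] fun _ => -v := by
      filter_upwards [h] with y hy using hy.J_sq v
    have := fderiv_clm_comp_apply hJ hJ u v
    rw [e.fderiv_eq, fderiv_fun_const] at this
    exact eq_neg_of_add_eq_zero_left this.symm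
  have dIJ : ∀ u v, fderiv ℝ J y₀ u (I y₀ v) = -fderiv ℝ I y₀ u (J y₀ v) -
      I y₀ (fderiv ℝ J y₀ u v) - J y₀ (fderiv ℝ I y₀ u v) := fun u v => by
    have e : (fun y => I y (J y v)) =ᶠ[nhds y₀] fun y => -J y (I y v) := by
      filter_upwards [h] with y hy using hy.I_J v
    have h1 := fderiv_clm_comp_apply hI hJ u v
    have h2 := fderiv_clm_comp_apply hJ hI u v
    rw [e.fderiv_eq, fderiv_fun_neg, neg_apply, h2] at h1
    linear_combination (norm := module) -h1
  exact ⟨obata (I y₀) (J y₀) (fderiv ℝ I y₀) (fderiv ℝ J y₀),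
    obata_symm h₀.I_sq h₀.J_sq h₀.I_J dII dJJ dIJ nI nJ,
    ⟨hI, obata_parallel_fst h₀.I_sq h₀.J_sq h₀.I_J dII dIJ nI⟩,
    ⟨hJ, obata_parallel_snd h₀.J_sq h₀.I_J dJJ⟩⟩

/-- The identity `d₊ ∘ hMul = hMul ∘ ∂ + hMul ∘ ∂_J` on an open subset of a vector space. -/
theorem projAlong_extDeriv_hMul (hI : DifferentiableAt ℝ I y₀) (hJ : DifferentiableAt ℝ J y₀)
    (h : ∀ᶠ y in nhds y₀, IsQuaternionic (I y) (J y) (K y))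
    (nI : ∀ u v, nijenhuis (I y₀) (fderiv ℝ I y₀) u v = 0)
    (nJ : ∀ u v, nijenhuis (J y₀) (fderiv ℝ J y₀) u v = 0) {p q : ℕ} (hpq : p + q = m)
    {η : E → E [⋀^Fin m]→L[ℝ] ℂ} (hη : DifferentiableAt ℝ η y₀)
    (hηt : ∀ᶠ y in nhds y₀, η y ∈ typeForms (I y) m m 0)
    (hβ : ∀ r, DifferentiableAt ℝ (fun y => hMul (J y) m r (η y)) y₀) :
    projAlong (plusForms (I y₀) (J y₀) (K y₀) (m + 1)) (lowForms (I y₀) (J y₀) (K y₀) (m + 1))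
        (extDeriv (fun y => hMul (J y) m p (η y)) y₀) =
      hMul (J y₀) (m + 1) (p + 1)
        (projAlong (typeForms (I y₀) (m + 1) (m + 1) 0) (otherTypeForms (I y₀) (m + 1) (m + 1) 0)
          (extDeriv η y₀)) +
      hMul (J y₀) (m + 1) p (pull (m + 1) (-(J y₀))
        (projAlong (typeForms (I y₀) (m + 1) 0 (m + 1)) (otherTypeForms (I y₀) (m + 1) 0 (m + 1))
          (extDeriv (fun y => pull m (J y) (η y)) y₀))) := by
  obtain ⟨Γ, hΓ, pI, pJ⟩ := exists_obata hI hJ h nI nJ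
  have hA := covDeriv_mem_typeForms pI hη hηt
  -- The exterior derivative is the alternation of ∇, which passes through `hMul` because `J` is
  -- parallel.
  have hext : ∀ r, extDeriv (fun y => hMul (J y) m r (η y)) y₀ =
      wedgeAlt (postcompForms (hMul (J y₀) m r) (covDeriv Γ η y₀).toLinearMap) := fun r => by
    rw [← alternatizeUncurryFin_covDeriv hΓ, wedgeAlt]
    congr 1
    ext u : 1
    exact covDeriv_hMul pJ hη (hβ r) u
  have e₀ : extDeriv η y₀ = wedgeAlt (covDeriv Γ η y₀).toLinearMap := by
    rw [← alternatizeUncurryFin_covDeriv hΓ, wedgeAlt]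
    rfl
  have e₁ : extDeriv (fun y => pull m (J y) (η y)) y₀ =
      wedgeAlt (postcompForms (pull m (J y₀)) (covDeriv Γ η y₀).toLinearMap) := by
    have := hext 0
    simp only [hMul_zero_eq_pull] at this
    rw [this]
    congr 1
    ext u : 1
    exact hMul_zero_eq_pull _
  rw [hext p, e₀, e₁]
  exact h.self_of_nhds.projAlong_wedgeAlt_hMul hpq hA

end LocalIdentity

/-! ### Smooth dependence of the pointwise operations. -/

section Smoothness

variable {E : Type*} [NormedAddCommGroup E] [NormedSpace ℝ E] [FiniteDimensional ℝ E] {m : ℕ}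
  {D : Type*} [NormedAddCommGroup D] [NormedSpace ℝ D] {s : Set D} {k : WithTop ℕ∞}

theorem finiteDimensional_continuousMultilinearMap :
    FiniteDimensional ℝ (ContinuousMultilinearMap ℝ (fun _ : Fin m => E) ℂ) :=
  Module.Finite.of_injective
    ({ toFun := ContinuousMultilinearMap.toMultilinearMap
       map_add' := fun _ _ => rfl
       map_smul' := fun _ _ => rfl } :
      ContinuousMultilinearMap ℝ (fun _ : Fin m => E) ℂ →ₗ[ℝ] MultilinearMap ℝ (fun _ : Fin m => E) ℂ)
    ContinuousMultilinearMap.toMultilinearMap_injective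

/-- Alternatization as a continuous linear map. -/
def alternatizationCLM (E : Type*) [NormedAddCommGroup E] [NormedSpace ℝ E] [FiniteDimensional ℝ E]
    (m : ℕ) : ContinuousMultilinearMap ℝ (fun _ : Fin m => E) ℂ →L[ℝ] E [⋀^Fin m]→L[ℝ] ℂ :=
  haveI := finiteDimensional_continuousMultilinearMap (E := E) (m := m)
  LinearMap.toContinuousLinearMap
    { toFun := ContinuousMultilinearMap.alternatization
      map_add' := map_add _
      map_smul' := fun c f => by
        ext v
        simp [ContinuousMultilinearMap.alternatization_apply_apply, Finset.mul_sum,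
          mul_left_comm, Units.smul_def] }

/-- `hMul` is continuous multilinear in the slot operators and linear in the form, followed by a
fixed continuous linear alternatization. -/
theorem contDiffOn_hMul {L : D → E →L[ℝ] E} {η : D → E [⋀^Fin m]→L[ℝ] ℂ}
    (hL : ContDiffOn ℝ k L s) (hη : ContDiffOn ℝ k η s) (p : ℕ) :
    ContDiffOn ℝ k (fun y => hMul (L y) m p (η y)) s := by
  have h₁ : ContDiffOn ℝ k (fun y => fun i : Fin m =>
      if i.val < p then ContinuousLinearMap.id ℝ E else L y) s := by
    refine contDiffOn_pi.2 fun i => ?_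
    by_cases hi : i.val < p
    · simpa only [hi, if_true] using contDiffOn_const
    · simpa only [hi, if_false] using hL
  have h₂ : ContDiffOn ℝ k (fun y =>
      ContinuousMultilinearMap.compContinuousLinearMapContinuousMultilinear ℝ (fun _ : Fin m => E)
        (fun _ : Fin m => E) ℂ
        (fun i : Fin m => if i.val < p then ContinuousLinearMap.id ℝ E else L y)) s :=
    (ContinuousMultilinearMap.contDiff _).comp_contDiffOn h₁
  have h₃ : ContDiffOn ℝ k (fun y => (η y).toContinuousMultilinearMap) s :=
    (ContinuousAlternatingMap.toContinuousMultilinearMapLI (𝕜 := ℝ) (E := E) (F := ℂ)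
      (ι := Fin m)).contDiff.comp_contDiffOn hη
  exact ((alternatizationCLM E m).contDiff.comp_contDiffOn (h₂.clm_apply h₃)).const_smul
    (m.factorial : ℂ)⁻¹

theorem contDiffOn_pull {L : D → E →L[ℝ] E} {η : D → E [⋀^Fin m]→L[ℝ] ℂ}
    (hL : ContDiffOn ℝ k L s) (hη : ContDiffOn ℝ k η s) :
    ContDiffOn ℝ k (fun y => pull m (L y) (η y)) s := by
  simpa only [hMul_zero_eq_pull] using contDiffOn_hMul hL hη 0

/-- The circle average is a finite sum of pullbacks, so no differentiation under an integral is
involved. -/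
theorem contDiffOn_circleProj {I : D → E →L[ℝ] E} {η : D → E [⋀^Fin m]→L[ℝ] ℂ}
    (hI : ContDiffOn ℝ k I s) (hη : ContDiffOn ℝ k η s) (j : ℤ) :
    ContDiffOn ℝ k (fun y => circleProj (I y) m j (η y)) s := by
  simp only [circleProj, LinearMap.smul_apply, LinearMap.sum_apply]
  refine ContDiffOn.sum fun i _ => ContDiffOn.const_smul _ (ContDiffOn.const_smul _ ?_)
  exact contDiffOn_pull (contDiffOn_const.add (hI.const_smul _)) hη

theorem contDiffOn_extDeriv {η : E → E [⋀^Fin m]→L[ℝ] ℂ} {s : Set E} (hs : IsOpen s)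
    (hη : ContDiffOn ℝ ∞ η s) : ContDiffOn ℝ ∞ (extDeriv η) s :=
  (ContinuousAlternatingMap.alternatizeUncurryFinCLM ℝ E ℂ).contDiff.comp_contDiffOn
    (hη.fderiv_of_isOpen hs (by simp))

end Smoothness

/-! ### Forms and endomorphism fields in charts. -/

section Charts

variable {E : Type*} [NormedAddCommGroup E] [NormedSpace ℝ E]
  {M : Type*} [TopologicalSpace M] [ChartedSpace E M] {m : ℕ}

/-- The derivative of the preferred chart at `x₀`. -/
def chartDeriv (x₀ x : M) : E →L[ℝ] E :=
  (mfderiv 𝓘(ℝ, E) 𝓘(ℝ, E) (extChartAt 𝓘(ℝ, E) x₀) x : TangentSpace 𝓘(ℝ, E) x →L[ℝ] E)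

/-- The derivative of the inverse of the preferred chart at `x₀`. -/
def chartSymmDeriv (x₀ : M) (y : E) : E →L[ℝ] E :=
  (mfderiv 𝓘(ℝ, E) 𝓘(ℝ, E) (extChartAt 𝓘(ℝ, E) x₀).symm y :
    E →L[ℝ] TangentSpace 𝓘(ℝ, E) ((extChartAt 𝓘(ℝ, E) x₀).symm y))

/-- The value of a field of endomorphisms, as an endomorphism of the model space. -/
def modelEnd (A : EndField E M) (x : M) : E →L[ℝ] E := A x

/-- The value of a form, as a form on the model space. -/
def modelForm (β : Form E M m) (x : M) : E [⋀^Fin m]→L[ℝ] ℂ := β x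

/-- The expression of a field of endomorphisms in the preferred chart at `x₀`. -/
def localEnd (A : EndField E M) (x₀ : M) (y : E) : E →L[ℝ] E :=
  chartDeriv x₀ ((extChartAt 𝓘(ℝ, E) x₀).symm y) ∘L
    modelEnd A ((extChartAt 𝓘(ℝ, E) x₀).symm y) ∘L chartSymmDeriv x₀ y

/-- A field of endomorphisms is smooth if its expressions in charts are. -/
def IsSmoothEnd (A : EndField E M) : Prop :=
  ∀ x₀ : M, ContDiffOn ℝ ∞ (localEnd A x₀) (extChartAt 𝓘(ℝ, E) x₀).target

theorem localForm_apply (β : Form E M m) (x₀ : M) (y : E) (v : Fin m → E) :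
    localForm β x₀ y v = modelForm β ((extChartAt 𝓘(ℝ, E) x₀).symm y)
      (fun i => chartSymmDeriv x₀ y (v i)) := rfl

theorem isOpen_target (x₀ : M) : IsOpen (extChartAt 𝓘(ℝ, E) x₀).target :=
  isOpen_extChartAt_target x₀

variable [IsManifold 𝓘(ℝ, E) ∞ M]

theorem isManifold_one : IsManifold 𝓘(ℝ, E) 1 M := IsManifold.of_le (n := ∞) (by simp)

theorem chartDeriv_chartSymmDeriv {x₀ : M} {y : E} (hy : y ∈ (extChartAt 𝓘(ℝ, E) x₀).target)
    (v : E) : chartDeriv x₀ ((extChartAt 𝓘(ℝ, E) x₀).symm y) (chartSymmDeriv x₀ y v) = v := by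
  have : IsManifold 𝓘(ℝ, E) 1 M := isManifold_one
  have h := mfderiv_extChartAt_comp_mfderivWithin_extChartAt_symm (I := 𝓘(ℝ, E)) hy
  rw [ModelWithCorners.range_eq_univ, mfderivWithin_univ] at h
  exact congrArg (fun L : E →L[ℝ] E => L v) h

theorem chartSymmDeriv_chartDeriv {x₀ x : M} (hx : x ∈ (extChartAt 𝓘(ℝ, E) x₀).source)
    (v : E) : chartSymmDeriv x₀ (extChartAt 𝓘(ℝ, E) x₀ x) (chartDeriv x₀ x v) = v := by
  have : IsManifold 𝓘(ℝ, E) 1 M := isManifold_one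
  have h := mfderivWithin_extChartAt_symm_comp_mfderiv_extChartAt' (I := 𝓘(ℝ, E)) hx
  rw [ModelWithCorners.range_eq_univ, mfderivWithin_univ] at h
  exact congrArg (fun L : E →L[ℝ] E => L v) h

theorem chartSymmDeriv_chartDeriv_symm {x₀ : M} {y : E}
    (hy : y ∈ (extChartAt 𝓘(ℝ, E) x₀).target) (v : E) :
    chartSymmDeriv x₀ y (chartDeriv x₀ ((extChartAt 𝓘(ℝ, E) x₀).symm y) v) = v := by
  have := chartSymmDeriv_chartDeriv ((extChartAt 𝓘(ℝ, E) x₀).map_target hy) v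
  rwa [(extChartAt 𝓘(ℝ, E) x₀).right_inv hy] at this

theorem chartDeriv_self (x : M) : chartDeriv x x = ContinuousLinearMap.id ℝ E := by
  have : IsManifold 𝓘(ℝ, E) 1 M := isManifold_one
  exact mfderiv_extChartAt_self

theorem chartSymmDeriv_self (x : M) :
    chartSymmDeriv x (extChartAt 𝓘(ℝ, E) x x) = ContinuousLinearMap.id ℝ E := by
  ext v
  have := chartSymmDeriv_chartDeriv (mem_extChartAt_source (I := 𝓘(ℝ, E)) x) v
  rwa [chartDeriv_self] at this

theorem localEnd_self (A : EndField E M) (x : M) :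
    localEnd A x (extChartAt 𝓘(ℝ, E) x x) = A x := by
  rw [localEnd, chartSymmDeriv_self, ContinuousLinearMap.comp_id]
  have h : (extChartAt 𝓘(ℝ, E) x).symm (extChartAt 𝓘(ℝ, E) x x) = x := extChartAt_to_inv x
  rw [h, chartDeriv_self]
  rfl

theorem deRham_eq (β : Form E M m) (x : M) :
    deRham β x = extDeriv (localForm β x) (extChartAt 𝓘(ℝ, E) x x) := by
  have h : chartDeriv x x = ContinuousLinearMap.id ℝ E := chartDeriv_self x
  ext v
  change extDeriv (localForm β x) (extChartAt 𝓘(ℝ, E) x x) (fun i => chartDeriv x x (v i)) = _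
  rw [h]
  rfl

theorem chartSymmDeriv_localEnd (A : EndField E M) {x₀ : M} {y : E}
    (hy : y ∈ (extChartAt 𝓘(ℝ, E) x₀).target) (v : E) :
    chartSymmDeriv x₀ y (localEnd A x₀ y v) =
      modelEnd A ((extChartAt 𝓘(ℝ, E) x₀).symm y) (chartSymmDeriv x₀ y v) :=
  chartSymmDeriv_chartDeriv_symm hy _

theorem localForm_hMul (A : EndField E M) (p : ℕ) (β : Form E M m) {x₀ : M} {y : E}
    (hy : y ∈ (extChartAt 𝓘(ℝ, E) x₀).target) :
    localForm (fun x => hMul (A x) m p (β x)) x₀ y =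
      hMul (localEnd A x₀ y) m p (localForm β x₀ y) := by
  ext v
  rw [localForm_apply, hMul_apply]
  refine (hMul_apply (V := E) _ _ _ _ _).trans ?_
  congr 1
  refine Finset.sum_congr rfl fun σ _ => ?_
  rw [localForm_apply]
  congr 1
  ext i
  split_ifs
  · rfl
  · rw [chartSymmDeriv_localEnd A hy]
    rfl

theorem localForm_mem_typeForms {I : EndField E M} {β : Form E M m} {p q : ℕ}
    (h : ∀ x, β x ∈ typeForms (I x) m p q) {x₀ : M} {y : E}
    (hy : y ∈ (extChartAt 𝓘(ℝ, E) x₀).target) :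
    localForm β x₀ y ∈ typeForms (localEnd I x₀ y) m p q := by
  intro z v
  refine Eq.trans ?_ (h _ z fun i => chartSymmDeriv x₀ y (v i))
  rw [localForm_apply]
  congr 1
  ext i
  rw [map_add, map_smul, map_smul, chartSymmDeriv_localEnd I hy]
  rfl

theorem localEnd_isQuaternionic {I J K : EndField E M}
    (h : ∀ x, IsQuaternionic (I x) (J x) (K x)) {x₀ : M} {y : E}
    (hy : y ∈ (extChartAt 𝓘(ℝ, E) x₀).target) :
    IsQuaternionic (localEnd I x₀ y) (localEnd J x₀ y) (localEnd K x₀ y) := by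
  have inj : ∀ u v, chartSymmDeriv x₀ y u = chartSymmDeriv x₀ y v → u = v := fun u v huv => by
    rw [← chartDeriv_chartSymmDeriv hy u, huv, chartDeriv_chartSymmDeriv hy v]
  refine ⟨fun v => inj _ _ ?_, fun v => inj _ _ ?_, fun v => inj _ _ ?_, fun v => inj _ _ ?_⟩ <;>
    simp only [map_neg, chartSymmDeriv_localEnd _ hy]
  · exact (h _).I_sq _
  · exact (h _).J_sq _
  · exact (h _).K_eq _
  · exact (h _).K_eq' _

theorem localEnd_combination (A : EndField E M) (a b : ℝ) {x₀ : M} {y : E}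
    (hy : y ∈ (extChartAt 𝓘(ℝ, E) x₀).target) :
    localEnd (fun x => a • ContinuousLinearMap.id ℝ _ + b • A x) x₀ y =
      a • ContinuousLinearMap.id ℝ E + b • localEnd A x₀ y := by
  ext v
  change chartDeriv x₀ _ (a • chartSymmDeriv x₀ y v +
    b • modelEnd A ((extChartAt 𝓘(ℝ, E) x₀).symm y) (chartSymmDeriv x₀ y v)) = _
  rw [map_add, map_smul, map_smul, chartDeriv_chartSymmDeriv hy]
  rfl

theorem IsSmoothEnd.combination {A : EndField E M} (hA : IsSmoothEnd A) (a b : ℝ) :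
    IsSmoothEnd (fun x => a • ContinuousLinearMap.id ℝ _ + b • A x) := fun x₀ =>
  ((contDiffOn_const (c := a • ContinuousLinearMap.id ℝ E)).add ((hA x₀).const_smul b)).congr
    fun _ hy => localEnd_combination A a b hy

theorem extChartAt_transition_contDiffAt {x₀ x : M} {y : E}
    (hy : y ∈ (extChartAt 𝓘(ℝ, E) x₀).target)
    (hx : (extChartAt 𝓘(ℝ, E) x₀).symm y ∈ (extChartAt 𝓘(ℝ, E) x).source) :
    ContDiffAt ℝ ∞ (fun z => extChartAt 𝓘(ℝ, E) x ((extChartAt 𝓘(ℝ, E) x₀).symm z)) y := by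
  have h₁ : ContMDiffAt 𝓘(ℝ, E) 𝓘(ℝ, E) ∞ (extChartAt 𝓘(ℝ, E) x₀).symm y :=
    (contMDiffOn_extChartAt_symm x₀).contMDiffAt ((isOpen_target x₀).mem_nhds hy)
  have h₂ : ContMDiffAt 𝓘(ℝ, E) 𝓘(ℝ, E) ∞ (extChartAt 𝓘(ℝ, E) x)
      ((extChartAt 𝓘(ℝ, E) x₀).symm y) :=
    contMDiffAt_extChartAt' (by rwa [extChartAt_source] at hx)
  exact (h₂.comp y h₁).contDiffAt

theorem fderiv_transition {x₀ x : M} {y : E}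
    (hy : y ∈ (extChartAt 𝓘(ℝ, E) x₀).target)
    (hx : (extChartAt 𝓘(ℝ, E) x₀).symm y ∈ (extChartAt 𝓘(ℝ, E) x).source) :
    fderiv ℝ (fun z => extChartAt 𝓘(ℝ, E) x ((extChartAt 𝓘(ℝ, E) x₀).symm z)) y =
      chartDeriv x ((extChartAt 𝓘(ℝ, E) x₀).symm y) ∘L chartSymmDeriv x₀ y := by
  have h₁ : MDifferentiableAt 𝓘(ℝ, E) 𝓘(ℝ, E) (extChartAt 𝓘(ℝ, E) x₀).symm y :=
    ((contMDiffOn_extChartAt_symm (n := ∞) x₀).contMDiffAt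
      ((isOpen_target x₀).mem_nhds hy)).mdifferentiableAt (by simp)
  have h₂ : MDifferentiableAt 𝓘(ℝ, E) 𝓘(ℝ, E) (extChartAt 𝓘(ℝ, E) x)
      ((extChartAt 𝓘(ℝ, E) x₀).symm y) :=
    (contMDiffAt_extChartAt' (n := ∞) (by rwa [extChartAt_source] at hx)).mdifferentiableAt (by simp)
  rw [← mfderiv_eq_fderiv]
  exact mfderiv_comp y h₂ h₁

theorem localForm_transition (β : Form E M m) {x₀ x : M} {y : E}
    (hy : y ∈ (extChartAt 𝓘(ℝ, E) x₀).target)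
    (hx : (extChartAt 𝓘(ℝ, E) x₀).symm y ∈ (extChartAt 𝓘(ℝ, E) x).source) :
    localForm β x₀ y = (localForm β x
      (extChartAt 𝓘(ℝ, E) x ((extChartAt 𝓘(ℝ, E) x₀).symm y))).compContinuousLinearMap
      (fderiv ℝ (fun z => extChartAt 𝓘(ℝ, E) x ((extChartAt 𝓘(ℝ, E) x₀).symm z)) y) := by
  ext v
  rw [fderiv_transition hy hx, localForm_apply,
    ContinuousAlternatingMap.compContinuousLinearMap_apply, localForm_apply]
  simp only [Function.comp_apply, ContinuousLinearMap.comp_apply, chartSymmDeriv_chartDeriv hx]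
  rw [(extChartAt 𝓘(ℝ, E) x).left_inv hx]

/-- The de Rham differential may be computed in any preferred chart. -/
theorem localForm_deRham {β : Form E M m} (hβ : IsSmooth β) {x₀ : M} {y : E}
    (hy : y ∈ (extChartAt 𝓘(ℝ, E) x₀).target) :
    localForm (deRham β) x₀ y = extDeriv (localForm β x₀) y := by
  -- `deRham` at each point uses the chart centred there. Comparison with the chart at `x₀` is
  -- naturality of the exterior derivative under the transition map.
  set x := (extChartAt 𝓘(ℝ, E) x₀).symm y with hxdef
  have hx : (extChartAt 𝓘(ℝ, E) x₀).symm y ∈ (extChartAt 𝓘(ℝ, E) x).source :=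
    mem_extChartAt_source x
  set τ := fun z => extChartAt 𝓘(ℝ, E) x ((extChartAt 𝓘(ℝ, E) x₀).symm z) with hτ
  have hcont : ContinuousAt (extChartAt 𝓘(ℝ, E) x₀).symm y := continuousAt_extChartAt_symm'' hy
  have e : localForm β x₀ =ᶠ[nhds y]
      fun z => (localForm β x (τ z)).compContinuousLinearMap (fderiv ℝ τ z) := by
    filter_upwards [(isOpen_target x₀).mem_nhds hy,
      hcont.preimage_mem_nhds ((isOpen_extChartAt_source x).mem_nhds hx)] with z hz hz'
    exact localForm_transition β hz hz'
  have hd : DifferentiableAt ℝ (localForm β x) (τ y) :=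
    ((hβ x).contDiffAt ((isOpen_target x).mem_nhds
      ((extChartAt 𝓘(ℝ, E) x).map_source hx))).differentiableAt (by simp)
  rw [e.extDeriv_eq, extDeriv_pullback hd (extChartAt_transition_contDiffAt hy hx)
    (by simp; exact WithTop.coe_le_coe.2 le_top), fderiv_transition hy hx]
  ext v
  rfl

theorem IsSmooth.hMul [FiniteDimensional ℝ E] {β : Form E M m} (hβ : IsSmooth β)
    {A : EndField E M} (hA : IsSmoothEnd A) (p : ℕ) :
    IsSmooth (fun x => Hypercomplex.hMul (A x) m p (β x)) := fun x₀ =>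
  (contDiffOn_hMul (hA x₀) (hβ x₀) p).congr fun _ hy => localForm_hMul A p β hy

theorem IsSmooth.deRham [FiniteDimensional ℝ E] {β : Form E M m} (hβ : IsSmooth β) : IsSmooth (deRham β) := fun x₀ =>
  (contDiffOn_extDeriv (isOpen_target x₀) (hβ x₀)).congr fun _ hy => localForm_deRham hβ hy

theorem IsSmooth.const_smul {β : Form E M m} (hβ : IsSmooth β) (c : ℂ) :
    IsSmooth (fun x => c • β x) := fun x₀ => (hβ x₀).const_smul c

theorem pull_circleProj {L I I' : E →L[ℝ] E} (h : ∀ v, L (I' v) = I (L v)) (j : ℤ)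
    (α : E [⋀^Fin m]→L[ℝ] ℂ) :
    pull m L (circleProj I m j α) = circleProj I' m j (pull m L α) := by
  simp only [circleProj, LinearMap.smul_apply, LinearMap.sum_apply, map_sum, map_smul]
  refine Finset.sum_congr rfl fun i _ => ?_
  congr 2
  ext v
  simp [pull_apply, complexAct_apply, h]

theorem IsSmooth.circleProj [FiniteDimensional ℝ E] {β : Form E M m} (hβ : IsSmooth β)
    {I : EndField E M} (hI : IsSmoothEnd I) (j : ℤ) :
    IsSmooth (fun x => Hypercomplex.circleProj (I x) m j (β x)) := fun x₀ =>
  (contDiffOn_circleProj (hI x₀) (hβ x₀) j).congr fun y hy =>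
    pull_circleProj (fun v => chartSymmDeriv_localEnd I hy v) j
      (modelForm β ((extChartAt 𝓘(ℝ, E) x₀).symm y))

end Charts

/-! ### Smoothness and integrability of complex structures in charts. -/

section ComplexStructures

variable {E : Type*} [NormedAddCommGroup E] [NormedSpace ℝ E]
  {M : Type*} [TopologicalSpace M] [ChartedSpace E M] [IsManifold 𝓘(ℝ, E) ∞ M]
  {I : EndField E M}

theorem continuousLinearMapAt_trivializationAt_apply {x₀ x : M} (hx : x ∈ (chartAt E x₀).source)
    (v : E) : (trivializationAt E (TangentSpace 𝓘(ℝ, E)) x₀).continuousLinearMapAt ℝ x v =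
      chartDeriv x₀ x v := by
  have : IsManifold 𝓘(ℝ, E) 1 M := isManifold_one
  exact congrArg (fun L : E →L[ℝ] E => L v)
    (TangentBundle.continuousLinearMapAt_trivializationAt (I := 𝓘(ℝ, E)) hx)

theorem symmL_trivializationAt_apply {x₀ x : M} (hx : x ∈ (chartAt E x₀).source) (v : E) :
    (trivializationAt E (TangentSpace 𝓘(ℝ, E)) x₀).symmL ℝ x v =
      chartSymmDeriv x₀ (extChartAt 𝓘(ℝ, E) x₀ x) v := by
  have : IsManifold 𝓘(ℝ, E) 1 M := isManifold_one
  have h := TangentBundle.symmL_trivializationAt (I := 𝓘(ℝ, E)) hx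
  rw [ModelWithCorners.range_eq_univ, mfderivWithin_univ] at h
  exact congrArg (fun L : E →L[ℝ] E => L v) h

/-- The trivialisation of the endomorphism bundle at `x₀` conjugates by the chart derivative, which
is exactly `localEnd`. -/
theorem IsComplexStructure.isSmoothEnd (h : IsComplexStructure I) : IsSmoothEnd I := by
  have : IsManifold 𝓘(ℝ, E) 1 M := isManifold_one
  intro x₀ y hy
  refine ContDiffAt.contDiffWithinAt ?_
  set x := (extChartAt 𝓘(ℝ, E) x₀).symm y with hxdef
  have hx : x ∈ (chartAt E x₀).source := by
    rw [← extChartAt_source 𝓘(ℝ, E)]; exact (extChartAt 𝓘(ℝ, E) x₀).map_target hy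
  have h₁ := (((trivializationAt (E →L[ℝ] E)
    (fun x : M => TangentSpace 𝓘(ℝ, E) x →L[ℝ] TangentSpace 𝓘(ℝ, E) x) x₀).contMDiffAt_iff
    (by simpa [hom_trivializationAt_source] using hx)).1 (h.smooth x)).2
  have h₂ : ContMDiffAt 𝓘(ℝ, E) 𝓘(ℝ, E) ∞ (extChartAt 𝓘(ℝ, E) x₀).symm y :=
    (contMDiffOn_extChartAt_symm x₀).contMDiffAt ((isOpen_target x₀).mem_nhds hy)
  refine ((h₁.comp y h₂).contDiffAt).congr_of_eventuallyEq ?_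
  filter_upwards [(isOpen_target x₀).mem_nhds hy] with z hz
  have hz' : (extChartAt 𝓘(ℝ, E) x₀).symm z ∈ (chartAt E x₀).source := by
    rw [← extChartAt_source 𝓘(ℝ, E)]; exact (extChartAt 𝓘(ℝ, E) x₀).map_target hz
  ext v
  have e₁ := symmL_trivializationAt_apply hz' v
  rw [(extChartAt 𝓘(ℝ, E) x₀).right_inv hz] at e₁
  have e₂ := continuousLinearMapAt_trivializationAt_apply hz'
    (modelEnd I ((extChartAt 𝓘(ℝ, E) x₀).symm z) (chartSymmDeriv x₀ z v))
  rw [← e₁] at e₂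
  refine (Eq.trans ?_ e₂.symm)
  rw [e₁]
  rfl

/-- The vector field that is constant in the preferred chart at `x₀`. -/
def chartField (x₀ : M) (u : E) (x : M) : TangentSpace 𝓘(ℝ, E) x :=
  chartSymmDeriv x₀ (extChartAt 𝓘(ℝ, E) x₀ x) u

theorem contMDiffAt_chartField (x₀ : M) (u : E) :
    ContMDiffAt 𝓘(ℝ, E) 𝓘(ℝ, E).tangent ∞
      (fun x => (⟨x, chartField x₀ u x⟩ : TangentBundle 𝓘(ℝ, E) M)) x₀ := by
  have : IsManifold 𝓘(ℝ, E) 1 M := isManifold_one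
  rw [Bundle.contMDiffAt_totalSpace]
  refine ⟨contMDiffAt_id, (contMDiffAt_const (c := u)).congr_of_eventuallyEq ?_⟩
  filter_upwards [(chartAt E x₀).open_source.mem_nhds (mem_chart_source E x₀)] with x hx
  have h := continuousLinearMapAt_trivializationAt_apply hx (chartField x₀ u x)
  have hx' : x ∈ (extChartAt 𝓘(ℝ, E) x₀).source := by rwa [extChartAt_source]
  have h' := chartDeriv_chartSymmDeriv ((extChartAt 𝓘(ℝ, E) x₀).map_source hx') u
  rw [(extChartAt 𝓘(ℝ, E) x₀).left_inv hx'] at h'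
  have h'' := h.trans h'
  rw [Bundle.Trivialization.continuousLinearMapAt_apply,
    Bundle.Trivialization.linearMapAt_apply, if_pos (by simpa using hx)] at h''
  exact h''

/-- The manifold bracket is defined by pulling back to the chart at x, whose derivative at x is the
identity. -/
theorem mlieBracket_eq (x : M) (X Y : ∀ y : M, TangentSpace 𝓘(ℝ, E) y) (V W : E → E)
    (hX : ∀ y ∈ (extChartAt 𝓘(ℝ, E) x).target,
      (X ((extChartAt 𝓘(ℝ, E) x).symm y) : E) = chartSymmDeriv x y (V y))
    (hY : ∀ y ∈ (extChartAt 𝓘(ℝ, E) x).target,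
      (Y ((extChartAt 𝓘(ℝ, E) x).symm y) : E) = chartSymmDeriv x y (W y)) :
    (VectorField.mlieBracket 𝓘(ℝ, E) X Y x : E) =
      fderiv ℝ W (extChartAt 𝓘(ℝ, E) x x) (V (extChartAt 𝓘(ℝ, E) x x)) -
      fderiv ℝ V (extChartAt 𝓘(ℝ, E) x x) (W (extChartAt 𝓘(ℝ, E) x x)) := by
  have : IsManifold 𝓘(ℝ, E) 1 M := isManifold_one
  have pull : ∀ (Z : ∀ y : M, TangentSpace 𝓘(ℝ, E) y) (T : E → E),
      (∀ y ∈ (extChartAt 𝓘(ℝ, E) x).target,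
        (Z ((extChartAt 𝓘(ℝ, E) x).symm y) : E) = chartSymmDeriv x y (T y)) →
      VectorField.mpullbackWithin 𝓘(ℝ, E) 𝓘(ℝ, E) (extChartAt 𝓘(ℝ, E) x).symm Z
        (Set.range 𝓘(ℝ, E)) =ᶠ[nhds (extChartAt 𝓘(ℝ, E) x x)] T := fun Z T hZ => by
    filter_upwards [(isOpen_target x).mem_nhds (mem_extChartAt_target x)] with y hy
    have hinv := isInvertible_mfderivWithin_extChartAt_symm (I := 𝓘(ℝ, E)) hy
    refine hinv.inverse_apply_eq.2 ?_
    rw [ModelWithCorners.range_eq_univ, mfderivWithin_univ]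
    exact hZ y hy
  rw [← VectorField.mlieBracketWithin_univ, VectorField.mlieBracketWithin_apply]
  have hinv := isInvertible_mfderiv_extChartAt (I := 𝓘(ℝ, E)) (mem_extChartAt_source (I := 𝓘(ℝ, E)) x)
  refine hinv.inverse_apply_eq.2 ?_
  have e := Filter.EventuallyEq.lieBracket_vectorField_eq (𝕜 := ℝ) (pull X V hX) (pull Y W hY)
  rw [Set.preimage_univ, Set.univ_inter, ModelWithCorners.range_eq_univ]
  rw [ModelWithCorners.range_eq_univ] at e
  refine (congrFun (VectorField.lieBracketWithin_univ (𝕜 := ℝ) (E := E)) _).trans (e.trans ?_)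
  exact congrArg (fun L : E →L[ℝ] E => L _) (chartDeriv_self x).symm

/-- Integrability is tested on fields constant in the chart: their mutual bracket vanishes, and the
other brackets only differentiate the structure. -/
theorem IsComplexStructure.nijenhuis_eq_zero (h : IsComplexStructure I) (x : M) (u v : E) :
    nijenhuis (localEnd I x (extChartAt 𝓘(ℝ, E) x x))
      (fderiv ℝ (localEnd I x) (extChartAt 𝓘(ℝ, E) x x)) u v = 0 := by
  set y₀ := extChartAt 𝓘(ℝ, E) x x with hy₀
  have hd : DifferentiableAt ℝ (localEnd I x) y₀ :=
    ((h.isSmoothEnd x).contDiffAt ((isOpen_target x).mem_nhds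
      (mem_extChartAt_target x))).differentiableAt (by simp)
  have hc : ∀ w, ∀ y ∈ (extChartAt 𝓘(ℝ, E) x).target,
      (chartField x w ((extChartAt 𝓘(ℝ, E) x).symm y) : E) = chartSymmDeriv x y w :=
    fun w y hy => by
      rw [chartField, (extChartAt 𝓘(ℝ, E) x).right_inv hy]
  have hI : ∀ w, ∀ y ∈ (extChartAt 𝓘(ℝ, E) x).target,
      (I _ (chartField x w ((extChartAt 𝓘(ℝ, E) x).symm y)) : E) =
        chartSymmDeriv x y (localEnd I x y w) := fun w y hy => by
    rw [chartSymmDeriv_localEnd I hy, ← hc w y hy]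
    rfl
  have key := h.integrable x _ _ (contMDiffAt_chartField x u) (contMDiffAt_chartField x v)
  have f : ∀ w, fderiv ℝ (fun y => localEnd I x y w) y₀ =
      (fderiv ℝ (localEnd I x) y₀).flip w := fun w => by
    rw [fderiv_clm_apply hd (differentiableAt_const _)]
    simp
  have e₁ := mlieBracket_eq x (fun y => I y (chartField x u y))
    (fun y => I y (chartField x v y)) _ _ (hI u) (hI v)
  have e₂ := mlieBracket_eq x (fun y => I y (chartField x u y)) (chartField x v) _ (fun _ => v) (hI u) (hc v)
  have e₃ := mlieBracket_eq x (chartField x u) (fun y => I y (chartField x v y)) (fun _ => u) _ (hc u) (hI v)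
  have e₄ := mlieBracket_eq x (chartField x u) (chartField x v) (fun _ => u) (fun _ => v) (hc u) (hc v)
  rw [f, f] at e₁
  rw [f] at e₂ e₃
  have e₅ : (I x : E →L[ℝ] E) = localEnd I x y₀ := (localEnd_self I x).symm
  have key' : ∀ (L : E →L[ℝ] E) (b₁ b₂ b₃ b₄ c₁ c₂ c₃ c₄ : E), b₁ = c₁ → b₂ = c₂ → b₃ = c₃ →
      b₄ = c₄ → b₁ - L b₂ - L b₃ - b₄ = 0 → c₁ - L c₂ - L c₃ - c₄ = 0 := by
    rintro L _ _ _ _ _ _ _ _ rfl rfl rfl rfl hb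
    exact hb
  have e := key' (I x) _ _ _ _ _ _ _ _ e₁ e₂ e₃ e₄ key
  rw [e₅] at e
  simp only [fderiv_fun_const, Pi.zero_apply, zero_apply, ContinuousLinearMap.flip_apply, zero_sub,
    sub_zero, map_neg, sub_neg_eq_add, ← hy₀] at e
  exact e

end ComplexStructures

/-! ### The theorem on the manifold. -/

section HypercomplexManifold

variable {E : Type*} [NormedAddCommGroup E] [NormedSpace ℝ E] [FiniteDimensional ℝ E]
  {M : Type*} [TopologicalSpace M] [ChartedSpace E M] [IsManifold 𝓘(ℝ, E) ∞ M] {m : ℕ}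
  {I J K : EndField E M}

instance finiteDimensional_tangentSpace (x : M) :
    FiniteDimensional ℝ (TangentSpace 𝓘(ℝ, E) x) := inferInstanceAs (FiniteDimensional ℝ E)

instance t2Space_tangentSpace (x : M) : T2Space (TangentSpace 𝓘(ℝ, E) x) :=
  inferInstanceAs (T2Space E)

theorem IsHypercomplex.isQuaternionic (h : IsHypercomplex I J K) (x : M) :
    IsQuaternionic (I x) (J x) (K x) :=
  ⟨h.complexI.sq_eq x, h.complexJ.sq_eq x, h.mul_IJ x, h.mul_JI x⟩

theorem IsSmooth.pull {β : Form E M m} (hβ : IsSmooth β) {A : EndField E M}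
    (hA : IsSmoothEnd A) : IsSmooth (fun x => Hypercomplex.pull m (A x) (β x)) := by
  have e : (fun x => Hypercomplex.pull m (A x) (β x)) =
      fun x => Hypercomplex.hMul (A x) m 0 (β x) :=
    funext fun x => (hMul_zero_eq_pull (E := E) (β x)).symm
  rw [e]
  exact hβ.hMul hA 0

theorem IsSmooth.pull_combination {β : Form E M m} (hβ : IsSmooth β) {A : EndField E M}
    (hA : IsSmoothEnd A) {a b : ℝ} {B : EndField E M} (hB : ∀ x v, B x v = a • v + b • A x v) :
    IsSmooth (fun x => Hypercomplex.pull m (B x) (β x)) := by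
  have e : B = fun x => a • ContinuousLinearMap.id ℝ _ + b • A x := by
    ext x v
    exact hB x v
  rw [e]
  exact hβ.pull (hA.combination a b)

theorem IsHypercomplex.isSmooth_hDiv (h : IsHypercomplex I J K) {β : Form E M m}
    (hβ : IsSmooth β) (q : ℕ) : IsSmooth (fun x => hDiv (I x) (J x) m q (β x)) :=
  ((hβ.pull_combination h.complexJ.isSmoothEnd (a := 1) (b := 1)
    (B := fun x => ContinuousLinearMap.id ℝ _ + J x) fun x v => by simp).circleProj
      h.complexI.isSmoothEnd _).const_smul _

theorem IsComplexStructure.isSmooth_projAlong (h : IsComplexStructure I) {β : Form E M m}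
    (hβ : IsSmooth β) {p q : ℕ} (hpq : p + q = m) : IsSmooth (fun x =>
      projAlong (typeForms (I x) m p q) (otherTypeForms (I x) m p q) (β x)) := by
  have e : (fun x => projAlong (typeForms (I x) m p q) (otherTypeForms (I x) m p q) (β x)) =
      fun x => circleProj (I x) m ((p : ℤ) - q) (β x) :=
    funext fun x => projAlong_typeForms (h.sq_eq x) hpq (β x)
  rw [e]
  exact hβ.circleProj h.isSmoothEnd _

theorem IsComplexStructure.isSmooth_del (h : IsComplexStructure I) {η : Form E M m}
    (hη : IsSmooth η) : IsSmooth (del I m 0 η) :=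
  h.isSmooth_projAlong hη.deRham (add_zero _)

theorem IsHypercomplex.isSmooth_delJ (h : IsHypercomplex I J K) {η : Form E M m}
    (hη : IsSmooth η) : IsSmooth (delJ I J η) :=
  (h.complexI.isSmooth_projAlong (hη.pull h.complexJ.isSmoothEnd).deRham
    (zero_add _)).pull_combination h.complexJ.isSmoothEnd (a := 0) (b := -1)
      (B := fun x => -(J x)) fun x v => by simp

/-- Pulling back by the antilinear -J turns the action of z into that of its conjugate, so type
(0,m+1) becomes (m+1,0). -/
theorem IsHypercomplex.delJ_mem_typeForms (h : IsHypercomplex I J K) (η : Form E M m) (x : M) :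
    delJ I J η x ∈ typeForms (I x) (m + 1) (m + 1) 0 := by
  intro z v
  have hx := h.isQuaternionic x
  have h₁ := projAlong_typeForms_mem hx.I_sq 0 (m + 1) (deRham (fun y => pull m (J y) (η y)) x)
    (starRingEnd ℂ z) fun i => -(J x (v i))
  refine Eq.trans ?_ (h₁.trans ?_)
  · rw [delJ, pull_apply]
    congr 1
    ext i
    simp only [neg_apply, map_add, map_neg, map_smul, hx.I_J, Complex.conj_re, Complex.conj_im]
    module
  · rw [Complex.conj_conj, delJ, pull_apply]
    simp only [pow_zero, one_mul, mul_one]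
    rfl

/-- Injectivity is fibrewise; surjectivity needs the preimage to be smooth, which the explicit
inverse `hDiv` provides. -/
theorem IsHypercomplex.bijOn_isSmooth_hMul (h : IsHypercomplex I J K) {p q : ℕ}
    (hpq : p + q = m) :
    Set.BijOn (fun (η : Form E M m) (x : M) => hMul (J x) m p (η x))
      {η | IsSmooth η ∧ ∀ x, η x ∈ typeForms (I x) m m 0}
      {β | IsSmooth β ∧ ∀ x, β x ∈ plusTypeForms (I x) (J x) (K x) m p q} := by
  refine ⟨fun η hη => ⟨hη.1.hMul h.complexJ.isSmoothEnd p, fun x =>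
    (h.isQuaternionic x).hMul_mem_plusTypeForms hpq (hη.2 x)⟩, fun η hη θ hθ e => ?_,
    fun β hβ => ?_⟩
  · ext x : 1
    exact ((h.isQuaternionic x).bijOn_hMul hpq).injOn (hη.2 x) (hθ.2 x) (congrFun e x)
  · have key : ∀ x, hDiv (I x) (J x) m q (β x) ∈ typeForms (I x) m m 0 ∧
        hMul (J x) m p (hDiv (I x) (J x) m q (β x)) = β x := fun x => by
      obtain ⟨α, hα, e⟩ := (h.isQuaternionic x).mem_plusTypeForms hpq (hβ.2 x)
      rw [← e, (h.isQuaternionic x).hDiv_hMul hpq hα]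
      exact ⟨hα, rfl⟩
    exact ⟨fun x => hDiv (I x) (J x) m q (β x), ⟨h.isSmooth_hDiv hβ.1 q, fun x => (key x).1⟩,
      funext fun x => (key x).2⟩

theorem IsHypercomplex.dPlus_hMul (h : IsHypercomplex I J K) {p q : ℕ} (hpq : p + q = m)
    {η : Form E M m} (hη : IsSmooth η) (hηt : ∀ x, η x ∈ typeForms (I x) m m 0) (x : M) :
    dPlus I J K (fun y => hMul (J y) m p (η y)) x =
      hMul (J x) (m + 1) (p + 1) (del I m 0 η x) + hMul (J x) (m + 1) p (delJ I J η x) := by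
  set y₀ := extChartAt 𝓘(ℝ, E) x x with hy₀
  have hnhds : (extChartAt 𝓘(ℝ, E) x).target ∈ nhds y₀ :=
    (isOpen_target x).mem_nhds (mem_extChartAt_target x)
  have diff : ∀ {F : Type _} [NormedAddCommGroup F] [NormedSpace ℝ F] {f : E → F},
      ContDiffOn ℝ ∞ f (extChartAt 𝓘(ℝ, E) x).target → DifferentiableAt ℝ f y₀ := fun hf =>
    (hf.contDiffAt hnhds).differentiableAt (by simp)
  have hJ := h.complexJ.isSmoothEnd x
  have key := projAlong_extDeriv_hMul (diff (h.complexI.isSmoothEnd x)) (diff hJ)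
    (K := localEnd K x)
    (Filter.eventually_of_mem hnhds fun y hy => localEnd_isQuaternionic h.isQuaternionic hy)
    (h.complexI.nijenhuis_eq_zero x) (h.complexJ.nijenhuis_eq_zero x) hpq (diff (hη x))
    (Filter.eventually_of_mem hnhds fun y hy => localForm_mem_typeForms hηt hy)
    fun r => diff (contDiffOn_hMul hJ (hη x) r)
  have e₁ : extDeriv (fun y => hMul (localEnd J x y) m p (localForm η x y)) y₀ =
      deRham (fun y => hMul (J y) m p (η y)) x := by
    rw [deRham_eq]
    exact (Filter.eventuallyEq_of_mem hnhds fun y hy => localForm_hMul J p η hy).symm.extDeriv_eq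
  have e₂ : extDeriv (fun y => pull m (localEnd J x y) (localForm η x y)) y₀ =
      deRham (fun y => pull m (J y) (η y)) x := by
    rw [deRham_eq]
    refine (Filter.eventuallyEq_of_mem hnhds fun y hy => ?_).symm.extDeriv_eq
    have := localForm_hMul J 0 η hy
    rw [hMul_zero_eq_pull] at this
    rw [← this]
    exact congrArg (fun β : Form E M m => localForm β x y)
      (funext fun z => (hMul_zero_eq_pull (E := E) (η z)).symm)
  -- At the centre of its own chart the local expressions of I, J, K are their actual values, so the
  -- local identity is the claim.
  rw [e₁, e₂, ← deRham_eq, localEnd_self, localEnd_self, localEnd_self] at key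
  exact key

end HypercomplexManifold

end Hypercomplex

end

theorem mainTheorem8 (n : ℕ) {M : Type*} [TopologicalSpace M]
    [ChartedSpace (EuclideanSpace ℝ (Fin (4 * n))) M]
    [IsManifold 𝓘(ℝ, EuclideanSpace ℝ (Fin (4 * n))) ∞ M]
    (I J K : Hypercomplex.EndField (EuclideanSpace ℝ (Fin (4 * n))) M)
    (hIJK : Hypercomplex.IsHypercomplex I J K) :
    -- the decompositions that define `∂`, `∂̄` and `d_+` are direct
    (∀ (m : ℕ) (x : M),
      IsCompl (Hypercomplex.plusForms (I x) (J x) (K x) m)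
        (Hypercomplex.lowForms (I x) (J x) (K x) m)) ∧
    (∀ (m p q : ℕ) (x : M),
      IsCompl (Hypercomplex.typeForms (I x) m p q)
        (Hypercomplex.otherTypeForms (I x) m p q)) ∧
    ∀ m p q : ℕ, p + q = m →
      -- `η ↦ h₁ ^ p h₂ ^ q η` is an isomorphism of `Λ^{p+q,0}_I` with `Λ^{p,q}_{I,+}`,
      -- fibre by fibre
      (∀ x : M, Set.BijOn (Hypercomplex.hMul (J x) m p)
        (Hypercomplex.typeForms (I x) m m 0)
        (Hypercomplex.plusTypeForms (I x) (J x) (K x) m p q)) ∧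
      -- and on smooth forms
      Set.BijOn
        (fun (η : Hypercomplex.Form (EuclideanSpace ℝ (Fin (4 * n))) M m) (x : M) =>
          Hypercomplex.hMul (J x) m p (η x))
        {η | Hypercomplex.IsSmooth η ∧ ∀ x, η x ∈ Hypercomplex.typeForms (I x) m m 0}
        {β | Hypercomplex.IsSmooth β ∧
          ∀ x, β x ∈ Hypercomplex.plusTypeForms (I x) (J x) (K x) m p q} ∧
      -- under these isomorphisms `d_+` is `∂ ⊕ ∂_J`
      ∀ η : Hypercomplex.Form (EuclideanSpace ℝ (Fin (4 * n))) M m,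
        Hypercomplex.IsSmooth η → (∀ x, η x ∈ Hypercomplex.typeForms (I x) m m 0) →
        (Hypercomplex.IsSmooth (Hypercomplex.del I m 0 η) ∧
          ∀ x, Hypercomplex.del I m 0 η x ∈
            Hypercomplex.typeForms (I x) (m + 1) (m + 1) 0) ∧
        (Hypercomplex.IsSmooth (Hypercomplex.delJ I J η) ∧
          ∀ x, Hypercomplex.delJ I J η x ∈
            Hypercomplex.typeForms (I x) (m + 1) (m + 1) 0) ∧
        ∀ x, Hypercomplex.dPlus I J K (fun y => Hypercomplex.hMul (J y) m p (η y)) x =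
          Hypercomplex.hMul (J x) (m + 1) (p + 1) (Hypercomplex.del I m 0 η x) +
          Hypercomplex.hMul (J x) (m + 1) p (Hypercomplex.delJ I J η x) := by
  open Hypercomplex in
  exact ⟨fun m x => (hIJK.isQuaternionic x).isCompl_plusForms m,
    fun m p q x => isCompl_typeForms (hIJK.isQuaternionic x).I_sq m p q,
    fun m p q hpq => ⟨fun x => (hIJK.isQuaternionic x).bijOn_hMul hpq,
      hIJK.bijOn_isSmooth_hMul hpq, fun η hη hηt =>
        ⟨⟨hIJK.complexI.isSmooth_del hη, fun x =>
            projAlong_typeForms_mem (hIJK.isQuaternionic x).I_sq (m + 1) 0 (deRham η x)⟩,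
          ⟨hIJK.isSmooth_delJ hη, hIJK.delJ_mem_typeForms η⟩, hIJK.dPlus_hMul hpq hη hηt⟩⟩⟩
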